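/- **Setting.** Everything is over $\mathbb C$. Let $n\ge 1$, let $\mathfrak g$ be a finite-dimensional simple Lie algebra, and let $\sigma_0,\dots,\sigma_n$ be commuting automorphisms of $\mathfrak g$ of finite orders $m_0,\dots,m_n$, with primitive $m_i$-th roots of unity $\xi_i$. Let $(\cdot,\cdot)$ be a positive real multiple of the Killing form of $\mathfrak g$. For $(k_0,k)\in\mathbb Z\times\mathbb Z^n$ put $\mathfrak g(\bar k_0,\bar k)=\{x\in\mathfrak g:\sigma_i x=\xi_i^{k_i}x,\ 0\le i\le n\}$, and let $\Gamma_0=m_0\mathbb Z$, $\Gamma=m_1\mathbb Z\oplus\dots\oplus m_n\mathbb Z$. Let $$\tau=\bigoplus_{(k_0,k)}\mathfrak g(\bar k_0,\bar k)\otimes t_0^{k_0}t^k\ \oplus\ Z\ \oplus\ D,$$ where $D$ has basis $t_0^{r_0}t^rd_i$ and $Z$ is spanned by $t_0^{r_0}t^rK_i$ ($0\le i\le n$, $r_0\in\Gamma_0$, $r\in\Gamma$) modulo the relations $\sum_i r_i\,t_0^{r_0}t^rK_i=0$. Write $X(k_0,k)=X\otimes t_0^{k_0}t^k$. The bracket is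 $$[X(k_0,k),Y(l_0,l)]=[X,Y](k_0+l_0,k+l)+(X,Y)\sum_i k_i\,t_0^{k_0+l_0}t^{k+l}K_i,$$ $$[t_0^{r_0}t^rd_a,X(k_0,k)]=k_aX(k_0+r_0,k+r),\qquad [Z,Z]=[Z,X(k_0,k)]=0,$$ $$[t_0^{r_0}t^rd_a,t_0^{s_0}t^sK_b]=s_a\,t_0^{r_0+s_0}t^{r+s}K_b+\delta_{ab}\sum_p r_p\,t_0^{r_0+s_0}t^{r+s}K_p,$$ $$[t_0^{r_0}t^rd_a,t_0^{s_0}t^sd_b]=s_a\,t_0^{r_0+s_0}t^{r+s}d_b-r_b\,t_0^{r_0+s_0}t^{r+s}d_a+(-a_1s_ar_b+a_2r_as_b)\sum_p r_p\,t_0^{r_0+s_0}t^{r+s}K_p,$$ for fixed $a_1,a_2\in\mathbb C$. Here $K_i=t_0^0t^0K_i$ and $d_i=t_0^0t^0d_i$. Assume that $\mathfrak g(\bar 0,\bar 0)$ is simple, with a Cartan subalgebra $\mathfrak h(0)$ contained in a Cartan subalgebra of $\mathfrak g$. Let $\Delta_0^\times$ be the set of roots of $(\mathfrak g(\bar0,\bar0),\mathfrak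 h(0))$. Let $\Delta_{0,en}=\{0\}\cup\Delta_0^\times$, enlarged by the doubles of the short roots (the roots of minimal length) if $\Delta_0^\times$ is of type $B_l$, $l\ge1$ (where $B_1=A_1$). Assume that the set of $\mathfrak h(0)$-weights of $\mathfrak g$ is contained in $\Delta_{0,en}$. Fix simple roots $\alpha_1,\dots,\alpha_p$ of $\Delta_0^\times$ and let $\beta_0$ be the maximal root in $\Delta_{0,en}$, i.e. $\beta_0-\alpha$ is an $\mathbb N$-combination of $\alpha_1,\dots,\alpha_p$ for every $\alpha\in\Delta_{0,en}$. Let $H=\mathfrak h(0)\oplus\sum_i\mathbb CK_i\oplus\sum_i\mathbb Cd_i$. Functionals on $\mathfrak h(0)$ are extended by $0$ to $H$. Let $\delta_i\in H^*$ be zero on $\mathfrak h(0)$ and on all $K_j$, with $\delta_i(d_j)=\delta_{ij}$, and let $\delta_k=\sum_{i=1}^nk_i\delta_i$ for $k\in\mathbb Z^n$. Put $\alpha_0=-\beta_0+\delta_0$ and $Q^+=\bigoplus_{i=0}^p\mathbb N\alpha_i$. For $\beta\in H^*$ write $\beta>0$ if $0\ne\beta\in Q^+$, and $\beta<0$ if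 $-\beta>0$. Let $\mathfrak g(\bar k_0,\bar k,\alpha)$ be the $\alpha$-weight space of $\mathfrak h(0)$ in $\mathfrak g(\bar k_0,\bar k)$. Let $\tau^{\pm}$ be the span of all $\mathfrak g(\bar k_0,\bar k,\alpha)\otimes t_0^{k_0}t^k$ with $\pm(\alpha+k_0\delta_0)>0$ and all $t_0^{r_0}t^rK_i$, $t_0^{r_0}t^rd_i$ with $\pm r_0>0$, and let $\tau^0$ be the span of all $\mathfrak g(\bar 0,\bar k,0)\otimes t^k$, $t^rK_i$, $t^rd_i$ (with $r_0\in\Gamma_0$, $r\in\Gamma$ throughout). A $\tau$-module $V$ is *integrable* if it is the direct sum of its weight spaces $V_\mu$ $(\mu\in H^*)$, each $V_\mu$ is finite-dimensional, and every element of $\mathfrak g(\bar k_0,\bar k,\alpha)\otimes t_0^{k_0}t^k$ with $\alpha\neq0$ acts locally nilpotently. Let $P(V)=\{\mu\in H^*:V_\mu\ne0\}$. **Theorem 5.3.** Let $V$ be an irreducible integrable $\tau$-module on which $K_0$ acts as a real scalar $C_0>0$ and $K_1,\dots,K_n$ act as zero. Then there is $\gamma\in P(V)$ such that $\gamma+\beta+\delta_k\notin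 P(V)$ for all $\beta>0$ and all $k\in\mathbb Z^n$. Moreover $\tau=\tau^-\oplus\tau^0\oplus\tau^+$ as vector spaces, and the highest weight space $\{v\in V:\tau^+v=0\}$ is nonzero. -/

import Mathlib

noncomputable section

open Module

namespace Toroidal

/-- The lattice `ℤ^(n+1)` of exponents `(k_0, k_1, …, k_n)`. -/
abbrev Deg (n : ℕ) : Type := Fin (n + 1) → ℤ

/-- `ℂ^(n+1)`, the space of coefficient vectors of `K_0, …, K_n` and of `d_0, …, d_n`. -/
abbrev Vec (n : ℕ) : Type := Fin (n + 1) → ℂ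

/-- An exponent seen as a complex vector. -/
def Deg.toVec {n : ℕ} (r : Deg n) : Vec n := fun i => (r i : ℂ)

section Convolution

variable {n : ℕ} {M N P : Type*} [AddCommGroup M] [Module ℂ M] [AddCommGroup N] [Module ℂ N]
  [AddCommGroup P] [Module ℂ P]

/-- The bilinear map on `M ⊗ A` and `N ⊗ A` (with `A` the Laurent polynomials, and `x ⊗ t^r`
written `Finsupp.single r x`) sending `(x ⊗ t^r, y ⊗ t^s)` to `φ r s x y ⊗ t^(r+s)`. -/
def conv (φ : Deg n → Deg n → M →ₗ[ℂ] N →ₗ[ℂ] P) :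
    (Deg n →₀ M) →ₗ[ℂ] (Deg n →₀ N) →ₗ[ℂ] (Deg n →₀ P) :=
  Finsupp.lsum ℂ fun r => LinearMap.flip <| Finsupp.lsum ℂ fun s =>
    LinearMap.flip ((φ r s).compr₂ (Finsupp.lsingle (r + s)))

@[simp] theorem conv_single (φ : Deg n → Deg n → M →ₗ[ℂ] N →ₗ[ℂ] P) (r s : Deg n) (x : M) (y : N) :
    conv φ (Finsupp.single r x) (Finsupp.single s y) = Finsupp.single (r + s) (φ r s x y) := by
  simp [conv]

end Convolution

section Centre

variable (n : ℕ)

/-- `dA ⊆ ΩA`: the span of the elements `∑ k_i t^k K_i`. Here `ΩA` is `Deg n →₀ Vec n`, the element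
`∑ w_i t^k K_i` being `Finsupp.single k w`. -/
def dA : Submodule ℂ (Deg n →₀ Vec n) :=
  Submodule.span ℂ (Set.range fun k : Deg n => Finsupp.single k k.toVec)

/-- `ΩA / dA`. -/
abbrev Omega : Type := (Deg n →₀ Vec n) ⧸ dA n

variable {n}

/-- The coefficient of `[∑ u_a t^r d_a, ∑ w_b t^s K_b]`, before passing to the quotient by `dA`. -/
def derOnOmega (r s : Deg n) : Vec n →ₗ[ℂ] Vec n →ₗ[ℂ] Vec n :=
  LinearMap.mk₂ ℂ (fun u w => (u ⬝ᵥ s.toVec) • w + (u ⬝ᵥ w) • r.toVec)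
    (fun a b c => by simp only [add_dotProduct]; module)
    (fun a b c => by simp only [smul_dotProduct, smul_eq_mul]; module)
    (fun a b c => by simp only [dotProduct_add]; module)
    (fun a b c => by simp only [dotProduct_smul, smul_eq_mul]; module)

@[simp] theorem derOnOmega_apply (r s : Deg n) (u w : Vec n) :
    derOnOmega r s u w = (u ⬝ᵥ s.toVec) • w + (u ⬝ᵥ w) • r.toVec := rfl

theorem toVec_add (r s : Deg n) : (r + s).toVec = r.toVec + s.toVec := by
  ext i; simp [Deg.toVec]

theorem single_toVec_mem (k : Deg n) (c : ℂ) :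
    Finsupp.single k (c • k.toVec) ∈ dA n := by
  rw [← Finsupp.smul_single]
  exact Submodule.smul_mem _ _ (Submodule.subset_span ⟨k, rfl⟩)

theorem dA_le_ker : dA n ≤ LinearMap.ker ((conv derOnOmega).compr₂ (dA n).mkQ).flip := by
  refine Submodule.span_le.2 ?_
  rintro _ ⟨s, rfl⟩
  refine LinearMap.mem_ker.2 (Finsupp.lhom_ext fun r u => ?_)
  simp only [LinearMap.flip_apply, LinearMap.compr₂_apply, conv_single, LinearMap.zero_apply,
    Submodule.mkQ_apply, Submodule.Quotient.mk_eq_zero, derOnOmega_apply]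
  rw [← smul_add, add_comm s.toVec, ← toVec_add]
  exact single_toVec_mem _ _

/-- The action of `Der A` on `ΩA / dA`. -/
def derAct : Omega n →ₗ[ℂ] (Deg n →₀ Vec n) →ₗ[ℂ] Omega n :=
  Submodule.liftQ (dA n) ((conv derOnOmega).compr₂ (dA n).mkQ).flip dA_le_ker

end Centre

section Full

set_option linter.unusedSimpArgs false

/-- The (untwisted) full toroidal Lie algebra `g ⊗ A ⊕ ΩA/dA ⊕ Der A` in the `n + 1` variables
`t_0, …, t_n`, for the invariant form `(x, y) = c · Killing(x, y)` on `g` and the cocycle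
`φ = a₁ φ₁ + a₂ φ₂`. The parameters `c`, `a₁`, `a₂` only enter the bracket. -/
def Full (g : Type*) [LieRing g] [LieAlgebra ℂ g] (n : ℕ) (_c : ℝ) (_a₁ _a₂ : ℂ) : Type _ :=
  (Deg n →₀ g) × Omega n × (Deg n →₀ Vec n)

variable {g : Type*} [LieRing g] [LieAlgebra ℂ g] {n : ℕ} {c : ℝ} {a₁ a₂ : ℂ}

instance : AddCommGroup (Full g n c a₁ a₂) :=
  inferInstanceAs (AddCommGroup ((Deg n →₀ g) × Omega n × (Deg n →₀ Vec n)))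

instance : Module ℂ (Full g n c a₁ a₂) :=
  inferInstanceAs (Module ℂ ((Deg n →₀ g) × Omega n × (Deg n →₀ Vec n)))

/-- `X ↦ X ⊗ t^k`. -/
def X (k : Deg n) : g →ₗ[ℂ] Full g n c a₁ a₂ :=
  (LinearMap.inl ℂ (Deg n →₀ g) (Omega n × (Deg n →₀ Vec n))).comp (Finsupp.lsingle k)

/-- `w ↦ ∑ w_i t^k K_i`. -/
def K (k : Deg n) : Vec n →ₗ[ℂ] Full g n c a₁ a₂ :=
  (LinearMap.inr ℂ (Deg n →₀ g) (Omega n × (Deg n →₀ Vec n))).comp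
    ((LinearMap.inl ℂ (Omega n) (Deg n →₀ Vec n)).comp ((dA n).mkQ.comp (Finsupp.lsingle k)))

/-- `u ↦ ∑ u_i t^k d_i`. -/
def D (k : Deg n) : Vec n →ₗ[ℂ] Full g n c a₁ a₂ :=
  (LinearMap.inr ℂ (Deg n →₀ g) (Omega n × (Deg n →₀ Vec n))).comp
    ((LinearMap.inr ℂ (Omega n) (Deg n →₀ Vec n)).comp (Finsupp.lsingle k))

variable (g n c a₁ a₂)

/-- The projection to `g ⊗ A`. -/
def prX : Full g n c a₁ a₂ →ₗ[ℂ] (Deg n →₀ g) := LinearMap.fst ℂ _ _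

/-- The projection to `ΩA/dA`. -/
def prK : Full g n c a₁ a₂ →ₗ[ℂ] Omega n := (LinearMap.fst ℂ _ _).comp (LinearMap.snd ℂ _ _)

/-- The projection to `Der A`. -/
def prD : Full g n c a₁ a₂ →ₗ[ℂ] (Deg n →₀ Vec n) :=
  (LinearMap.snd ℂ _ _).comp (LinearMap.snd ℂ _ _)

/-- `[X ⊗ t^k, Y ⊗ t^l]`, the part in `g ⊗ A`. -/
def loopBr : Deg n → Deg n → g →ₗ[ℂ] g →ₗ[ℂ] g := fun _ _ => LieModule.toEnd ℂ g g

/-- `[X ⊗ t^k, Y ⊗ t^l]`, the part in `ΩA/dA`: `(X, Y) ∑ k_i t^(k+l) K_i`. -/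
def loopCocycle : Deg n → Deg n → g →ₗ[ℂ] g →ₗ[ℂ] Vec n := fun k _ =>
  ((c : ℂ) • killingForm ℂ g).compr₂ (LinearMap.toSpanSingleton ℂ (Vec n) k.toVec)

/-- `[∑ u_a t^r d_a, X ⊗ t^k] = (∑ u_a k_a) X ⊗ t^(k+r)`. -/
def derOnLoop : Deg n → Deg n → Vec n →ₗ[ℂ] g →ₗ[ℂ] g := fun _ k =>
  LinearMap.mk₂ ℂ (fun u x => (u ⬝ᵥ k.toVec) • x)
    (fun a b d => by simp only [add_dotProduct]; module)
    (fun a b d => by simp only [smul_dotProduct, smul_eq_mul]; module)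
    (fun a b d => by module)
    (fun a b d => by module)

/-- `[∑ u_a t^r d_a, ∑ v_b t^s d_b]`, the part in `Der A`:
`∑ u_a v_b (s_a t^(r+s) d_b - r_b t^(r+s) d_a)`. -/
def derBr : Deg n → Deg n → Vec n →ₗ[ℂ] Vec n →ₗ[ℂ] Vec n := fun r s =>
  LinearMap.mk₂ ℂ (fun u v => (u ⬝ᵥ s.toVec) • v - (v ⬝ᵥ r.toVec) • u)
    (fun a b d => by simp only [add_dotProduct]; module)
    (fun a b d => by simp only [smul_dotProduct, smul_eq_mul]; module)
    (fun a b d => by simp only [add_dotProduct]; module)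
    (fun a b d => by simp only [smul_dotProduct, smul_eq_mul]; module)

/-- `[∑ u_a t^r d_a, ∑ v_b t^s d_b]`, the part in `ΩA/dA`: the cocycle `a₁ φ₁ + a₂ φ₂` with
`φ₁(t^r d_a, t^s d_b) = - s_a r_b ∑ r_p t^(r+s) K_p` and
`φ₂(t^r d_a, t^s d_b) = r_a s_b ∑ r_p t^(r+s) K_p`. -/
def derCocycle : Deg n → Deg n → Vec n →ₗ[ℂ] Vec n →ₗ[ℂ] Vec n := fun r s =>
  LinearMap.mk₂ ℂ (fun u v =>
      (a₁ * -((u ⬝ᵥ s.toVec) * (v ⬝ᵥ r.toVec)) + a₂ * ((u ⬝ᵥ r.toVec) * (v ⬝ᵥ s.toVec))) • r.toVec)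
    (fun a b d => by simp only [add_dotProduct]; module)
    (fun a b d => by simp only [smul_dotProduct, smul_eq_mul]; module)
    (fun a b d => by simp only [add_dotProduct]; module)
    (fun a b d => by simp only [smul_dotProduct, smul_eq_mul]; module)

variable {g n c a₁ a₂}

instance : Bracket (Full g n c a₁ a₂) (Full g n c a₁ a₂) where
  bracket p q :=
    let x := prX g n c a₁ a₂ p
    let z := prK g n c a₁ a₂ p
    let d := prD g n c a₁ a₂ p
    let y := prX g n c a₁ a₂ q
    let w := prK g n c a₁ a₂ q
    let e := prD g n c a₁ a₂ q
    (conv (loopBr g n) x y + conv (derOnLoop g n) d y - conv (derOnLoop g n) e x,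
      (dA n).mkQ (conv (loopCocycle g n c) x y) + derAct w d - derAct z e
        + (dA n).mkQ (conv (derCocycle n a₁ a₂) d e),
      conv (derBr n) d e)

theorem bracket_def (p q : Full g n c a₁ a₂) : ⁅p, q⁆ =
    ((conv (loopBr g n) (prX g n c a₁ a₂ p) (prX g n c a₁ a₂ q)
        + conv (derOnLoop g n) (prD g n c a₁ a₂ p) (prX g n c a₁ a₂ q)
        - conv (derOnLoop g n) (prD g n c a₁ a₂ q) (prX g n c a₁ a₂ p),
      (dA n).mkQ (conv (loopCocycle g n c) (prX g n c a₁ a₂ p) (prX g n c a₁ a₂ q))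
        + derAct (prK g n c a₁ a₂ q) (prD g n c a₁ a₂ p)
        - derAct (prK g n c a₁ a₂ p) (prD g n c a₁ a₂ q)
        + (dA n).mkQ (conv (derCocycle n a₁ a₂) (prD g n c a₁ a₂ p) (prD g n c a₁ a₂ q)),
      conv (derBr n) (prD g n c a₁ a₂ p) (prD g n c a₁ a₂ q)) :
      (Deg n →₀ g) × Omega n × (Deg n →₀ Vec n)) := rfl

theorem add_br (p q r : Full g n c a₁ a₂) : ⁅p + q, r⁆ = ⁅p, r⁆ + ⁅q, r⁆ := by
  refine Prod.ext ?_ (Prod.ext ?_ ?_)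
  all_goals
    first
    | change _ = Prod.fst (α := Deg n →₀ g) _ + Prod.fst (α := Deg n →₀ g) _
    | change _ = Prod.fst (Prod.snd (α := Deg n →₀ g) _) + Prod.fst (Prod.snd (α := Deg n →₀ g) _)
    | change _ = Prod.snd (Prod.snd (α := Deg n →₀ g) _) + Prod.snd (Prod.snd (α := Deg n →₀ g) _)
    simp only [bracket_def, map_add, LinearMap.add_apply]
    try abel

theorem br_add (p q r : Full g n c a₁ a₂) : ⁅p, q + r⁆ = ⁅p, q⁆ + ⁅p, r⁆ := by
  refine Prod.ext ?_ (Prod.ext ?_ ?_)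
  all_goals
    first
    | change _ = Prod.fst (α := Deg n →₀ g) _ + Prod.fst (α := Deg n →₀ g) _
    | change _ = Prod.fst (Prod.snd (α := Deg n →₀ g) _) + Prod.fst (Prod.snd (α := Deg n →₀ g) _)
    | change _ = Prod.snd (Prod.snd (α := Deg n →₀ g) _) + Prod.snd (Prod.snd (α := Deg n →₀ g) _)
    simp only [bracket_def, map_add, LinearMap.add_apply]
    try abel

theorem br_smul (a : ℂ) (p q : Full g n c a₁ a₂) : ⁅p, a • q⁆ = a • ⁅p, q⁆ := by
  refine Prod.ext ?_ (Prod.ext ?_ ?_)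
  all_goals
    first
    | change _ = a • Prod.fst (α := Deg n →₀ g) _
    | change _ = a • Prod.fst (Prod.snd (α := Deg n →₀ g) _)
    | change _ = a • Prod.snd (Prod.snd (α := Deg n →₀ g) _)
    simp only [bracket_def, map_smul, LinearMap.smul_apply]
    try module

theorem prX_X (k : Deg n) (x : g) : prX g n c a₁ a₂ (X k x) = Finsupp.single k x := rfl
theorem prK_X (k : Deg n) (x : g) : prK g n c a₁ a₂ (X k x) = 0 := rfl
theorem prD_X (k : Deg n) (x : g) : prD g n c a₁ a₂ (X k x) = 0 := rfl
theorem prX_K (k : Deg n) (w : Vec n) : prX g n c a₁ a₂ (K k w) = 0 := rfl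
theorem prK_K (k : Deg n) (w : Vec n) :
    prK g n c a₁ a₂ (K k w) = (dA n).mkQ (Finsupp.single k w) := rfl
theorem prD_K (k : Deg n) (w : Vec n) : prD g n c a₁ a₂ (K k w) = 0 := rfl
theorem prX_D (k : Deg n) (u : Vec n) : prX g n c a₁ a₂ (D k u) = 0 := rfl
theorem prK_D (k : Deg n) (u : Vec n) : prK g n c a₁ a₂ (D k u) = 0 := rfl
theorem prD_D (k : Deg n) (u : Vec n) : prD g n c a₁ a₂ (D k u) = Finsupp.single k u := rfl

theorem ext_pr {p q : Full g n c a₁ a₂} (h1 : prX g n c a₁ a₂ p = prX g n c a₁ a₂ q)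
    (h2 : prK g n c a₁ a₂ p = prK g n c a₁ a₂ q) (h3 : prD g n c a₁ a₂ p = prD g n c a₁ a₂ q) :
    p = q := Prod.ext h1 (Prod.ext h2 h3)

theorem prX_br (p q : Full g n c a₁ a₂) : prX g n c a₁ a₂ ⁅p, q⁆ =
    conv (loopBr g n) (prX g n c a₁ a₂ p) (prX g n c a₁ a₂ q)
        + conv (derOnLoop g n) (prD g n c a₁ a₂ p) (prX g n c a₁ a₂ q)
        - conv (derOnLoop g n) (prD g n c a₁ a₂ q) (prX g n c a₁ a₂ p) := rfl

theorem prK_br (p q : Full g n c a₁ a₂) : prK g n c a₁ a₂ ⁅p, q⁆ =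
    (dA n).mkQ (conv (loopCocycle g n c) (prX g n c a₁ a₂ p) (prX g n c a₁ a₂ q))
        + derAct (prK g n c a₁ a₂ q) (prD g n c a₁ a₂ p)
        - derAct (prK g n c a₁ a₂ p) (prD g n c a₁ a₂ q)
        + (dA n).mkQ (conv (derCocycle n a₁ a₂) (prD g n c a₁ a₂ p) (prD g n c a₁ a₂ q)) := rfl

theorem prD_br (p q : Full g n c a₁ a₂) : prD g n c a₁ a₂ ⁅p, q⁆ =
    conv (derBr n) (prD g n c a₁ a₂ p) (prD g n c a₁ a₂ q) := rfl

theorem derAct_single (r s : Deg n) (u w : Vec n) :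
    derAct ((dA n).mkQ (Finsupp.single s w)) (Finsupp.single r u) =
      (dA n).mkQ (Finsupp.single (r + s) ((u ⬝ᵥ s.toVec) • w + (u ⬝ᵥ w) • r.toVec)) := by
  rw [derAct, Submodule.mkQ_apply, Submodule.liftQ_apply]
  simp only [LinearMap.flip_apply, LinearMap.compr₂_apply, conv_single, derOnOmega_apply]

theorem K_toVec (k : Deg n) : (K k k.toVec : Full g n c a₁ a₂) = 0 := by
  refine ext_pr rfl ?_ rfl
  rw [prK_K, map_zero, Submodule.mkQ_apply, Submodule.Quotient.mk_eq_zero]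
  simpa using single_toVec_mem k 1

/-- The bracket of two elements of the loop algebra. -/
theorem br_X_X (k l : Deg n) (x y : g) : ⁅(X k x : Full g n c a₁ a₂), (X l y : Full g n c a₁ a₂)⁆ =
    X (k + l) ⁅x, y⁆ + K (k + l) (((c : ℂ) * killingForm ℂ g x y) • k.toVec) := by
  refine ext_pr ?_ ?_ ?_ <;>
    simp [prX_br, prK_br, prD_br, prX_X, prK_X, prD_X, prX_K, prK_K, prD_K, loopBr, loopCocycle,
      -Finsupp.smul_single, ← Finsupp.smul_single, -Submodule.mkQ_apply]

theorem br_X_K (k l : Deg n) (x : g) (w : Vec n) :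
    ⁅(X k x : Full g n c a₁ a₂), (K l w : Full g n c a₁ a₂)⁆ = 0 := by
  refine ext_pr ?_ ?_ ?_ <;>
    simp [prX_br, prK_br, prD_br, prX_X, prK_X, prD_X, prX_K, prD_K]

theorem br_K_X (k l : Deg n) (x : g) (w : Vec n) :
    ⁅(K l w : Full g n c a₁ a₂), (X k x : Full g n c a₁ a₂)⁆ = 0 := by
  refine ext_pr ?_ ?_ ?_ <;>
    simp [prX_br, prK_br, prD_br, prX_X, prK_X, prD_X, prX_K, prD_K]

theorem br_K_K (k l : Deg n) (v w : Vec n) :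
    ⁅(K k v : Full g n c a₁ a₂), (K l w : Full g n c a₁ a₂)⁆ = 0 := by
  refine ext_pr ?_ ?_ ?_ <;>
    simp [prX_br, prK_br, prD_br, prX_K, prD_K]

theorem br_D_X (r k : Deg n) (u : Vec n) (x : g) :
    ⁅(D r u : Full g n c a₁ a₂), (X k x : Full g n c a₁ a₂)⁆ = X (r + k) ((u ⬝ᵥ k.toVec) • x) := by
  refine ext_pr ?_ ?_ ?_ <;>
    simp [prX_br, prK_br, prD_br, prX_X, prK_X, prD_X, prX_D, prK_D, prD_D, derOnLoop]

theorem br_X_D (r k : Deg n) (u : Vec n) (x : g) :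
    ⁅(X k x : Full g n c a₁ a₂), (D r u : Full g n c a₁ a₂)⁆ =
      -X (r + k) ((u ⬝ᵥ k.toVec) • x) := by
  refine ext_pr ?_ ?_ ?_ <;>
    simp [prX_br, prK_br, prD_br, prX_X, prK_X, prD_X, prX_D, prK_D, prD_D, derOnLoop]

theorem br_D_K (r s : Deg n) (u w : Vec n) :
    ⁅(D r u : Full g n c a₁ a₂), (K s w : Full g n c a₁ a₂)⁆ =
      K (r + s) ((u ⬝ᵥ s.toVec) • w + (u ⬝ᵥ w) • r.toVec) := by
  refine ext_pr ?_ ?_ ?_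
  · simp [prX_br, prX_K, prD_K, prX_D]
  · rw [prK_br, prK_K, prD_D, derAct_single]
    simp only [prX_K, prD_K, prX_D, prK_D, prK_K, map_neg, map_zero, LinearMap.zero_apply, add_zero,
      zero_add, sub_zero, zero_sub]
  · simp [prD_br, prD_K]

theorem br_K_D (r s : Deg n) (u w : Vec n) :
    ⁅(K s w : Full g n c a₁ a₂), (D r u : Full g n c a₁ a₂)⁆ =
      -K (r + s) ((u ⬝ᵥ s.toVec) • w + (u ⬝ᵥ w) • r.toVec) := by
  refine ext_pr ?_ ?_ ?_
  · simp [prX_br, prX_K, prD_K, prX_D]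
  · rw [prK_br, prK_K, prD_D, derAct_single]
    simp only [prX_K, prD_K, prX_D, prK_D, prK_K, map_neg, map_zero, LinearMap.zero_apply, add_zero,
      zero_add, sub_zero, zero_sub]
  · simp [prD_br, prD_K]

theorem br_D_D (r s : Deg n) (u v : Vec n) :
    ⁅(D r u : Full g n c a₁ a₂), (D s v : Full g n c a₁ a₂)⁆ =
      D (r + s) ((u ⬝ᵥ s.toVec) • v - (v ⬝ᵥ r.toVec) • u) +
      K (r + s) ((a₁ * -((u ⬝ᵥ s.toVec) * (v ⬝ᵥ r.toVec))
        + a₂ * ((u ⬝ᵥ r.toVec) * (v ⬝ᵥ s.toVec))) • r.toVec) := by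
  refine ext_pr ?_ ?_ ?_ <;>
    simp [prX_br, prK_br, prD_br, prX_K, prK_K, prD_K, prX_D, prK_D, prD_D, derBr, derCocycle,
      -Finsupp.smul_single, ← Finsupp.smul_single, -Submodule.mkQ_apply]

/-- The monomials span the full toroidal Lie algebra. -/
theorem Full.induction {motive : Full g n c a₁ a₂ → Prop} (hX : ∀ k x, motive (X k x))
    (hK : ∀ k w, motive (K k w)) (hD : ∀ k u, motive (D k u))
    (hadd : ∀ p q, motive p → motive q → motive (p + q)) (p : Full g n c a₁ a₂) : motive p := by
  have h0 : motive 0 := by simpa using hX 0 0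
  obtain ⟨x, z, d⟩ := p
  obtain ⟨z, rfl⟩ := (dA n).mkQ_surjective z
  have e : ((x, (dA n).mkQ z, d) : (Deg n →₀ g) × Omega n × (Deg n →₀ Vec n)) =
    (x, 0, 0) + ((0, (dA n).mkQ z, 0) + (0, 0, d)) := by simp
  have e1 : motive ((x, 0, 0) : (Deg n →₀ g) × Omega n × (Deg n →₀ Vec n)) := by
    induction x using Finsupp.induction_linear with
    | zero => exact h0
    | single k x => exact hX k x
    | add p q hp hq =>
      have : ((p + q, 0, 0) : (Deg n →₀ g) × Omega n × (Deg n →₀ Vec n)) =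
        (p, 0, 0) + (q, 0, 0) := by simp
      rw [this]; exact hadd _ _ (hp (by simp)) (hq (by simp))
  have e2 : motive ((0, (dA n).mkQ z, 0) : (Deg n →₀ g) × Omega n × (Deg n →₀ Vec n)) := by
    clear e e1
    induction z using Finsupp.induction_linear with
    | zero => rw [map_zero]; exact h0
    | single k x => exact hK k x
    | add p q hp hq =>
      have : ((0, (dA n).mkQ (p + q), 0) : (Deg n →₀ g) × Omega n × (Deg n →₀ Vec n)) =
        (0, (dA n).mkQ p, 0) + (0, (dA n).mkQ q, 0) := by simp
      rw [this]; exact hadd _ _ hp hq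
  have e3 : motive ((0, 0, d) : (Deg n →₀ g) × Omega n × (Deg n →₀ Vec n)) := by
    clear e e1 e2
    induction d using Finsupp.induction_linear with
    | zero => exact h0
    | single k x => exact hD k x
    | add p q hp hq =>
      have : ((0, 0, p + q) : (Deg n →₀ g) × Omega n × (Deg n →₀ Vec n)) =
        (0, 0, p) + (0, 0, q) := by simp
      rw [this]; exact hadd _ _ hp hq
  rw [e]
  exact hadd _ _ e1 (hadd _ _ e2 e3)

theorem K_eq_of_sub {k : Deg n} {v w : Vec n} (b : ℂ) (h : v - w = b • k.toVec) :
    (K k v : Full g n c a₁ a₂) = K k w := by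
  rw [← sub_eq_zero, ← map_sub, h, map_smul, K_toVec, smul_zero]

theorem br_swap (p q : Full g n c a₁ a₂) : ⁅p, q⁆ = -⁅q, p⁆ := by
  induction p using Full.induction with
  | hadd a b ha hb => rw [add_br, br_add, ha, hb]; abel
  | hX k x =>
    induction q using Full.induction with
    | hadd a b ha hb => rw [add_br, br_add, ha, hb]; abel
    | hX l y =>
      rw [br_X_X, br_X_X, neg_add, ← map_neg, ← map_neg, lie_skew, add_comm l k]
      congr 1
      refine K_eq_of_sub ((c : ℂ) * killingForm ℂ g x y) ?_
      rw [LieModule.traceForm_comm ℂ g g y x, toVec_add]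
      module
    | hK l w => rw [br_X_K, br_K_X, neg_zero]
    | hD l u => rw [br_X_D, br_D_X]
  | hK k w =>
    induction q using Full.induction with
    | hadd a b ha hb => rw [add_br, br_add, ha, hb]; abel
    | hX l y => rw [br_X_K, br_K_X, neg_zero]
    | hK l w => rw [br_K_K, br_K_K, neg_zero]
    | hD l u => rw [br_K_D, br_D_K]
  | hD r u =>
    induction q using Full.induction with
    | hadd a b ha hb => rw [add_br, br_add, ha, hb]; abel
    | hX l y => rw [br_X_D, br_D_X, neg_neg]
    | hK l w => rw [br_K_D, br_D_K, neg_neg]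
    | hD s v =>
      rw [br_D_D, br_D_D, neg_add, ← map_neg, ← map_neg, add_comm s r, neg_sub]
      congr 1
      refine K_eq_of_sub (a₁ * -((u ⬝ᵥ s.toVec) * (v ⬝ᵥ r.toVec))
        + a₂ * ((u ⬝ᵥ r.toVec) * (v ⬝ᵥ s.toVec))) ?_
      rw [toVec_add]
      module

theorem smul_br (a : ℂ) (p q : Full g n c a₁ a₂) : ⁅a • p, q⁆ = a • ⁅p, q⁆ := by
  rw [br_swap, br_smul, br_swap q p, smul_neg, neg_neg]

theorem neg_br (p q : Full g n c a₁ a₂) : ⁅-p, q⁆ = -⁅p, q⁆ := by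
  simpa using smul_br (-1) p q

theorem br_neg (p q : Full g n c a₁ a₂) : ⁅p, -q⁆ = -⁅p, q⁆ := by
  simpa using br_smul (-1) p q

theorem zero_br (p : Full g n c a₁ a₂) : ⁅(0 : Full g n c a₁ a₂), p⁆ = 0 := by
  simpa using smul_br 0 0 p

theorem br_zero (p : Full g n c a₁ a₂) : ⁅p, (0 : Full g n c a₁ a₂)⁆ = 0 := by
  simpa using br_smul 0 p 0

/-- The Jacobi expression. -/
def jac (p q r : Full g n c a₁ a₂) : Full g n c a₁ a₂ := ⁅p, ⁅q, r⁆⁆ - ⁅⁅p, q⁆, r⁆ - ⁅q, ⁅p, r⁆⁆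

theorem jac_add₁ (p p' q r : Full g n c a₁ a₂) : jac (p + p') q r = jac p q r + jac p' q r := by
  simp only [jac, add_br, br_add]; abel

theorem jac_add₂ (p q q' r : Full g n c a₁ a₂) : jac p (q + q') r = jac p q r + jac p q' r := by
  simp only [jac, add_br, br_add]; abel

theorem jac_add₃ (p q r r' : Full g n c a₁ a₂) : jac p q (r + r') = jac p q r + jac p q r' := by
  simp only [jac, br_add]; abel

theorem jac_swap (p q r : Full g n c a₁ a₂) : jac p q r = -jac q p r := by
  simp only [jac]
  rw [br_swap p q, neg_br]; abel

theorem jac_swap' (p q r : Full g n c a₁ a₂) : jac p q r = -jac p r q := by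
  simp only [jac]
  rw [br_swap q r, br_neg, br_swap ⁅p, q⁆ r, br_swap q ⁅p, r⁆]; abel


theorem K_eq_zero {k : Deg n} {v : Vec n} (b : ℂ) (h : v = b • k.toVec) :
    (K k v : Full g n c a₁ a₂) = 0 := by
  rw [h, map_smul, K_toVec, smul_zero]

theorem jac_X_X_X (k l m : Deg n) (x y z : g) :
    jac (X k x : Full g n c a₁ a₂) (X l y) (X m z) = 0 := by
  simp only [jac, br_X_X, add_br, br_add, br_X_K, br_K_X, add_zero]
  rw [show l + (k + m) = k + l + m by abel, show k + (l + m) = k + l + m by abel]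
  have h1 : killingForm ℂ g x ⁅y, z⁆ = killingForm ℂ g ⁅x, y⁆ z :=
    (LieModule.traceForm_apply_lie_apply ℂ g g x y z).symm
  have h2 : killingForm ℂ g y ⁅x, z⁆ = -killingForm ℂ g ⁅x, y⁆ z := by
    rw [show killingForm ℂ g y ⁅x, z⁆ = killingForm ℂ g ⁅y, x⁆ z from
      (LieModule.traceForm_apply_lie_apply ℂ g g y x z).symm, ← lie_skew y x, map_neg,
      LinearMap.neg_apply]
  rw [h1, h2, leibniz_lie x y z, toVec_add, map_add]
  simp only [mul_neg, neg_smul, smul_add, map_add, map_neg]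
  abel

theorem jac_D_X_X (k l m : Deg n) (u : Vec n) (y z : g) :
    jac (D k u : Full g n c a₁ a₂) (X l y) (X m z) = 0 := by
  simp only [jac, br_X_X, add_br, br_add, br_X_K, br_K_X, br_D_X, br_D_K]
  rw [show l + (k + m) = k + l + m by abel, show k + (l + m) = k + l + m by abel]
  simp only [toVec_add, dotProduct_add, smul_lie, lie_smul, map_smul, LinearMap.smul_apply,
    smul_eq_mul, dotProduct_smul, map_add]
  module

theorem jac_D_D_X (k l m : Deg n) (u v : Vec n) (z : g) :
    jac (D k u : Full g n c a₁ a₂) (D l v) (X m z) = 0 := by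
  simp only [jac, br_X_X, add_br, br_add, br_X_K, br_K_X, br_D_X, br_D_K, br_D_D]
  rw [show l + (k + m) = k + l + m by abel, show k + (l + m) = k + l + m by abel]
  simp only [toVec_add, dotProduct_add, sub_dotProduct, smul_dotProduct, map_smul, smul_eq_mul]
  module

theorem jac_D_D_K (k l m : Deg n) (u v w : Vec n) :
    jac (D k u : Full g n c a₁ a₂) (D l v) (K m w) = 0 := by
  simp only [jac, br_X_X, add_br, br_add, br_X_K, br_K_K, br_D_X, br_D_K, br_D_D, add_zero]
  rw [show l + (k + m) = k + l + m by abel, show k + (l + m) = k + l + m by abel,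
    ← map_sub, ← map_sub]
  refine K_eq_zero 0 ?_
  simp only [toVec_add, dotProduct_add, sub_dotProduct, smul_dotProduct, dotProduct_smul,
    smul_eq_mul]
  module

theorem jac_D_D_D (k l m : Deg n) (u v w : Vec n) :
    jac (D k u : Full g n c a₁ a₂) (D l v) (D m w) = 0 := by
  simp only [jac, br_X_X, add_br, br_add, br_X_K, br_K_K, br_D_X, br_D_K, br_D_D, br_K_D]
  rw [show l + (k + m) = k + l + m by abel, show k + (l + m) = k + l + m by abel,
    show m + (k + l) = k + l + m by abel]
  have e : ∀ (A B C : Vec n) (A₁ A₂ B₁ B₂ C₁ C₂ : Vec n), A - B - C = 0 →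
      (K (k + l + m) (A₁ + A₂ - B₁ + B₂ - C₁ - C₂) : Full g n c a₁ a₂) = 0 →
      (D (k + l + m) A + K (k + l + m) A₁ + K (k + l + m) A₂ -
        (D (k + l + m) B + K (k + l + m) B₁ + -K (k + l + m) B₂) -
        (D (k + l + m) C + K (k + l + m) C₁ + K (k + l + m) C₂) : Full g n c a₁ a₂) = 0 := by
    intro A B C A₁ A₂ B₁ B₂ C₁ C₂ h1 h2
    have h3 : (D (k + l + m) (A - B - C) : Full g n c a₁ a₂) = 0 := by rw [h1, map_zero]
    simp only [map_add, map_sub] at h2 h3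
    calc _ = (D (k + l + m) A - D (k + l + m) B - D (k + l + m) C : Full g n c a₁ a₂) +
          (K (k + l + m) A₁ + K (k + l + m) A₂ - K (k + l + m) B₁ + K (k + l + m) B₂
            - K (k + l + m) C₁ - K (k + l + m) C₂) := by abel
      _ = 0 := by rw [h2, h3, add_zero]
  refine e _ _ _ _ _ _ _ _ _ ?_ (K_eq_zero ((a₁ * -((u ⬝ᵥ l.toVec) * (v ⬝ᵥ k.toVec))
        + a₂ * ((u ⬝ᵥ k.toVec) * (v ⬝ᵥ l.toVec))) * (w ⬝ᵥ k.toVec)) ?_)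
  · simp only [toVec_add, dotProduct_add, sub_dotProduct, smul_dotProduct, dotProduct_smul,
      smul_eq_mul]
    module
  · simp only [toVec_add, dotProduct_add, sub_dotProduct, smul_dotProduct, dotProduct_smul,
      smul_eq_mul]
    module

theorem jac_K (k : Deg n) (w : Vec n) (q r : Full g n c a₁ a₂) : jac q r (K k w) = 0 := by
  induction q using Full.induction with
  | hadd a b ha hb => rw [jac_add₁, ha, hb, add_zero]
  | hX l x =>
    induction r using Full.induction with
    | hadd a b ha hb => rw [jac_add₂, ha, hb, add_zero]
    | hX m y => simp only [jac, br_X_X, br_X_K, br_K_X, br_K_K, br_D_X, br_X_D, br_D_K,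
        br_K_D, add_br, br_zero, zero_br, neg_br, br_neg, neg_zero, sub_zero, add_zero]
    | hK m y => simp only [jac, br_X_X, br_X_K, br_K_X, br_K_K, br_D_X, br_X_D, br_D_K,
        br_K_D, add_br, br_zero, zero_br, neg_br, br_neg, neg_zero, sub_zero, add_zero]
    | hD m y => simp only [jac, br_X_X, br_X_K, br_K_X, br_K_K, br_D_X, br_X_D, br_D_K,
        br_K_D, add_br, br_zero, zero_br, neg_br, br_neg, neg_zero, sub_zero, add_zero]
  | hK l x =>
    induction r using Full.induction with
    | hadd a b ha hb => rw [jac_add₂, ha, hb, add_zero]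
    | hX m y => simp only [jac, br_X_X, br_X_K, br_K_X, br_K_K, br_D_X, br_X_D, br_D_K,
        br_K_D, add_br, br_zero, zero_br, neg_br, br_neg, neg_zero, sub_zero, add_zero]
    | hK m y => simp only [jac, br_X_X, br_X_K, br_K_X, br_K_K, br_D_X, br_X_D, br_D_K,
        br_K_D, add_br, br_zero, zero_br, neg_br, br_neg, neg_zero, sub_zero, add_zero]
    | hD m y => simp only [jac, br_X_X, br_X_K, br_K_X, br_K_K, br_D_X, br_X_D, br_D_K,
        br_K_D, add_br, br_zero, zero_br, neg_br, br_neg, neg_zero, sub_zero, add_zero]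
  | hD l x =>
    induction r using Full.induction with
    | hadd a b ha hb => rw [jac_add₂, ha, hb, add_zero]
    | hX m y => simp only [jac, br_X_X, br_X_K, br_K_X, br_K_K, br_D_X, br_X_D, br_D_K,
        br_K_D, add_br, br_zero, zero_br, neg_br, br_neg, neg_zero, sub_zero, add_zero]
    | hK m y => simp only [jac, br_X_X, br_X_K, br_K_X, br_K_K, br_D_X, br_X_D, br_D_K,
        br_K_D, add_br, br_zero, zero_br, neg_br, br_neg, neg_zero, sub_zero, add_zero]
    | hD m y => exact jac_D_D_K _ _ _ _ _ _

theorem jac_eq_zero (p q r : Full g n c a₁ a₂) : jac p q r = 0 := by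
  induction r using Full.induction with
  | hadd a b ha hb => rw [jac_add₃, ha, hb, add_zero]
  | hK k w => exact jac_K k w p q
  | hX k x =>
    induction q using Full.induction with
    | hadd a b ha hb => rw [jac_add₂, ha, hb, add_zero]
    | hK k w => rw [jac_swap', jac_K, neg_zero]
    | hX l y =>
      induction p using Full.induction with
      | hadd a b ha hb => rw [jac_add₁, ha, hb, add_zero]
      | hK m z => rw [jac_swap, jac_swap', jac_K, neg_zero, neg_zero]
      | hX m z => exact jac_X_X_X _ _ _ _ _ _
      | hD m z => exact jac_D_X_X _ _ _ _ _ _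
    | hD l y =>
      induction p using Full.induction with
      | hadd a b ha hb => rw [jac_add₁, ha, hb, add_zero]
      | hK m z => rw [jac_swap, jac_swap', jac_K, neg_zero, neg_zero]
      | hX m z => rw [jac_swap, jac_D_X_X, neg_zero]
      | hD m z => exact jac_D_D_X _ _ _ _ _ _
  | hD k x =>
    induction q using Full.induction with
    | hadd a b ha hb => rw [jac_add₂, ha, hb, add_zero]
    | hK k w => rw [jac_swap', jac_K, neg_zero]
    | hX l y =>
      induction p using Full.induction with
      | hadd a b ha hb => rw [jac_add₁, ha, hb, add_zero]
      | hK m z => rw [jac_swap, jac_swap', jac_K, neg_zero, neg_zero]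
      | hX m z => rw [jac_swap', jac_swap, jac_D_X_X, neg_zero, neg_zero]
      | hD m z => rw [jac_swap', jac_D_D_X, neg_zero]
    | hD l y =>
      induction p using Full.induction with
      | hadd a b ha hb => rw [jac_add₁, ha, hb, add_zero]
      | hK m z => rw [jac_swap, jac_swap', jac_K, neg_zero, neg_zero]
      | hX m z => rw [jac_swap, jac_swap', jac_D_D_X, neg_zero, neg_zero]
      | hD m z => exact jac_D_D_D _ _ _ _ _ _

instance : LieRing (Full g n c a₁ a₂) where
  add_lie := add_br
  lie_add := br_add
  lie_self p := by
    have h : ⁅p, p⁆ = -⁅p, p⁆ := br_swap p p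
    have h2 : (2 : ℂ) • ⁅p, p⁆ = 0 := by rw [two_smul]; nth_rewrite 2 [h]; abel
    exact (smul_eq_zero.1 h2).resolve_left two_ne_zero
  leibniz_lie p q r := by
    have h := jac_eq_zero p q r
    rw [jac, sub_sub, sub_eq_zero] at h
    exact h

instance : LieAlgebra ℂ (Full g n c a₁ a₂) where
  lie_smul := br_smul

end Full

/-- Commuting automorphisms `σ_0, …, σ_n` of `g` of finite orders `m_0, …, m_n`, together with
primitive `m_i`-th roots of unity `ξ_i`. -/
structure Datum (g : Type*) [LieRing g] [LieAlgebra ℂ g] (n : ℕ) where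
  σ : Fin (n + 1) → (g ≃ₗ⁅ℂ⁆ g)
  m : Fin (n + 1) → ℕ
  ξ : Fin (n + 1) → ℂ
  m_pos : ∀ i, 0 < m i
  order_eq : ∀ i, orderOf (σ i).toLinearEquiv = m i
  commute : ∀ i j x, σ i (σ j x) = σ j (σ i x)
  primitive : ∀ i, IsPrimitiveRoot (ξ i) (m i)

namespace Datum

variable {g : Type*} [LieRing g] [LieAlgebra ℂ g] {n : ℕ} (S : Datum g n)

/-- The simultaneous eigenspace `g(k̄_0, k̄) = {x | σ_i x = ξ_i ^ k_i x for all i}`. -/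
def grade (k : Deg n) : Submodule ℂ g where
  carrier := {x | ∀ i, S.σ i x = S.ξ i ^ k i • x}
  add_mem' hx hy i := by simp only [Set.mem_ofPred_eq] at hx hy; rw [map_add, hx, hy, smul_add]
  zero_mem' i := by simp
  smul_mem' a x hx i := by
    simp only [Set.mem_ofPred_eq] at hx; rw [map_smul, hx, smul_comm]

/-- The lattice `Γ_0 ⊕ Γ = m_0 ℤ ⊕ m_1 ℤ ⊕ ⋯ ⊕ m_n ℤ`. -/
def lattice : AddSubgroup (Deg n) where
  carrier := {r | ∀ i, (S.m i : ℤ) ∣ r i}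
  add_mem' hx hy i := dvd_add (hx i) (hy i)
  zero_mem' _ := dvd_zero _
  neg_mem' hx i := (dvd_neg).2 (hx i)

/-- The fixed subalgebra `g(0̄, 0̄)`. -/
def fixed : LieSubalgebra ℂ g where
  carrier := {x | ∀ i, S.σ i x = x}
  add_mem' hx hy i := by simp only [Set.mem_ofPred_eq] at hx hy; rw [map_add, hx, hy]
  zero_mem' i := by simp
  smul_mem' a x hx i := by simp only [Set.mem_ofPred_eq] at hx; rw [map_smul, hx]
  lie_mem' hx hy i := by
    have h1 := hx i
    have h2 := hy i
    rw [LieEquiv.map_lie, h1, h2]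

variable {S}

theorem ξ_ne_zero (i : Fin (n + 1)) : S.ξ i ≠ 0 := (S.primitive i).ne_zero (S.m_pos i).ne'

theorem fixed_mem_grade {x : g} (hx : x ∈ S.fixed) : x ∈ S.grade 0 := fun i => by
  rw [Pi.zero_apply, zpow_zero, one_smul]; exact hx i

theorem lie_mem_grade {k l : Deg n} {x y : g} (hx : x ∈ S.grade k) (hy : y ∈ S.grade l) :
    ⁅x, y⁆ ∈ S.grade (k + l) := fun i => by
  rw [LieEquiv.map_lie, hx i, hy i, smul_lie, lie_smul, smul_smul, Pi.add_apply,
    zpow_add₀ (ξ_ne_zero i)]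

theorem grade_add_lattice {k r : Deg n} (hr : r ∈ S.lattice) {x : g} (hx : x ∈ S.grade k) :
    x ∈ S.grade (r + k) := fun i => by
  rw [hx i, Pi.add_apply, zpow_add₀ (ξ_ne_zero i),
    ((S.primitive i).zpow_eq_one_iff_dvd (r i)).2 (hr i), one_mul]

/-- The invariant form pairs non-trivially only degrees adding up to an element of the lattice. -/
theorem add_mem_lattice {k l : Deg n} {x y : g} (hx : x ∈ S.grade k) (hy : y ∈ S.grade l)
    (h : killingForm ℂ g x y ≠ 0) : k + l ∈ S.lattice := fun i => by
  refine ((S.primitive i).zpow_eq_one_iff_dvd _).1 ?_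
  have h1 := LieAlgebra.killingForm_of_equiv_apply (S.σ i) x y
  rw [hx i, hy i, map_smul, map_smul, LinearMap.smul_apply, smul_smul, smul_eq_mul, mul_comm (_ ^ _)]
    at h1
  rw [Pi.add_apply, zpow_add₀ (ξ_ne_zero i)]
  exact mul_right_cancel₀ h (by rw [h1, one_mul])

variable (S) (c : ℝ) (a₁ a₂ : ℂ)

/-- The homogeneous elements spanning `τ`. -/
inductive IsMonomial : Full g n c a₁ a₂ → Prop
  | X (k : Deg n) (x : g) (hx : x ∈ S.grade k) : IsMonomial (X k x)
  | K (r : Deg n) (w : Vec n) (hr : r ∈ S.lattice) : IsMonomial (K r w)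
  | D (r : Deg n) (u : Vec n) (hr : r ∈ S.lattice) : IsMonomial (D r u)

theorem br_mem {p q : Full g n c a₁ a₂} (hp : S.IsMonomial c a₁ a₂ p)
    (hq : S.IsMonomial c a₁ a₂ q) :
    ⁅p, q⁆ ∈ Submodule.span ℂ {p | S.IsMonomial c a₁ a₂ p} := by
  have sub : ∀ {p}, S.IsMonomial c a₁ a₂ p → p ∈ Submodule.span ℂ {p | S.IsMonomial c a₁ a₂ p} :=
    fun h => Submodule.subset_span h
  rcases hp with ⟨k, x, hx⟩ | ⟨r, w, hr⟩ | ⟨r, u, hr⟩ <;>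
    rcases hq with ⟨l, y, hy⟩ | ⟨s, v, hs⟩ | ⟨s, v, hs⟩
  · rw [br_X_X]
    refine add_mem (sub (.X _ _ (lie_mem_grade hx hy))) ?_
    by_cases h : killingForm ℂ g x y = 0
    · rw [h, mul_zero, zero_smul, map_zero]; exact zero_mem _
    · exact sub (.K _ _ (add_mem_lattice hx hy h))
  · rw [br_X_K]; exact zero_mem _
  · rw [br_X_D]
    exact neg_mem (sub (.X _ _ (grade_add_lattice hs (Submodule.smul_mem _ _ hx))))
  · rw [br_K_X]; exact zero_mem _
  · rw [br_K_K]; exact zero_mem _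
  · rw [br_K_D]; exact neg_mem (sub (.K _ _ (add_mem hs hr)))
  · rw [br_D_X]
    exact sub (.X _ _ (grade_add_lattice hr (Submodule.smul_mem _ _ hy)))
  · rw [br_D_K]; exact sub (.K _ _ (add_mem hr hs))
  · rw [br_D_D]
    exact add_mem (sub (.D _ _ (add_mem hr hs))) (sub (.K _ _ (add_mem hr hs)))

/-- The twisted full toroidal Lie algebra `τ = L(g, σ) ⊕ Z(m_0, m) ⊕ D(m_0, m)`, as a subalgebra of
`g ⊗ A ⊕ ΩA/dA ⊕ Der A`. -/
def tau : LieSubalgebra ℂ (Full g n c a₁ a₂) where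
  toSubmodule := Submodule.span ℂ {p | S.IsMonomial c a₁ a₂ p}
  lie_mem' {p q} hp hq := by
    refine Submodule.span_induction₂ (p := fun p q _ _ => ⁅p, q⁆ ∈
      Submodule.span ℂ {p | S.IsMonomial c a₁ a₂ p}) (fun p q hp hq => S.br_mem c a₁ a₂ hp hq)
      ?_ ?_ ?_ ?_ ?_ ?_ hp hq
    · intro y _; rw [zero_lie]; exact zero_mem _
    · intro y _; rw [lie_zero]; exact zero_mem _
    · intro x y z _ _ _ h1 h2; rw [add_lie]; exact add_mem h1 h2
    · intro x y z _ _ _ h1 h2; rw [lie_add]; exact add_mem h1 h2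
    · intro a x y _ _ h; rw [smul_lie]; exact Submodule.smul_mem _ _ h
    · intro a x y _ _ h; rw [lie_smul]; exact Submodule.smul_mem _ _ h

variable {c a₁ a₂}

/-- `X ⊗ t^k` as an element of `τ`. -/
def tauX (k : Deg n) (x : g) (hx : x ∈ S.grade k) : S.tau c a₁ a₂ :=
  ⟨X k x, Submodule.subset_span (.X k x hx)⟩

/-- `∑ w_i t^r K_i` as an element of `τ`. -/
def tauK (r : Deg n) (w : Vec n) (hr : r ∈ S.lattice) : S.tau c a₁ a₂ :=
  ⟨K r w, Submodule.subset_span (.K r w hr)⟩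

/-- `∑ u_i t^r d_i` as an element of `τ`. -/
def tauD (r : Deg n) (u : Vec n) (hr : r ∈ S.lattice) : S.tau c a₁ a₂ :=
  ⟨D r u, Submodule.subset_span (.D r u hr)⟩

/-- The central element `K_i` of `τ`. -/
def central (i : Fin (n + 1)) : S.tau c a₁ a₂ := S.tauK 0 (Pi.single i 1) (zero_mem _)

section Weights

variable {S} (h₀ : LieSubalgebra ℂ S.fixed)

/-- `H = h(0) ⊕ ∑ ℂ K_i ⊕ ∑ ℂ d_i`; the triple `(h, w, u)` stands for
`h + ∑ w_i K_i + ∑ u_i d_i`. -/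
abbrev Cart : Type _ := h₀ × Vec n × Vec n

/-- The inclusion of `H` in `τ`. -/
def cartIncl (x : Cart h₀) : S.tau c a₁ a₂ :=
  S.tauX 0 ((x.1 : S.fixed) : g) (fixed_mem_grade (x.1 : S.fixed).2) + S.tauK 0 x.2.1 (zero_mem _)
    + S.tauD 0 x.2.2 (zero_mem _)

/-- A functional on `h(0)`, extended by zero to `H`. -/
def extend (α : Dual ℂ h₀) : Dual ℂ (Cart h₀) := α.comp (LinearMap.fst ℂ _ _)

/-- `δ_i ∈ H*`: zero on `h(0)` and on all `K_j`, and `δ_i(d_j) = δ_{ij}`. -/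
def delta (i : Fin (n + 1)) : Dual ℂ (Cart h₀) :=
  (LinearMap.proj i).comp ((LinearMap.snd ℂ _ _).comp (LinearMap.snd ℂ _ _))

/-- `δ_k = ∑_{i=1}^n k_i δ_i` for `k ∈ ℤ^n`. -/
def deltaVec (k : Fin n → ℤ) : Dual ℂ (Cart h₀) := ∑ i : Fin n, k i • delta h₀ i.succ

/-- `g(k̄_0, k̄, α)`. -/
def gradeRoot (k : Deg n) (α : Dual ℂ h₀) : Submodule ℂ g where
  carrier := {x | x ∈ S.grade k ∧ ∀ h : h₀, ⁅((h : S.fixed) : g), x⁆ = α h • x}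
  add_mem' hx hy := ⟨add_mem hx.1 hy.1, fun h => by rw [lie_add, hx.2, hy.2, smul_add]⟩
  zero_mem' := ⟨zero_mem _, fun h => by rw [lie_zero, smul_zero]⟩
  smul_mem' a _ hx := ⟨Submodule.smul_mem _ a hx.1, fun h => by rw [lie_smul, hx.2, smul_comm]⟩

/-- `Δ(g, h(0))`, which includes zero. -/
def weightsOnG : Set (Dual ℂ h₀) :=
  {α | ∃ x : g, x ≠ 0 ∧ ∀ h : h₀, ⁅((h : S.fixed) : g), x⁆ = α h • x}

section Module

variable (c a₁ a₂) (V : Type*) [AddCommGroup V] [Module ℂ V] [LieRingModule (S.tau c a₁ a₂) V]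
  [LieModule ℂ (S.tau c a₁ a₂) V]

/-- `V_μ = {v | h v = μ(h) v for all h ∈ H}`. -/
def weightSpace (μ : Dual ℂ (Cart h₀)) : Submodule ℂ V where
  carrier := {v | ∀ x : Cart h₀, ⁅(cartIncl h₀ x : S.tau c a₁ a₂), v⁆ = μ x • v}
  add_mem' hv hw x := by
    rw [lie_add]; simp only [Set.mem_ofPred_eq] at hv hw; rw [hv, hw, smul_add]
  zero_mem' x := by rw [lie_zero, smul_zero]
  smul_mem' a v hv x := by
    simp only [Set.mem_ofPred_eq] at hv; rw [lie_smul, hv, smul_comm]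

/-- `P(V)`, the set of weights of `V`. -/
def weights : Set (Dual ℂ (Cart h₀)) := {μ | weightSpace c a₁ a₂ h₀ V μ ≠ ⊥}

/-- Integrable modules. The sum of the weight spaces in the first field is automatically direct. -/
structure IsIntegrable : Prop where
  iSup_weightSpace : ⨆ μ, weightSpace c a₁ a₂ h₀ V μ = ⊤
  finite_weightSpace : ∀ μ, FiniteDimensional ℂ (weightSpace c a₁ a₂ h₀ V μ)
  locally_nilpotent : ∀ (k : Deg n) (α : Dual ℂ h₀), α ≠ 0 → ∀ (x : g) (hx : x ∈ gradeRoot h₀ k α)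
    (v : V), ∃ N : ℕ, (LieModule.toEnd ℂ (S.tau c a₁ a₂) V (S.tauX k x hx.1) ^ N) v = 0

end Module

section Roots

open LieAlgebra.IsKilling

variable [FiniteDimensional ℂ g] [LieAlgebra.IsSimple ℂ S.fixed] [h₀.IsCartanSubalgebra]

/-- The root `i` is short, that is, of minimal length (so that all roots are short when there is
only one root length). -/
def IsShort (i : h₀.root) : Prop :=
  ∀ j : h₀.root, ((rootSystem h₀).posRootForm ℚ).rootLength i ≤
    ((rootSystem h₀).posRootForm ℚ).rootLength j

/-- The root system of `g(0̄, 0̄)` is of type `B_l` for some `l ≥ 1`, where `B_1 = A_1`. -/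
def IsTypeB : Prop :=
  ∃ (b : (rootSystem h₀).Base) (l : ℕ) (e : Fin l ≃ b.support),
    ∀ i j, b.cartanMatrix (e i) (e j) = CartanMatrix.B l i j

/-- `Δ_{0,en}`: the roots of `g(0̄, 0̄)` and zero, and for type `B_l` also twice the short roots. -/
def enlargedRoots : Set (Dual ℂ h₀) :=
  {α | α = 0 ∨ (∃ i, α = (rootSystem h₀).root i) ∨
    (IsTypeB h₀ ∧ ∃ i, IsShort h₀ i ∧ α = (2 : ℂ) • (rootSystem h₀).root i)}

variable {h₀}

/-- `β₀` is the maximal (highest) root in `Δ_{0,en}`, with respect to the simple roots `b`. -/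
def IsMaximalRoot (b : (rootSystem h₀).Base) (β₀ : Dual ℂ h₀) : Prop :=
  β₀ ∈ enlargedRoots h₀ ∧ ∀ α ∈ enlargedRoots h₀,
    β₀ - α ∈ AddSubmonoid.closure ((rootSystem h₀).root '' b.support)

/-- `Q⁺ = ℕ α_0 ⊕ ℕ α_1 ⊕ ⋯ ⊕ ℕ α_p ⊆ H*`, where `α_1, …, α_p` are the simple roots and
`α_0 = -β₀ + δ_0`. -/
def posCone (b : (rootSystem h₀).Base) (β₀ : Dual ℂ h₀) : AddSubmonoid (Dual ℂ (Cart h₀)) :=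
  AddSubmonoid.closure (insert (-extend h₀ β₀ + delta h₀ 0)
    ((fun i => extend h₀ ((rootSystem h₀).root i)) '' b.support))

/-- `β > 0` for the ordering of `H*` given by `μ ≤ ν ↔ ν - μ ∈ Q⁺`. -/
def IsPos (b : (rootSystem h₀).Base) (β₀ : Dual ℂ h₀) (β : Dual ℂ (Cart h₀)) : Prop :=
  β ∈ posCone b β₀ ∧ β ≠ 0

variable (c a₁ a₂) (b : (rootSystem h₀).Base) (β₀ : Dual ℂ h₀)

/-- `τ⁺`, spanned by the `g(k̄_0, k̄, α) ⊗ t_0^{k_0} t^k` with `α + k_0 δ_0 > 0` and the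
`t_0^{r_0} t^r K_i`, `t_0^{r_0} t^r d_i` with `r_0 > 0`. -/
def tauPos : Submodule ℂ (S.tau c a₁ a₂) :=
  Submodule.span ℂ
    ({t | ∃ k α x, ∃ hx : x ∈ gradeRoot h₀ k α,
        IsPos b β₀ (extend h₀ α + k 0 • delta h₀ 0) ∧ t = S.tauX k x hx.1} ∪
      {t | ∃ r w, ∃ hr : r ∈ S.lattice, 0 < r 0 ∧ (t = S.tauK r w hr ∨ t = S.tauD r w hr)})

/-- `τ⁻`, the same with `α + k_0 δ_0 < 0` and `r_0 < 0`. -/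
def tauNeg : Submodule ℂ (S.tau c a₁ a₂) :=
  Submodule.span ℂ
    ({t | ∃ k α x, ∃ hx : x ∈ gradeRoot h₀ k α,
        IsPos b β₀ (-(extend h₀ α + k 0 • delta h₀ 0)) ∧ t = S.tauX k x hx.1} ∪
      {t | ∃ r w, ∃ hr : r ∈ S.lattice, r 0 < 0 ∧ (t = S.tauK r w hr ∨ t = S.tauD r w hr)})

variable (h₀)

/-- `τ⁰`, spanned by the `g(0̄, k̄, 0) ⊗ t^k` and the `t^r K_i`, `t^r d_i`. -/
def tauZero : Submodule ℂ (S.tau c a₁ a₂) :=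
  Submodule.span ℂ
    ({t | ∃ k x, ∃ hx : x ∈ gradeRoot h₀ k 0, k 0 = 0 ∧ t = S.tauX k x hx.1} ∪
      {t | ∃ r w, ∃ hr : r ∈ S.lattice, r 0 = 0 ∧ (t = S.tauK r w hr ∨ t = S.tauD r w hr)})

variable {h₀} (V : Type*) [AddCommGroup V] [Module ℂ V] [LieRingModule (S.tau c a₁ a₂) V]
  [LieModule ℂ (S.tau c a₁ a₂) V]

/-- The highest weight space `T = {v ∈ V | τ⁺ v = 0}`. -/
def highestWeightSpace : Submodule ℂ V where
  carrier := {v | ∀ t ∈ tauPos c a₁ a₂ b β₀, ⁅t, v⁆ = 0}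
  add_mem' hv hw t ht := by rw [lie_add, hv t ht, hw t ht, add_zero]
  zero_mem' t _ := lie_zero t
  smul_mem' a v hv t ht := by rw [lie_smul, hv t ht, smul_zero]

end Roots

end Weights

end Datum
end Toroidal

end

noncomputable section

open Module

/-! Choose `ρ ∈ h(0)` on which every simple root takes the value 1, and put `L = β₀(ρ) + 1`.
Evaluation at `ρ + L d_0` takes the value 1 on each of `α_0, …, α_p` and vanishes on every `δ_k`. A
weight `γ` maximising this evaluation on P(V) is therefore what is wanted: `γ + β + δ_k` with `β >
0` would give a strictly larger value. Since V is irreducible, all weights are congruent modulo the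
root lattice and the `δ_i` (`mem_weightCoset_of_mem_weights`), so the values lie in one coset of ℤ,
and it suffices to bound them above.

The bound has the following sources. For `k` in the lattice, the real root `α + ∑ k_i δ_i` gives an
`sl₂`-triple acting locally nilpotently, so P(V) is stable under its reflection (`reflect_mem`).
Since `K_1, …, K_n` act as zero, only `k_0` enters the value of a weight on the coroot.

Along a ray in the direction of `δ_0`, two successive injective root operators carry every far
weight space into one fixed space, so multiplicities are bounded (`exists_finrank_le`). The elements
`α^∨ ⊗ t_0^{r m_0}` act as a Heisenberg algebra with non-zero charge, and bounded multiplicities in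
positive degrees force such a graded module to vanish in large degrees
(`heisenberg_eventually_bot`). Products of two reflections make P(V) periodic in the directions
`δ_1, …, δ_n`. Hence finitely many rays control a whole coset of `∑ ℤ δ_i`, and `k_0` is bounded on
it (`exists_forall_le`).

To treat all restrictions to `h(0)` at once, use the quadratic form `energy`, that is `|res μ|² + 2
c C₀ μ(d_0)`. It is invariant under the translations of the affine Weyl group. Translating until
`μ(d_0)` is maximal leaves a weight of the same energy whose restriction is one of finitely many
(`exists_reduced`), so the energy is bounded above (`exists_energy_le`). As `C₀ > 0`, Cauchy–Schwarz
turns this into a bound on `ρ + L d_0`.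

The same element gives the triangular decomposition: `τ⁻`, `τ⁰` and `τ⁺` lie in the sums of the
eigenspaces of its adjoint action with negative, zero and positive eigenvalues. A weight vector of
weight `γ` is killed by `τ⁺`. -/

theorem exists_joint_eigenvector {V : Type*} [AddCommGroup V] [Module ℂ V] (T : ℕ → End ℂ V)
    (hT : ∀ i j, Commute (T i) (T j)) (M : ℕ) (W : Submodule ℂ V) [FiniteDimensional ℂ W]
    (hW : W ≠ ⊥) (hTW : ∀ i, ∀ v ∈ W, T i v ∈ W) :
    ∃ (x : ℕ → ℂ) (v : V), v ∈ W ∧ v ≠ 0 ∧ ∀ i < M, T i v = x i • v := by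
  induction M generalizing W with
  | zero =>
    obtain ⟨v, hv, hv0⟩ := W.ne_bot_iff.1 hW
    exact ⟨0, v, hv, hv0, fun i hi => absurd hi (Nat.not_lt_zero i)⟩
  | succ M ih =>
    have : Nontrivial W := Submodule.nontrivial_iff_ne_bot.2 hW
    obtain ⟨c, hc⟩ := Module.End.exists_eigenvalue ((T M).restrict (hTW M))
    obtain ⟨w, hw⟩ := hc.exists_hasEigenvector
    have hw1 : T M (w : V) = c • (w : V) := by
      have := congrArg Subtype.val hw.apply_eq_smul
      simpa using this
    -- The other operators commute with `T M`, so they preserve this eigenspace and the induction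
    -- continues inside it.
    let W' : Submodule ℂ V := W ⊓ (T M).eigenspace c
    have hW' : W' ≠ ⊥ := by
      refine W'.ne_bot_iff.2 ⟨w, ⟨w.2, Module.End.mem_eigenspace_iff.2 hw1⟩, ?_⟩
      simpa using hw.2
    have : FiniteDimensional ℂ W' := Submodule.finiteDimensional_of_le inf_le_left
    obtain ⟨x, v, hv, hv0, hx⟩ := ih W' hW' (fun i v hv => by
      refine ⟨hTW i v hv.1, Module.End.mem_eigenspace_iff.2 ?_⟩
      have h1 := Module.End.mem_eigenspace_iff.1 hv.2
      rw [← Module.End.mul_apply, (hT M i).eq, Module.End.mul_apply, h1, map_smul])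
    refine ⟨fun i => if i = M then c else x i, v, hv.1, hv0, fun i hi => ?_⟩
    by_cases h : i = M
    · subst h; simpa using Module.End.mem_eigenspace_iff.1 hv.2
    · simpa [h] using hx i (by omega)

/-! ### Graded modules over a Heisenberg algebra -/

section Heisenberg

variable {V : Type*} [AddCommGroup V] [Module ℂ V] {a : ℤ → End ℂ V} {κ : ℂ}

/-- The number operator of the mode `r`. -/
def numberOp (a : ℤ → End ℂ V) (r : ℕ) : End ℂ V := a (-r) * a r

theorem numberOp_commute (hcomm : ∀ r s, r + s ≠ 0 → Commute (a r) (a s)) (i j : ℕ) :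
    Commute (numberOp a i) (numberOp a j) := by
  rcases eq_or_ne i j with rfl | h
  · exact Commute.refl _
  · have c : ∀ x y : ℤ, x + y ≠ 0 → Commute (a x) (a y) := hcomm
    by_cases h0 : i = 0 ∧ j = 0
    · omega
    · exact ((c _ _ (by omega)).mul_right (c _ _ (by omega))).mul_left
        ((c _ _ (by omega)).mul_right (c _ _ (by omega)))

/-- The powers of a creation or annihilation operator shift the eigenvalue of the number operator
of the same mode. -/
theorem numberOp_pow_self (hcc : ∀ r : ℤ, a r * a (-r) - a (-r) * a r = ((r : ℂ) * κ) • 1)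
    {ε : ℤ} (hε : ε = 1 ∨ ε = -1) (r : ℕ) {x : ℂ} {v : V} (hv : numberOp a r v = x • v) (k : ℕ) :
    numberOp a r ((a (ε * r) ^ k) v) = (x - ε * (k * r * κ)) • (a (ε * r) ^ k) v := by
  have h1 : ∀ w, a r (a (-r) w) = a (-r) (a r w) + ((r : ℂ) * κ) • w := fun w => by
    have := LinearMap.congr_fun (hcc r) w
    simp only [LinearMap.sub_apply, Module.End.mul_apply, LinearMap.smul_apply,
      Module.End.one_apply] at this
    rw [sub_eq_iff_eq_add'] at this
    simpa using this
  induction k with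
  | zero => simpa using hv
  | succ k ih =>
    rw [pow_succ', Module.End.mul_apply]
    set w := (a (ε * r) ^ k) v
    rcases hε with rfl | rfl
    · rw [one_mul]
      rw [numberOp, Module.End.mul_apply] at ih ⊢
      have h2 := h1 (a r w)
      have h3 : a (-r) (a r (a r w)) = a r (a (-r) (a r w)) - ((r : ℂ) * κ) • a r w := by
        rw [h2]; abel
      rw [h3, ih, map_smul]
      push_cast
      module
    · rw [neg_one_mul]
      rw [numberOp, Module.End.mul_apply] at ih ⊢
      rw [h1 w, map_add, ih, map_smul, map_smul]
      push_cast
      module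

theorem numberOp_pow_of_ne (hcomm : ∀ r s, r + s ≠ 0 → Commute (a r) (a s))
    {ε : ℤ} (hε : ε = 1 ∨ ε = -1) {r s : ℕ} (hrs : r ≠ s) {x : ℂ} {v : V}
    (hv : numberOp a s v = x • v) (k : ℕ) :
    numberOp a s ((a (ε * r) ^ k) v) = x • (a (ε * r) ^ k) v := by
  have : Commute (numberOp a s) (a (ε * r) ^ k) :=
    Commute.pow_right (Commute.mul_left (hcomm _ _ (by rcases hε with rfl | rfl <;> omega))
      (hcomm _ _ (by rcases hε with rfl | rfl <;> omega))) k
  rw [← Module.End.mul_apply, this.eq, Module.End.mul_apply, hv, map_smul]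

/-- In each mode, the powers of the creation operators or those of the annihilation operators never
kill a given eigenvector of the number operator. -/
theorem exists_sign_pow_ne_zero (hκ : κ ≠ 0)
    (hcc : ∀ r : ℤ, a r * a (-r) - a (-r) * a r = ((r : ℂ) * κ) • 1)
    {r : ℕ} (hr : r ≠ 0) {x : ℂ} {v : V} (hv0 : v ≠ 0) (hv : numberOp a r v = x • v) :
    (∀ k : ℕ, (a ((1 : ℤ) * r) ^ k) v ≠ 0) ∨ (∀ k : ℕ, (a ((-1 : ℤ) * r) ^ k) v ≠ 0) := by
  have hrκ : (r : ℂ) * κ ≠ 0 := mul_ne_zero (Nat.cast_ne_zero.2 hr) hκ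
  -- If `a r` kills a non-zero `a r ^ k v`, the number operator vanishes there and `x = k r κ`. If
  -- instead `x = l r κ` with `l` natural, then `a r * a (-r)` acts on `a (-r) ^ k v` by `(l + k +
  -- 1) r κ ≠ 0`.
  by_cases h : ∀ k : ℕ, x ≠ k * r * κ
  · left
    intro k
    induction k with
    | zero => simpa using hv0
    | succ k ih =>
      intro h0
      have h1 := numberOp_pow_self hcc (Or.inl rfl) r hv k
      rw [pow_succ', Module.End.mul_apply, one_mul] at h0
      rw [numberOp, Module.End.mul_apply, one_mul, h0, map_zero, eq_comm, smul_eq_zero] at h1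
      rw [one_mul] at ih
      refine (h1.resolve_right ih) |> fun h2 => h k ?_
      push_cast at h2
      linear_combination h2
  · push Not at h
    obtain ⟨l, rfl⟩ := h
    right
    intro k
    induction k with
    | zero => simpa using hv0
    | succ k ih =>
      intro h0
      have h1 := numberOp_pow_self hcc (Or.inr rfl) r hv k
      have h2 := LinearMap.congr_fun (hcc r) ((a ((-1 : ℤ) * r) ^ k) v)
      rw [pow_succ', Module.End.mul_apply] at h0
      rw [neg_one_mul] at h0 h1 h2 ih
      rw [numberOp, Module.End.mul_apply] at h1
      simp only [LinearMap.sub_apply, Module.End.mul_apply, LinearMap.smul_apply,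
        Module.End.one_apply, h0, map_zero, h1] at h2
      rw [zero_sub, neg_eq_iff_add_eq_zero, ← add_smul, smul_eq_zero] at h2
      have h3 := h2.resolve_right ih
      have h4 : ((l + k + 1 : ℕ) : ℂ) * ((r : ℂ) * κ) = 0 := by
        push_cast at h3 ⊢
        linear_combination h3
      exact (mul_ne_zero (Nat.cast_ne_zero.2 (Nat.succ_ne_zero _)) hrκ) h4

/-- A graded module over the Heisenberg algebra with non-zero charge whose homogeneous components
have bounded dimension in positive degrees vanishes in large degrees. -/
theorem heisenberg_eventually_bot (W : ℤ → Submodule ℂ V) (hκ : κ ≠ 0)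
    (hcomm : ∀ r s, r + s ≠ 0 → Commute (a r) (a s))
    (hcc : ∀ r : ℤ, a r * a (-r) - a (-r) * a r = ((r : ℂ) * κ) • 1)
    (ha : ∀ r n, ∀ v ∈ W n, a r v ∈ W (n + r)) (d : ℕ)
    (hfd : ∀ n, FiniteDimensional ℂ (W n)) (hd : ∀ n, 0 ≤ n → finrank ℂ (W n) ≤ d) :
    ∃ N : ℤ, ∀ n, N ≤ n → W n = ⊥ := by
  by_contra! hcon
  -- Among `2d + 2` modes, at least `d + 1` share a sign. The degree is taken at least `M!` so that
  -- `n ± M!` is still non-negative, where the dimension bound applies.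
  set M : ℕ := 2 * d + 2 with hM
  obtain ⟨n, hn, hWn⟩ := hcon (M.factorial : ℤ)
  have hN : ∀ i, ∀ v ∈ W n, numberOp a i v ∈ W n := fun i v hv => by
    have := ha (-i) _ _ (ha i n v hv)
    rwa [add_neg_cancel_right] at this
  obtain ⟨x, v, hv, hv0, hx⟩ :=
    exists_joint_eigenvector (numberOp a) (numberOp_commute hcomm) (M + 1) (W n) hWn hN
  -- a large set of modes with the same sign
  have hsplit : ∃ ε : ℤ, (ε = 1 ∨ ε = -1) ∧ ∃ R : Finset ℕ, R ⊆ Finset.Icc 1 M ∧ d < R.card ∧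
      ∀ r ∈ R, ∀ k : ℕ, (a (ε * r) ^ k) v ≠ 0 := by
    classical
    let R₁ := (Finset.Icc 1 M).filter fun r : ℕ => ∀ k : ℕ, (a ((1 : ℤ) * r) ^ k) v ≠ 0
    let R₂ := (Finset.Icc 1 M).filter fun r : ℕ => ¬ ∀ k : ℕ, (a ((1 : ℤ) * r) ^ k) v ≠ 0
    have hc : R₁.card + R₂.card = M := by
      rw [Finset.card_filter_add_card_filter_not]; simp
    by_cases h : d < R₁.card
    · exact ⟨1, Or.inl rfl, R₁, Finset.filter_subset _ _, h, fun r hr =>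
        (Finset.mem_filter.1 hr).2⟩
    · refine ⟨-1, Or.inr rfl, R₂, Finset.filter_subset _ _, by omega, fun r hr => ?_⟩
      have h1 := Finset.mem_filter.1 hr
      have h2 := Finset.mem_Icc.1 h1.1
      exact (exists_sign_pow_ne_zero hκ hcc (by omega) hv0 (hx r (by omega))).resolve_left h1.2
  obtain ⟨ε, hε, R, hRM, hRd, hR⟩ := hsplit
  set E := M.factorial
  -- The exponent `M! / r` makes every mode move `v` by the same total degree `ε M!`.
  have hmem : ∀ r : R, (a (ε * (r : ℕ)) ^ (E / (r : ℕ))) v ∈ W (n + ε * E) := fun r => by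
    have hk : ∀ k : ℕ, (a (ε * (r : ℕ)) ^ k) v ∈ W (n + k * (ε * (r : ℕ))) := fun k => by
      induction k with
      | zero => simpa using hv
      | succ k ih =>
        rw [pow_succ', Module.End.mul_apply]
        have := ha (ε * (r : ℕ)) _ _ ih
        convert this using 2
        push_cast; ring
    have h1 := Finset.mem_Icc.1 (hRM r.2)
    have h2 : E / (r : ℕ) * (r : ℕ) = E := Nat.div_mul_cancel (Nat.dvd_factorial (by omega) h1.2)
    have h3 := hk (E / (r : ℕ))
    have h4 : ((E / (r : ℕ) : ℕ) : ℤ) * (ε * (r : ℕ)) = ε * E := by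
      have h5 : ((E / (r : ℕ) : ℕ) : ℤ) * (r : ℕ) = E := by exact_mod_cast h2
      linear_combination ε * h5
    rwa [h4] at h3
  let u : R → W (n + ε * E) := fun r => ⟨_, hmem r⟩
  have hE : (E : ℂ) ≠ 0 := Nat.cast_ne_zero.2 (Nat.factorial_ne_zero M)
  have hεc : (ε : ℂ) ≠ 0 := by rcases hε with rfl | rfl <;> simp
  -- Mode `r` shifts its own number operator by `-ε E κ`, independently of `r`. Weighting by `s`
  -- makes the shift `-ε E κ r`, so the vectors `u r` have distinct eigenvalues: more than `d`
  -- independent vectors in one component.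
  let T : End ℂ V := ∑ s ∈ Finset.Icc 1 M, (s : ℂ) • numberOp a s
  let X : ℂ := ∑ s ∈ Finset.Icc 1 M, (s : ℂ) * x s
  have hT : ∀ r : R, T.HasEigenvector (X - ε * E * κ * (r : ℕ)) (u r : V) := fun r => by
    have h1 := Finset.mem_Icc.1 (hRM r.2)
    refine ⟨Module.End.mem_eigenspace_iff.2 ?_, hR r r.2 _⟩
    have h2 : ((E / (r : ℕ) : ℕ) : ℂ) * ((r : ℕ) : ℂ) = E := by
      rw [← Nat.cast_mul, Nat.div_mul_cancel (Nat.dvd_factorial (by omega) h1.2)]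
    have key : ∀ s ∈ Finset.Icc 1 M, ((s : ℂ) • numberOp a s) (u r : V) =
        ((s : ℂ) * x s - if s = (r : ℕ) then ε * E * κ * (r : ℕ) else 0) • (u r : V) := by
      intro s hs
      have hs' := Finset.mem_Icc.1 hs
      rw [LinearMap.smul_apply]
      split_ifs with hsr
      · subst hsr
        rw [numberOp_pow_self hcc hε _ (hx _ (by omega)), smul_smul, h2]
        congr 1; ring
      · rw [numberOp_pow_of_ne hcomm hε (Ne.symm hsr) (hx _ (by omega)), smul_smul, sub_zero]
    rw [LinearMap.sum_apply, Finset.sum_congr rfl key, ← Finset.sum_smul, Finset.sum_sub_distrib,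
      Finset.sum_ite_eq', if_pos (hRM r.2)]
  have hli : LinearIndependent ℂ fun r : R => (u r : V) :=
    Module.End.eigenvectors_linearIndependent' T _ (fun r s h => by
      have h' : X - ε * E * κ * (r : ℕ) = X - ε * E * κ * (s : ℕ) := h
      have h1 : (ε * E * κ : ℂ) ≠ 0 := mul_ne_zero (mul_ne_zero hεc hE) hκ
      exact Subtype.ext (Nat.cast_injective (R := ℂ) (mul_left_cancel₀ h1 (sub_right_injective h'))))
      _ hT
  have hli' : LinearIndependent ℂ u :=
    LinearIndependent.of_comp (W (n + ε * E)).subtype hli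
  have := hfd (n + ε * E)
  have h1 := hli'.fintype_card_le_finrank
  rw [Fintype.card_coe] at h1
  have h2 := hd (n + ε * E) (by rcases hε with rfl | rfl <;> omega)
  omega

end Heisenberg

/-! ### Locally nilpotent `sl₂`-actions, without finite dimensionality -/

namespace IsSl2Triple

variable {L M : Type*} [LieRing L] [LieAlgebra ℂ L] [AddCommGroup M] [Module ℂ M]
  [LieRingModule L M] [LieModule ℂ L M] {h e f : L}

open LieModule

/-- At the last non-zero power `f ^ n m`, the identity `e f ^ (n+1) m = (n+1)(μ - n) f ^ n m` has
left side zero, which forces `μ = n`. -/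
theorem exists_nat_of_nilpotent {t : IsSl2Triple h e f} {m : M} {μ : ℂ}
    (P : HasPrimitiveVectorWith t m μ) (hf : ∃ N : ℕ, (toEnd ℂ L M f ^ N) m = 0) :
    ∃ n : ℕ, μ = n ∧ ∀ i ≤ n, (toEnd ℂ L M f ^ i) m ≠ 0 := by
  obtain ⟨n, hn₁, hn₂⟩ := Nat.exists_not_and_succ_of_not_zero_of_exists
    (p := fun k => (toEnd ℂ L M f ^ k) m = 0) P.ne_zero hf
  have := P.lie_e_pow_succ_toEnd_f n
  rw [hn₂, lie_zero, eq_comm, smul_eq_zero_iff_left hn₁, mul_eq_zero, sub_eq_zero] at this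
  refine ⟨n, this.resolve_left (Nat.cast_add_one_ne_zero n), fun i hi h0 => hn₁ ?_⟩
  obtain ⟨j, rfl⟩ := Nat.exists_eq_add_of_le' hi
  rw [pow_add, Module.End.mul_apply, h0, map_zero]

/-- The last non-zero power of `e` applied to `m` is primitive, and each `e` adds 2 to the weight.
-/
theorem exists_primitive (t : IsSl2Triple h e f) {m : M} {μ : ℂ} (hm : m ≠ 0)
    (hμ : ⁅h, m⁆ = μ • m) (he : ∃ N : ℕ, (toEnd ℂ L M e ^ N) m = 0) :
    ∃ j : ℕ, HasPrimitiveVectorWith t ((toEnd ℂ L M e ^ j) m) (μ + 2 * j) := by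
  obtain ⟨n, hn₁, hn₂⟩ := Nat.exists_not_and_succ_of_not_zero_of_exists
    (p := fun k => (toEnd ℂ L M e ^ k) m = 0) hm he
  refine ⟨n, hn₁, ?_, ?_⟩
  · clear hn₁ hn₂
    induction n with
    | zero => simpa using hμ
    | succ n ih =>
      rw [pow_succ', Module.End.mul_apply, toEnd_apply_apply, leibniz_lie, ih, t.lie_h_e_smul ℂ,
        lie_smul, smul_lie]
      push_cast
      module
  · simpa [pow_succ'] using hn₂

theorem exists_int (t : IsSl2Triple h e f)
    (he : ∀ m : M, ∃ N : ℕ, (toEnd ℂ L M e ^ N) m = 0)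
    (hf : ∀ m : M, ∃ N : ℕ, (toEnd ℂ L M f ^ N) m = 0) 
    {m : M} {μ : ℂ} (hm : m ≠ 0) (hμ : ⁅h, m⁆ = μ • m) : ∃ n : ℤ, μ = n := by
  obtain ⟨j, hj⟩ := t.exists_primitive hm hμ (he m)
  obtain ⟨n, hn, -⟩ := exists_nat_of_nilpotent hj (hf _)
  exact ⟨n - 2 * j, by push_cast; linear_combination hn⟩

/-- The lowering operator is injective on weight spaces of positive weight. -/
theorem eq_zero_of_lie_f (t : IsSl2Triple h e f)
    (he : ∀ m : M, ∃ N : ℕ, (toEnd ℂ L M e ^ N) m = 0)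
    {m : M} {n : ℤ} (hn : 0 < n) (hμ : ⁅h, m⁆ = (n : ℂ) • m)
    (h0 : ⁅f, m⁆ = 0) : m = 0 := by
  by_contra hm
  -- A non-zero vector killed by `f` is primitive for the opposite triple, whose weight `-n` would
  -- then have to be a natural number.
  have P : HasPrimitiveVectorWith t.symm m (-n : ℂ) := ⟨hm, by rw [neg_lie, hμ, neg_smul], h0⟩
  obtain ⟨k, hk, -⟩ := exists_nat_of_nilpotent P (he _)
  have : (-n : ℤ) = k := by exact_mod_cast hk
  omega

/-- Reflecting a vector of weight `n`. -/
theorem exists_pow_f_pow_e_ne_zero (t : IsSl2Triple h e f)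
    (he : ∀ m : M, ∃ N : ℕ, (toEnd ℂ L M e ^ N) m = 0)
    (hf : ∀ m : M, ∃ N : ℕ, (toEnd ℂ L M f ^ N) m = 0) 
    {m : M} {n : ℕ} (hm : m ≠ 0) (hμ : ⁅h, m⁆ = (n : ℂ) • m) :
    ∃ j : ℕ, (toEnd ℂ L M f ^ (n + j)) ((toEnd ℂ L M e ^ j) m) ≠ 0 := by
  obtain ⟨j, hj⟩ := t.exists_primitive hm hμ (he m)
  obtain ⟨k, hk, h1⟩ := exists_nat_of_nilpotent hj (hf _)
  have : n + 2 * j = k := by exact_mod_cast hk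
  -- The primitive vector `e ^ j m` has weight `n + 2j`, so it survives `n + j ≤ n + 2j` lowerings;
  -- the result has weight `-n`.
  exact ⟨j, h1 _ (by omega)⟩

end IsSl2Triple

namespace Toroidal

namespace Datum

open LieAlgebra.IsKilling LieModule

set_option linter.unusedSectionVars false

/-! ### The form of `g` on `h(0)`, positivity, and heights -/

section FiniteTheory

variable {g : Type*} [LieRing g] [LieAlgebra ℂ g] [FiniteDimensional ℂ g]
  {n : ℕ} {S : Datum g n} [LieAlgebra.IsSimple ℂ S.fixed] {h₀ : LieSubalgebra ℂ S.fixed}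
  [h₀.IsCartanSubalgebra]

variable (h₀) in
/-- The root lattice of `g(0̄, 0̄)`. -/
def rootLattice : AddSubgroup (Dual ℂ h₀) :=
  AddSubgroup.closure (Set.range (rootSystem h₀).root)

theorem root_mem_rootLattice (i : h₀.root) : (rootSystem h₀).root i ∈ rootLattice h₀ :=
  AddSubgroup.subset_closure ⟨i, rfl⟩

theorem enlargedRoots_subset_rootLattice {α : Dual ℂ h₀} (hα : α ∈ enlargedRoots h₀) :
    α ∈ rootLattice h₀ := by
  rcases hα with rfl | ⟨i, rfl⟩ | ⟨-, i, -, rfl⟩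
  · exact zero_mem _
  · exact root_mem_rootLattice i
  · rw [two_smul]; exact add_mem (root_mem_rootLattice i) (root_mem_rootLattice i)

theorem neg_mem_enlargedRoots {α : Dual ℂ h₀} (hα : α ∈ enlargedRoots h₀) :
    -α ∈ enlargedRoots h₀ := by
  rcases hα with rfl | ⟨i, rfl⟩ | ⟨hB, i, hi, rfl⟩
  · left; simp
  · right; left
    exact ⟨(rootSystem h₀).reflectionPerm i i, by
      rw [RootPairing.root_reflectionPerm, RootPairing.reflection_apply_self]⟩
  · right; right
    refine ⟨hB, (rootSystem h₀).reflectionPerm i i, fun j => ?_, by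
      rw [RootPairing.root_reflectionPerm, RootPairing.reflection_apply_self, smul_neg]⟩
    have h1 : ((rootSystem h₀).posRootForm ℚ).rootLength ((rootSystem h₀).reflectionPerm i i) =
        ((rootSystem h₀).posRootForm ℚ).rootLength i :=
      RootPairing.RootPositiveForm.rootLength_reflectionPerm_self _ i
    rw [h1]; exact hi j

/-- Elements of the root lattice are integral on coroots. -/
theorem apply_coroot_int {α : Dual ℂ h₀} (hα : α ∈ rootLattice h₀) (i : h₀.root) :
    ∃ z : ℤ, α ((rootSystem h₀).coroot i) = z := by
  induction hα using AddSubgroup.closure_induction with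
  | mem x hx =>
    obtain ⟨j, rfl⟩ := hx
    obtain ⟨z, hz⟩ := (rootSystem h₀).exists_value (S := ℤ) j i
    exact ⟨z, hz.symm⟩
  | zero => exact ⟨0, by simp⟩
  | add x y _ _ hx hy =>
    obtain ⟨a, ha⟩ := hx
    obtain ⟨c, hc⟩ := hy
    exact ⟨a + c, by simp [-rootSystem_coroot_apply, ha, hc]⟩
  | neg x _ hx =>
    obtain ⟨a, ha⟩ := hx
    exact ⟨-a, by simp [-rootSystem_coroot_apply, ha]⟩

/-- Root vectors of `g(0̄, 0̄)`, normalised to an `sl₂`-triple. -/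
theorem exists_rootVectors (i : h₀.root) : ∃ x y : S.fixed,
    IsSl2Triple (((rootSystem h₀).coroot i : h₀) : S.fixed) x y ∧
    (∀ h : h₀, ⁅(h : S.fixed), x⁆ = (rootSystem h₀).root i h • x) ∧
    (∀ h : h₀, ⁅(h : S.fixed), y⁆ = (-(rootSystem h₀).root i) h • y) := by
  have hi := LieSubalgebra.isNonZero_coe_root i
  obtain ⟨h, e, f, ht, he, hf⟩ := exists_isSl2Triple_of_weight_isNonZero hi
  have hh := ht.h_eq_coroot hi he hf
  subst hh
  exact ⟨e, f, ht, fun h => lie_eq_smul_of_mem_rootSpace he h,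
    fun h => lie_eq_smul_of_mem_rootSpace hf h⟩

variable (h₀) in
/-- The Killing form of `g`, restricted to `h(0)`. -/
def cartanForm : LinearMap.BilinForm ℂ h₀ := traceForm ℂ h₀ g

theorem cartanForm_apply (x y : h₀) :
    cartanForm h₀ x y = killingForm ℂ g ((x : S.fixed) : g) ((y : S.fixed) : g) := rfl

theorem cartanForm_comm (x y : h₀) : cartanForm h₀ x y = cartanForm h₀ y x :=
  traceForm_comm ℂ h₀ g x y

theorem weight_mem_enlargedRoots (hroots : weightsOnG h₀ ⊆ enlargedRoots h₀)
    (χ : Weight ℂ h₀ g) : χ.toLinear ∈ enlargedRoots h₀ := by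
  obtain ⟨m, hm, hχ⟩ := exists_forall_lie_eq_smul ℂ h₀ g χ
  exact hroots ⟨m, hm, fun h => hχ h⟩

/-- Elements of `h(0)` on which all roots take real values. -/
def IsRealElt (t : h₀) : Prop := ∀ i, ∃ r : ℝ, (rootSystem h₀).root i t = r

theorem IsRealElt.apply_rootLattice {t : h₀} (ht : IsRealElt t) {α : Dual ℂ h₀}
    (hα : α ∈ rootLattice h₀) : ∃ r : ℝ, α t = r := by
  induction hα using AddSubgroup.closure_induction with
  | mem x hx =>
    obtain ⟨j, rfl⟩ := hx
    exact ht j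
  | zero => exact ⟨0, by simp⟩
  | add x y _ _ hx hy =>
    obtain ⟨a, ha⟩ := hx
    obtain ⟨c, hc⟩ := hy
    exact ⟨a + c, by simp [-rootSystem_coroot_apply, ha, hc]⟩
  | neg x _ hx =>
    obtain ⟨a, ha⟩ := hx
    exact ⟨-a, by simp [-rootSystem_coroot_apply, ha]⟩

theorem IsRealElt.sub_smul {s t : h₀} (hs : IsRealElt s) (ht : IsRealElt t) (a : ℝ) :
    IsRealElt (s - (a : ℂ) • t) := fun i => by
  obtain ⟨x, hx⟩ := hs i
  obtain ⟨y, hy⟩ := ht i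
  exact ⟨x - a * y, by simp [-rootSystem_root_apply, hx, hy]⟩

theorem isRealElt_coroot (i : h₀.root) : IsRealElt ((rootSystem h₀).coroot i) := fun j => by
  obtain ⟨z, hz⟩ := apply_coroot_int (root_mem_rootLattice j) i
  exact ⟨z, by rw [hz]; simp⟩

/-- The trace form at `(t, t)` is the sum of the squares `χ(t)²` over the weights of `g`, with
multiplicity. These weights lie in the root lattice, so each `χ(t)` is real. -/
theorem cartanForm_self_nonneg (hroots : weightsOnG h₀ ⊆ enlargedRoots h₀) {t : h₀}
    (ht : IsRealElt t) : ∃ r : ℝ, 0 ≤ r ∧ cartanForm h₀ t t = r := by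
  have h : ∀ χ : Weight ℂ h₀ g, ∃ r : ℝ, χ t = r := fun χ =>
    ht.apply_rootLattice (enlargedRoots_subset_rootLattice (weight_mem_enlargedRoots hroots χ))
  choose r hr using h
  refine ⟨∑ χ : Weight ℂ h₀ g, finrank ℂ (genWeightSpace g χ) • (r χ * r χ),
    Finset.sum_nonneg fun χ _ => nsmul_nonneg (mul_self_nonneg _) _, ?_⟩
  rw [cartanForm, traceForm_eq_sum_finrank_nsmul_mul]
  push_cast
  exact Finset.sum_congr rfl fun χ _ => by simp [-rootSystem_coroot_apply, hr]

/-- The invariant form pairs the coroot of `α` with `h` to a positive multiple of `α(h)`. -/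
theorem exists_cartanForm_coroot (hroots : weightsOnG h₀ ⊆ enlargedRoots h₀) (i : h₀.root) :
    ∃ κ : ℝ, 0 < κ ∧ (∀ t : h₀, cartanForm h₀ ((rootSystem h₀).coroot i) t =
        (κ : ℂ) * (rootSystem h₀).root i t) ∧
      ∀ x y : S.fixed, IsSl2Triple (((rootSystem h₀).coroot i : h₀) : S.fixed) x y →
        (∀ h : h₀, ⁅(h : S.fixed), y⁆ = (-(rootSystem h₀).root i) h • y) →
        killingForm ℂ g (x : g) (y : g) = (κ : ℂ) := by
  -- Invariance of the form: `(α^∨, t) = ([x, y], t) = (x, [y, t]) = α(t) (x, y)`.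
  have key : ∀ x y : S.fixed, IsSl2Triple (((rootSystem h₀).coroot i : h₀) : S.fixed) x y →
      (∀ h : h₀, ⁅(h : S.fixed), y⁆ = (-(rootSystem h₀).root i) h • y) → ∀ t : h₀,
      cartanForm h₀ ((rootSystem h₀).coroot i) t =
        killingForm ℂ g (x : g) (y : g) * (rootSystem h₀).root i t := by
    intro x y ht hy t
    have h1 : ((((rootSystem h₀).coroot i : h₀) : S.fixed) : g) = ⁅(x : g), (y : g)⁆ := by
      rw [← ht.lie_e_f]; rfl
    have h2 : ⁅(y : g), ((t : S.fixed) : g)⁆ = (rootSystem h₀).root i t • (y : g) := by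
      have := congrArg (Subtype.val (p := fun z => z ∈ S.fixed)) (hy t)
      rw [← lie_skew]
      change -⁅((t : S.fixed) : g), (y : g)⁆ = _
      have h3 : ⁅((t : S.fixed) : g), (y : g)⁆ = (-(rootSystem h₀).root i) t • (y : g) := this
      rw [h3]; simp
    rw [cartanForm_apply, h1, LieModule.traceForm_apply_lie_apply, h2, map_smul, smul_eq_mul,
      mul_comm]
  obtain ⟨x, y, ht, hx, hy⟩ := exists_rootVectors i
  have hself : (rootSystem h₀).root i ((rootSystem h₀).coroot i) = 2 :=
    (rootSystem h₀).root_coroot_two i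
  -- the norm of a coroot is a sum of squares of integers, not all zero
  have hpos : ∃ r : ℝ, 0 < r ∧
      cartanForm h₀ ((rootSystem h₀).coroot i) ((rootSystem h₀).coroot i) = r := by
    have h : ∀ χ : Weight ℂ h₀ g, ∃ r : ℝ, χ ((rootSystem h₀).coroot i) = r := fun χ =>
      (isRealElt_coroot i).apply_rootLattice
        (enlargedRoots_subset_rootLattice (weight_mem_enlargedRoots hroots χ))
    choose r hr using h
    refine ⟨∑ χ : Weight ℂ h₀ g, finrank ℂ (genWeightSpace g χ) • (r χ * r χ), ?_, ?_⟩
    · have hxg : (x : g) ∈ genWeightSpace g ((rootSystem h₀).root i) := by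
        rw [mem_genWeightSpace]
        intro h
        refine ⟨1, ?_⟩
        have h3 : ⁅((h : S.fixed) : g), (x : g)⁆ = (rootSystem h₀).root i h • (x : g) :=
          congrArg (Subtype.val (p := fun z => z ∈ S.fixed)) (hx h)
        rw [pow_one, LinearMap.sub_apply, LinearMap.smul_apply, Module.End.one_apply,
          sub_eq_zero]
        exact h3
      have hne : genWeightSpace g ((rootSystem h₀).root i) ≠ ⊥ := by
        intro h0
        rw [h0] at hxg
        exact ht.e_ne_zero (Subtype.ext hxg)
      -- The root itself is a weight of `g` and contributes a positive multiple of `2²`.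
      let χ : Weight ℂ h₀ g := ⟨(rootSystem h₀).root i, hne⟩
      refine Finset.sum_pos' (fun χ _ => nsmul_nonneg (mul_self_nonneg _) _)
        ⟨χ, Finset.mem_univ _, ?_⟩
      have h2 : r χ = 2 := by
        have : χ ((rootSystem h₀).coroot i) = 2 := hself
        rw [hr] at this
        exact_mod_cast this
      rw [h2]
      have : Nontrivial (genWeightSpace g χ) :=
        (LieSubmodule.nontrivial_iff_ne_bot ℂ h₀ g).2 hne
      exact nsmul_pos (by norm_num) (Module.finrank_pos (R := ℂ)).ne'
    · rw [cartanForm, traceForm_eq_sum_finrank_nsmul_mul]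
      push_cast
      exact Finset.sum_congr rfl fun χ _ => by simp [-rootSystem_coroot_apply, hr]
  obtain ⟨r, hr0, hr⟩ := hpos
  have hκ : ∀ x y : S.fixed, IsSl2Triple (((rootSystem h₀).coroot i : h₀) : S.fixed) x y →
      (∀ h : h₀, ⁅(h : S.fixed), y⁆ = (-(rootSystem h₀).root i) h • y) →
      killingForm ℂ g (x : g) (y : g) = ((r / 2 : ℝ) : ℂ) := by
    intro x y ht hy
    have := key x y ht hy ((rootSystem h₀).coroot i)
    rw [hself, hr] at this
    push_cast
    linear_combination -this / 2
  -- Taking `t = α^∨` in the invariance identity gives `(α^∨, α^∨) = 2 (x, y)`, whence the half.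
  exact ⟨r / 2, by positivity, fun t => by rw [key x y ht hy, hκ x y ht hy], hκ⟩

variable (h₀) in
/-- `(α^∨, α^∨) / 2` for the root `α` with index `i`. -/
def kap (hroots : weightsOnG h₀ ⊆ enlargedRoots h₀) (i : h₀.root) : ℝ :=
  (exists_cartanForm_coroot hroots i).choose

theorem kap_pos (hroots : weightsOnG h₀ ⊆ enlargedRoots h₀) (i : h₀.root) : 0 < kap h₀ hroots i :=
  (exists_cartanForm_coroot hroots i).choose_spec.1

theorem cartanForm_coroot (hroots : weightsOnG h₀ ⊆ enlargedRoots h₀) (i : h₀.root) (t : h₀) :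
    cartanForm h₀ ((rootSystem h₀).coroot i) t =
      (kap h₀ hroots i : ℂ) * (rootSystem h₀).root i t :=
  (exists_cartanForm_coroot hroots i).choose_spec.2.1 t

theorem killingForm_rootVectors (hroots : weightsOnG h₀ ⊆ enlargedRoots h₀) (i : h₀.root)
    {x y : S.fixed} (ht : IsSl2Triple (((rootSystem h₀).coroot i : h₀) : S.fixed) x y)
    (hy : ∀ h : h₀, ⁅(h : S.fixed), y⁆ = (-(rootSystem h₀).root i) h • y) :
    killingForm ℂ g (x : g) (y : g) = (kap h₀ hroots i : ℂ) :=
  (exists_cartanForm_coroot hroots i).choose_spec.2.2 x y ht hy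

theorem eq_zero_of_root_apply {t : h₀} (h : ∀ i, (rootSystem h₀).root i t = 0) : t = 0 := by
  have h1 : ∀ f : Dual ℂ h₀, f t = 0 := fun f => by
    have hf : f ∈ Submodule.span ℂ (Set.range (rootSystem h₀).root) := by
      rw [RootPairing.IsRootSystem.span_root_eq_top]; trivial
    induction hf using Submodule.span_induction with
    | mem x hx => obtain ⟨i, rfl⟩ := hx; exact h i
    | zero => rfl
    | add x y _ _ hx hy => simp [hx, hy]
    | smul a x _ hx => simp [hx]
  exact (Module.forall_dual_apply_eq_zero_iff ℂ t).1 h1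

/-- An element of the radical pairs to zero with every coroot, so every root vanishes on it, and the
roots span the dual. -/
theorem cartanForm_nondegenerate (hroots : weightsOnG h₀ ⊆ enlargedRoots h₀) :
    (cartanForm h₀).Nondegenerate := by
  have hl : ∀ t : h₀, (∀ s, cartanForm h₀ t s = 0) → t = 0 := fun t h => by
    refine eq_zero_of_root_apply fun i => ?_
    have := cartanForm_coroot hroots i t
    rw [cartanForm_comm, h, eq_comm, mul_eq_zero] at this
    exact this.resolve_left (Complex.ofReal_ne_zero.2 (kap_pos hroots i).ne')
  exact ⟨hl, fun t h => hl t fun s => by rw [cartanForm_comm]; exact h s⟩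

variable (h₀) in
/-- The identification of `h(0)*` with `h(0)` by means of the invariant form. -/
def dualElt (hroots : weightsOnG h₀ ⊆ enlargedRoots h₀) : Dual ℂ h₀ →ₗ[ℂ] h₀ :=
  (LinearMap.BilinForm.toDual _ (cartanForm_nondegenerate hroots)).symm.toLinearMap

theorem cartanForm_dualElt (hroots : weightsOnG h₀ ⊆ enlargedRoots h₀) (ν : Dual ℂ h₀) (t : h₀) :
    cartanForm h₀ (dualElt h₀ hroots ν) t = ν t := by
  have := (LinearMap.BilinForm.toDual _ (cartanForm_nondegenerate hroots)).apply_symm_apply ν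
  exact LinearMap.congr_fun this t

theorem kap_mul_root_dualElt (hroots : weightsOnG h₀ ⊆ enlargedRoots h₀) (ν : Dual ℂ h₀)
    (i : h₀.root) : (kap h₀ hroots i : ℂ) * (rootSystem h₀).root i (dualElt h₀ hroots ν) =
      ν ((rootSystem h₀).coroot i) := by
  rw [← cartanForm_coroot, cartanForm_comm, cartanForm_dualElt]

/-- Weights of V need not lie in the root lattice; integrality on coroots is all that is known of
their restrictions, and it suffices for positivity of the norm. -/
theorem isRealElt_dualElt (hroots : weightsOnG h₀ ⊆ enlargedRoots h₀) {ν : Dual ℂ h₀}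
    (hν : ∀ i, ∃ z : ℤ, ν ((rootSystem h₀).coroot i) = z) : IsRealElt (dualElt h₀ hroots ν) :=
  fun i => by
    obtain ⟨z, hz⟩ := hν i
    have h1 := kap_mul_root_dualElt hroots ν i
    have h2 : (kap h₀ hroots i : ℂ) ≠ 0 := Complex.ofReal_ne_zero.2 (kap_pos hroots i).ne'
    refine ⟨z / kap h₀ hroots i, ?_⟩
    push_cast
    rw [eq_div_iff h2, ← hz, ← h1, mul_comm]

/-- The norm on `h(0)*` transported from the invariant form. -/
def normSq (hroots : weightsOnG h₀ ⊆ enlargedRoots h₀) (ν : Dual ℂ h₀) : ℝ :=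
  (ν (dualElt h₀ hroots ν)).re

theorem normSq_nonneg (hroots : weightsOnG h₀ ⊆ enlargedRoots h₀) {ν : Dual ℂ h₀}
    (hν : ∀ i, ∃ z : ℤ, ν ((rootSystem h₀).coroot i) = z) : 0 ≤ normSq hroots ν := by
  obtain ⟨r, hr, h⟩ := cartanForm_self_nonneg hroots (isRealElt_dualElt hroots hν)
  rw [cartanForm_dualElt] at h
  rw [normSq, h]
  exact hr

/-- Under the form, the root `α` corresponds to `α^∨ / κ` and has square length `2 / κ`, where `κ =
kap h₀ hroots i`; the square is then expanded and multiplied by `κ`. -/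
theorem normSq_sub_smul_root (hroots : weightsOnG h₀ ⊆ enlargedRoots h₀) (ν : Dual ℂ h₀)
    (i : h₀.root) {x : ℤ} (hx : ν ((rootSystem h₀).coroot i) = x) (s : ℝ) :
    kap h₀ hroots i * normSq hroots (ν - (s : ℂ) • (rootSystem h₀).root i) =
      kap h₀ hroots i * normSq hroots ν - 2 * s * x + 2 * s ^ 2 := by
  have h1 : (kap h₀ hroots i : ℂ) ≠ 0 := Complex.ofReal_ne_zero.2 (kap_pos hroots i).ne'
  have h2 : dualElt h₀ hroots ((rootSystem h₀).root i) =
      (kap h₀ hroots i : ℂ)⁻¹ • (rootSystem h₀).coroot i := by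
    apply (LinearMap.BilinForm.toDual _ (cartanForm_nondegenerate hroots)).injective
    ext t
    change cartanForm h₀ _ t = cartanForm h₀ _ t
    rw [cartanForm_dualElt, map_smul, LinearMap.smul_apply, cartanForm_coroot hroots, smul_eq_mul,
      inv_mul_cancel_left₀ h1]
  have h3 := kap_mul_root_dualElt hroots ν i
  have h4 : (rootSystem h₀).root i ((rootSystem h₀).coroot i) = 2 :=
    (rootSystem h₀).root_coroot_two i
  have h5 : (kap h₀ hroots i : ℂ) * ((ν - (s : ℂ) • (rootSystem h₀).root i)
      (dualElt h₀ hroots (ν - (s : ℂ) • (rootSystem h₀).root i))) =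
      (kap h₀ hroots i : ℂ) * ν (dualElt h₀ hroots ν) - 2 * s * x + 2 * s ^ 2 := by
    rw [map_sub, map_smul, h2]
    simp only [LinearMap.sub_apply, map_sub, map_smul, LinearMap.smul_apply, smul_eq_mul, hx, h4]
    rw [hx] at h3
    field_simp
    linear_combination (-(s : ℂ)) * h3
  have h6 := congrArg Complex.re h5
  have h7 : (2 * (s : ℂ) * x) = ((2 * s * x : ℝ) : ℂ) := by push_cast; ring
  have h8 : (2 * (s : ℂ) ^ 2) = ((2 * s ^ 2 : ℝ) : ℂ) := by push_cast; ring
  rw [h7, h8, Complex.add_re, Complex.sub_re, Complex.re_ofReal_mul, Complex.re_ofReal_mul,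
    Complex.ofReal_re, Complex.ofReal_re] at h6
  exact h6

/-- A Cauchy–Schwarz inequality. -/
theorem apply_re_le_normSq (hroots : weightsOnG h₀ ⊆ enlargedRoots h₀) {ρ : h₀}
    (hρ : IsRealElt ρ) : ∃ B : ℝ, ∀ ν : Dual ℂ h₀,
      (∀ i, ∃ z : ℤ, ν ((rootSystem h₀).coroot i) = z) → ∀ s : ℝ,
      2 * s * (ν ρ).re ≤ normSq hroots ν + s ^ 2 * B := by
  obtain ⟨B, -, hB⟩ := cartanForm_self_nonneg hroots hρ
  refine ⟨B, fun ν hν s => ?_⟩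
  -- This is `|ν♯ - s ρ|² ≥ 0`, with `ν♯` the dual element of `ν`; `s` stays free so that it can be
  -- fitted to the energy later.
  obtain ⟨r, hr, h⟩ := cartanForm_self_nonneg hroots ((isRealElt_dualElt hroots hν).sub_smul hρ s)
  simp only [map_sub, map_smul, LinearMap.sub_apply, LinearMap.smul_apply, smul_eq_mul,
    cartanForm_dualElt, hB, cartanForm_comm ρ (dualElt h₀ hroots ν)] at h
  have h1 := congrArg Complex.re h
  simp only [Complex.sub_re, Complex.mul_re, Complex.ofReal_re, Complex.ofReal_im, zero_mul,
    sub_zero, mul_zero] at h1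
  rw [normSq]
  nlinarith

/-- The height of an element of the root lattice is an integer. -/
theorem apply_heightElt_int {b : (rootSystem h₀).Base} {ρ : h₀}
    (hρ : ∀ i ∈ b.support, (rootSystem h₀).root i ρ = 1) {α : Dual ℂ h₀}
    (hα : α ∈ rootLattice h₀) : ∃ z : ℤ, α ρ = z := by
  have h3 : α ∈ Submodule.span ℤ ((rootSystem h₀).root '' b.support) := by
    rw [b.span_int_root_support, ← Submodule.mem_toAddSubgroup, Submodule.span_int_eq_addSubgroupClosure]
    exact hα
  induction h3 using Submodule.span_induction with
  | mem x hx => obtain ⟨j, hj, rfl⟩ := hx; exact ⟨1, by simpa using hρ j hj⟩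
  | zero => exact ⟨0, by simp⟩
  | add x y hx' hy' hx hy =>
    have hle : ∀ z ∈ Submodule.span ℤ ((rootSystem h₀).root '' b.support), z ∈ rootLattice h₀ :=
      fun z hz => by
        rwa [b.span_int_root_support, ← Submodule.mem_toAddSubgroup,
          Submodule.span_int_eq_addSubgroupClosure] at hz
    obtain ⟨p, hp⟩ := hx (hle _ hx')
    obtain ⟨q, hq⟩ := hy (hle _ hy')
    exact ⟨p + q, by simp [hp, hq]⟩
  | smul a x hx' hx =>
    obtain ⟨p, hp⟩ := hx (by
      rwa [b.span_int_root_support, ← Submodule.mem_toAddSubgroup,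
          Submodule.span_int_eq_addSubgroupClosure] at hx')
    exact ⟨a * p, by simp [hp]⟩

/-- The simple roots form a basis of the dual, so values can be prescribed on them and realised by
an element of `h(0)` through the double dual. -/
theorem exists_heightElt (b : (rootSystem h₀).Base) : ∃ ρ : h₀,
    IsRealElt ρ ∧ ∀ i ∈ b.support, (rootSystem h₀).root i ρ = 1 := by
  let f : Dual ℂ (Dual ℂ h₀) := b.toWeightBasis.constr ℂ fun _ => (1 : ℂ)
  let ρ := (Module.evalEquiv ℂ h₀).symm f
  have h0 : ∀ ν : Dual ℂ h₀, ν ρ = f ν := fun ν => by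
    have := LinearMap.congr_fun ((Module.evalEquiv ℂ h₀).apply_symm_apply f) ν
    exact this
  have h1 : ∀ i ∈ b.support, (rootSystem h₀).root i ρ = 1 := fun i hi => by
    have h2 := b.toWeightBasis.constr_basis ℂ (fun _ => (1 : ℂ)) ⟨i, hi⟩
    rw [RootPairing.Base.toWeightBasis_apply] at h2
    rw [h0]; exact h2
  refine ⟨ρ, fun i => ?_, h1⟩
  obtain ⟨z, hz⟩ := apply_heightElt_int h1 (root_mem_rootLattice i)
  exact ⟨z, by rw [hz]; simp⟩

/-- The grading components of `g` are spanned by weight vectors of `h(0)`. -/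
theorem grade_le_iSup_gradeRoot [LieAlgebra.IsSimple ℂ g]
    (hroots : weightsOnG h₀ ⊆ enlargedRoots h₀)
    {h : LieSubalgebra ℂ g} [h.IsCartanSubalgebra] (hh : h₀.map S.fixed.incl ≤ h) (k : Deg n) :
    S.grade k ≤ ⨆ α : enlargedRoots h₀, gradeRoot h₀ k α := by
  have hlie : ∀ (t : h₀) (x : g), x ∈ S.grade k → ⁅t, x⁆ ∈ S.grade k := fun t x hx => by
    have := lie_mem_grade (fixed_mem_grade (t : S.fixed).2) hx
    rwa [zero_add] at this
  let N : LieSubmodule ℂ h₀ g := { S.grade k with lie_mem := fun {t x} hx => hlie t x hx }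
  have htop := iSup_genWeightSpace_eq_top' ℂ h₀ N
  -- Here the inclusion of `h(0)` in a Cartan subalgebra of `g` enters: it makes the generalised
  -- weight spaces genuine ones.
  have hss : ∀ t : h₀, (LieAlgebra.ad ℂ g ((t : S.fixed) : g)).IsSemisimple := fun t =>
    isSemisimple_ad_of_mem_isCartanSubalgebra (H := h)
      (hh ((LieSubalgebra.mem_map _ _ _).2 ⟨(t : S.fixed), t.2, rfl⟩))
  intro x hx
  have hx' : (⟨x, hx⟩ : N) ∈ (⨆ χ : Weight ℂ h₀ N, genWeightSpace N χ : LieSubmodule ℂ h₀ N) := by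
    rw [htop]; trivial
  rw [← LieSubmodule.mem_toSubmodule, LieSubmodule.iSup_toSubmodule] at hx'
  have hle : (⨆ χ : Weight ℂ h₀ N, (genWeightSpace N χ).toSubmodule) ≤
      (⨆ α : enlargedRoots h₀, gradeRoot h₀ k α).comap (N : Submodule ℂ g).subtype := by
    refine iSup_le fun χ => ?_
    have hmem : ∀ y : N, y ∈ genWeightSpace N χ → (y : g) ∈ gradeRoot h₀ k χ.toLinear := by
      intro y hy
      refine ⟨y.2, fun t => ?_⟩
      rw [mem_genWeightSpace] at hy
      obtain ⟨j, hj⟩ := hy t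
      have h1 : (y : g) ∈ (LieAlgebra.ad ℂ g ((t : S.fixed) : g)).maxGenEigenspace (χ t) := by
        rw [Module.End.mem_maxGenEigenspace]
        refine ⟨j, ?_⟩
        have h2 : ∀ (j : ℕ) (y : N), ((((toEnd ℂ h₀ N t - χ t • 1) ^ j) y : N) : g) =
            ((LieAlgebra.ad ℂ g ((t : S.fixed) : g) - χ t • 1) ^ j) (y : g) := by
          intro j
          induction j with
          | zero => intro y; simp
          | succ j ih =>
            intro y
            rw [pow_succ, pow_succ, Module.End.mul_apply, Module.End.mul_apply, ih]
            rfl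
        rw [← h2, hj]; rfl
      rw [(hss t).isFinitelySemisimple.maxGenEigenspace_eq_eigenspace,
        Module.End.mem_eigenspace_iff] at h1
      exact h1
    have hχ : χ.toLinear ∈ enlargedRoots h₀ := by
      obtain ⟨m, hm, hm0⟩ := χ.exists_ne_zero
      exact hroots ⟨m, fun h => hm0 (Subtype.ext h), (hmem m hm).2⟩
    intro y hy
    exact Submodule.mem_iSup_of_mem (⟨_, hχ⟩ : enlargedRoots h₀) (hmem y hy)
  exact hle hx'

end FiniteTheory

/-! ### The functionals `∑ k_i δ_i` -/

section DegreeWeights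

variable {g : Type*} [LieRing g] [LieAlgebra ℂ g] {n : ℕ} {S : Datum g n}
  (h₀ : LieSubalgebra ℂ S.fixed)

/-- The functional `∑ k_i δ_i` on `H`. -/
def degWt (k : Deg n) : Dual ℂ (Cart h₀) := ∑ i, k i • delta h₀ i

@[simp] theorem degWt_apply (k : Deg n) (z : Cart h₀) : degWt h₀ k z = z.2.2 ⬝ᵥ k.toVec := by
  simp [degWt, delta, dotProduct, Deg.toVec, mul_comm]

@[simp] theorem extend_apply (α : Dual ℂ h₀) (z : Cart h₀) : extend h₀ α z = α z.1 := rfl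

theorem degWt_add (k l : Deg n) : degWt h₀ (k + l) = degWt h₀ k + degWt h₀ l := by
  ext z <;> simp [toVec_add]

theorem degWt_neg (k : Deg n) : degWt h₀ (-k) = -degWt h₀ k := by
  rw [eq_neg_iff_add_eq_zero, ← degWt_add, neg_add_cancel]
  ext z <;> simp [Deg.toVec, dotProduct]

theorem degWt_zero : degWt h₀ (0 : Deg n) = 0 := by
  ext z <;> simp [Deg.toVec, dotProduct]

theorem degWt_smul (a : ℤ) (k : Deg n) : degWt h₀ (a • k) = a • degWt h₀ k := by
  simp [degWt, Finset.smul_sum, mul_smul]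

theorem degWt_eq (k : Deg n) :
    degWt h₀ k = k 0 • delta h₀ 0 + deltaVec h₀ (fun i => k i.succ) := by
  rw [degWt, Fin.sum_univ_succ]; rfl

theorem extend_add (α β : Dual ℂ h₀) : extend h₀ (α + β) = extend h₀ α + extend h₀ β := rfl

theorem extend_neg (α : Dual ℂ h₀) : extend h₀ (-α) = -extend h₀ α := rfl

theorem extend_zero : extend h₀ (0 : Dual ℂ h₀) = 0 := rfl

end DegreeWeights

/-! ### Weights of the homogeneous elements of `τ` -/

section Monomials

variable {g : Type*} [LieRing g] [LieAlgebra ℂ g] {n : ℕ} {S : Datum g n}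
  {h₀ : LieSubalgebra ℂ S.fixed} {c : ℝ} {a₁ a₂ : ℂ}

/-- The element `t` of `τ` has weight `lam` for the adjoint action of `H`. -/
def HasWt (t : S.tau c a₁ a₂) (lam : Dual ℂ (Cart h₀)) : Prop :=
  ∀ z : Cart h₀, ⁅(cartIncl h₀ z : S.tau c a₁ a₂), t⁆ = lam z • t

theorem toVec_zero : (0 : Deg n).toVec = 0 := by ext; simp [Deg.toVec]

theorem hasWt_tauX {k : Deg n} {α : Dual ℂ h₀} {x : g} (hx : x ∈ gradeRoot h₀ k α) :
    HasWt (S.tauX k x hx.1 : S.tau c a₁ a₂) (extend h₀ α + degWt h₀ k) := fun z => by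
  refine Subtype.ext ?_
  change ⁅(X 0 ((z.1 : S.fixed) : g) + K 0 z.2.1 + D 0 z.2.2 : Full g n c a₁ a₂), X k x⁆ =
    (extend h₀ α z + degWt h₀ k z) • X k x
  rw [add_br, add_br, br_X_X, br_K_X, br_D_X, toVec_zero, smul_zero, map_zero, hx.2,
    extend_apply, degWt_apply, zero_add, map_smul, map_smul]
  module

theorem hasWt_tauK {r : Deg n} (w : Vec n) (hr : r ∈ S.lattice) :
    HasWt (S.tauK r w hr : S.tau c a₁ a₂) (degWt h₀ r) := fun z => by
  refine Subtype.ext ?_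
  change ⁅(X 0 ((z.1 : S.fixed) : g) + K 0 z.2.1 + D 0 z.2.2 : Full g n c a₁ a₂), K r w⁆ =
    degWt h₀ r z • K r w
  rw [add_br, add_br, br_X_K, br_K_K, br_D_K, toVec_zero, smul_zero, degWt_apply]
  simp only [zero_add, add_zero, map_smul]

theorem hasWt_tauD {r : Deg n} (u : Vec n) (hr : r ∈ S.lattice) :
    HasWt (S.tauD r u hr : S.tau c a₁ a₂) (degWt h₀ r) := fun z => by
  refine Subtype.ext ?_
  change ⁅(X 0 ((z.1 : S.fixed) : g) + K 0 z.2.1 + D 0 z.2.2 : Full g n c a₁ a₂), D r u⁆ =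
    degWt h₀ r z • D r u
  rw [add_br, add_br, br_X_D, br_K_D, br_D_D, toVec_zero, dotProduct_zero, dotProduct_zero]
  simp only [smul_zero, zero_smul, map_zero, neg_zero, zero_add, degWt_apply, add_zero, mul_zero,
    map_smul, K_toVec, sub_zero]

/-- Homogeneous elements span `τ`. -/
theorem tau_eq_top_of_monomials {R : Set (Dual ℂ h₀)}
    (hg : ∀ k, S.grade k ≤ ⨆ α : R, gradeRoot h₀ k α) (N : Submodule ℂ (S.tau c a₁ a₂))
    (hX : ∀ k, ∀ α ∈ R, ∀ x (hx : x ∈ gradeRoot h₀ k α), S.tauX k x hx.1 ∈ N)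
    (hK : ∀ r w (hr : r ∈ S.lattice), S.tauK r w hr ∈ N)
    (hD : ∀ r u (hr : r ∈ S.lattice), S.tauD r u hr ∈ N) : N = ⊤ := by
  have hX' : ∀ k x (hx : x ∈ S.grade k), S.tauX k x hx ∈ N := by
    intro k x hx
    have key : (⨆ α : R, gradeRoot h₀ k α) ≤
        (N.map (S.tau c a₁ a₂).subtype).comap (X k) := by
      refine iSup_le fun α y hy => ?_
      exact ⟨_, hX k α α.2 y hy, rfl⟩
    obtain ⟨t, ht, h⟩ := key (hg k hx)
    have : t = S.tauX k x hx := Subtype.ext h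
    rwa [← this]
  rw [eq_top_iff]
  rintro ⟨p, hp⟩ -
  have key : (S.tau c a₁ a₂).toSubmodule ≤ N.map (S.tau c a₁ a₂).subtype := by
    refine Submodule.span_le.2 ?_
    rintro p (⟨k, x, hx⟩ | ⟨r, w, hr⟩ | ⟨r, u, hr⟩)
    · exact ⟨_, hX' k x hx, rfl⟩
    · exact ⟨_, hK r w hr, rfl⟩
    · exact ⟨_, hD r u hr, rfl⟩
  obtain ⟨t, ht, h⟩ := key hp
  have : t = ⟨p, hp⟩ := Subtype.ext h
  rwa [← this]

variable {V : Type*} [AddCommGroup V] [Module ℂ V] [LieRingModule (S.tau c a₁ a₂) V]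
  [LieModule ℂ (S.tau c a₁ a₂) V]

theorem HasWt.lie_mem {t : S.tau c a₁ a₂} {lam : Dual ℂ (Cart h₀)} (ht : HasWt t lam)
    {μ : Dual ℂ (Cart h₀)} {v : V} (hv : v ∈ weightSpace c a₁ a₂ h₀ V μ) :
    ⁅t, v⁆ ∈ weightSpace c a₁ a₂ h₀ V (μ + lam) := fun z => by
  rw [leibniz_lie, ht z, hv z, smul_lie, lie_smul, LinearMap.add_apply]
  module

theorem HasWt.pow_lie_mem {t : S.tau c a₁ a₂} {lam : Dual ℂ (Cart h₀)} (ht : HasWt t lam)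
    {μ : Dual ℂ (Cart h₀)} {v : V} (hv : v ∈ weightSpace c a₁ a₂ h₀ V μ) (j : ℕ) :
    (toEnd ℂ (S.tau c a₁ a₂) V t ^ j) v ∈ weightSpace c a₁ a₂ h₀ V (μ + j • lam) := by
  induction j with
  | zero => simpa using hv
  | succ j ih =>
    rw [pow_succ', Module.End.mul_apply, succ_nsmul, ← add_assoc]
    exact ht.lie_mem ih

theorem mem_weights_of_ne_zero {μ : Dual ℂ (Cart h₀)} {v : V}
    (hv : v ∈ weightSpace c a₁ a₂ h₀ V μ) (h0 : v ≠ 0) : μ ∈ weights c a₁ a₂ h₀ V :=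
  (Submodule.ne_bot_iff _).2 ⟨v, hv, h0⟩

theorem exists_of_mem_weights {μ : Dual ℂ (Cart h₀)} (h : μ ∈ weights c a₁ a₂ h₀ V) :
    ∃ v ∈ weightSpace c a₁ a₂ h₀ V μ, v ≠ 0 :=
  (Submodule.ne_bot_iff _).1 h

variable (c a₁ a₂ h₀ V) in
-- The operators from `H` commute, because they do so on weight vectors and these span V. The weight
-- spaces lie in the joint generalised eigenspaces of a commuting family, which are independent.
theorem iSupIndep_weightSpace (htop : ⨆ μ, weightSpace c a₁ a₂ h₀ V μ = ⊤) :
    iSupIndep (weightSpace c a₁ a₂ h₀ V) := by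
  let f : Cart h₀ → End ℂ V := fun z => toEnd ℂ (S.tau c a₁ a₂) V (cartIncl h₀ z)
  have hcomm : ∀ z z', Commute (f z) (f z') := fun z z' => by
    refine LinearMap.ext fun v => ?_
    have hv : v ∈ ⨆ μ, weightSpace c a₁ a₂ h₀ V μ := by rw [htop]; trivial
    induction hv using Submodule.iSup_induction' with
    | mem μ v hv =>
      have h1 : ∀ z, f z v = μ z • v := hv
      simp only [Module.End.mul_apply, h1, map_smul]
      rw [smul_comm]
    | zero => simp
    | add x y _ _ hx hy => rw [map_add, map_add, hx, hy]
  have h1 := Module.End.independent_iInf_maxGenEigenspace_of_forall_mapsTo f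
    fun i j φ => Module.End.mapsTo_maxGenEigenspace_of_comm (hcomm j i) φ
  have h2 : iSupIndep fun μ : Dual ℂ (Cart h₀) => ⨅ i, (f i).maxGenEigenspace (μ i) :=
    h1.comp (f := fun μ : Dual ℂ (Cart h₀) => (μ : Cart h₀ → ℂ)) DFunLike.coe_injective
  refine h2.mono fun μ v hv => (Submodule.mem_iInf _).2 fun z => ?_
  rw [Module.End.mem_maxGenEigenspace]
  refine ⟨1, ?_⟩
  have := hv z
  rw [pow_one, LinearMap.sub_apply, sub_eq_zero]
  exact this

end Monomials

/-! ### Congruence of weights, real root triples, and the action of the centre -/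

section IntegrableModules

variable {g : Type*} [LieRing g] [LieAlgebra ℂ g] [FiniteDimensional ℂ g]
  {n : ℕ} {S : Datum g n} [LieAlgebra.IsSimple ℂ S.fixed] {h₀ : LieSubalgebra ℂ S.fixed}
  [h₀.IsCartanSubalgebra] {c : ℝ} {a₁ a₂ : ℂ}
  {V : Type*} [AddCommGroup V] [Module ℂ V] [LieRingModule (S.tau c a₁ a₂) V]
  [LieModule ℂ (S.tau c a₁ a₂) V]

variable (h₀) in
/-- The coset of a functional modulo the root lattice. -/
def weightCoset (μ₀ : Dual ℂ (Cart h₀)) : Set (Dual ℂ (Cart h₀)) :=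
  {μ | ∃ α ∈ rootLattice h₀, ∃ k : Deg n, μ = μ₀ + extend h₀ α + degWt h₀ k}

/-- Each homogeneous generator of `τ` shifts weights by a root lattice element plus some `∑ k_i
δ_i`, hence stays within the coset. -/
theorem lie_mem_iSup_weightCoset
    (hg : ∀ k, S.grade k ≤ ⨆ α : enlargedRoots h₀, gradeRoot h₀ k α) (μ₀ : Dual ℂ (Cart h₀))
    (t : S.tau c a₁ a₂) (v : V) (hv : v ∈ ⨆ μ ∈ weightCoset h₀ μ₀, weightSpace c a₁ a₂ h₀ V μ) :
    ⁅t, v⁆ ∈ ⨆ μ ∈ weightCoset h₀ μ₀, weightSpace c a₁ a₂ h₀ V μ := by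
  set N₀ : Submodule ℂ V := ⨆ μ ∈ weightCoset h₀ μ₀, weightSpace c a₁ a₂ h₀ V μ with hN₀
  have hstep : ∀ (t : S.tau c a₁ a₂) (α : Dual ℂ h₀) (k : Deg n), α ∈ rootLattice h₀ →
      HasWt t (extend h₀ α + degWt h₀ k) → ∀ v ∈ N₀, ⁅t, v⁆ ∈ N₀ := by
    intro t α k hα ht v hv
    have hle : N₀ ≤ N₀.comap (toEnd ℂ (S.tau c a₁ a₂) V t) := by
      refine iSup₂_le fun μ hμ v hv => ?_
      refine (le_iSup₂_of_le (μ + (extend h₀ α + degWt h₀ k)) ?_ le_rfl :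
        weightSpace c a₁ a₂ h₀ V (μ + (extend h₀ α + degWt h₀ k)) ≤ N₀) (ht.lie_mem hv)
      obtain ⟨β, hβ, l, rfl⟩ := hμ
      exact ⟨β + α, add_mem hβ hα, l + k, by rw [extend_add, degWt_add]; abel⟩
    exact hle hv
  let N₁ : Submodule ℂ (S.tau c a₁ a₂) :=
    { carrier := {t | ∀ v ∈ N₀, ⁅t, v⁆ ∈ N₀}
      add_mem' := fun {s t} hs ht v hv => by rw [add_lie]; exact add_mem (hs v hv) (ht v hv)
      zero_mem' := fun v _ => by rw [zero_lie]; exact zero_mem _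
      smul_mem' := fun a t ht v hv => by
        rw [smul_lie]; exact Submodule.smul_mem _ _ (ht v hv) }
  have : N₁ = ⊤ := by
    refine tau_eq_top_of_monomials hg N₁ ?_ ?_ ?_
    · intro k α hα x hx
      exact hstep _ α k (enlargedRoots_subset_rootLattice hα) (hasWt_tauX hx)
    · intro r w hr
      exact hstep _ 0 r (zero_mem _) (by rw [extend_zero, zero_add]; exact hasWt_tauK w hr)
    · intro r w hr
      exact hstep _ 0 r (zero_mem _) (by rw [extend_zero, zero_add]; exact hasWt_tauD w hr)
  have ht : t ∈ N₁ := by rw [this]; trivial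
  exact ht v hv

/-- All weights of an irreducible module are congruent modulo the root lattice. -/
theorem mem_weightCoset_of_mem_weights [LieModule.IsIrreducible ℂ (S.tau c a₁ a₂) V]
    (hg : ∀ k, S.grade k ≤ ⨆ α : enlargedRoots h₀, gradeRoot h₀ k α)
    (hV : IsIntegrable c a₁ a₂ h₀ V) {μ₀ μ : Dual ℂ (Cart h₀)}
    (hμ₀ : μ₀ ∈ weights c a₁ a₂ h₀ V) (hμ : μ ∈ weights c a₁ a₂ h₀ V) :
    μ ∈ weightCoset h₀ μ₀ := by
  by_contra hcon
  let N : LieSubmodule ℂ (S.tau c a₁ a₂) V :=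
    { (⨆ μ ∈ weightCoset h₀ μ₀, weightSpace c a₁ a₂ h₀ V μ : Submodule ℂ V) with
      lie_mem := fun {t v} hv => lie_mem_iSup_weightCoset hg μ₀ t v hv }
  have hle : weightSpace c a₁ a₂ h₀ V μ₀ ≤ N.toSubmodule :=
    le_iSup₂_of_le (f := fun μ (_ : μ ∈ weightCoset h₀ μ₀) => weightSpace c a₁ a₂ h₀ V μ) μ₀
      ⟨0, zero_mem _, 0, by rw [extend_zero, degWt_zero]; simp⟩ le_rfl
  have hN : N = ⊤ := by
    refine (eq_bot_or_eq_top N).resolve_left fun h => ?_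
    obtain ⟨v, hv, hv0⟩ := exists_of_mem_weights hμ₀
    have : v ∈ N := hle hv
    rw [h] at this
    exact hv0 this
  have hN' : (⨆ μ ∈ weightCoset h₀ μ₀, weightSpace c a₁ a₂ h₀ V μ : Submodule ℂ V) = ⊤ :=
    congrArg LieSubmodule.toSubmodule hN
  -- The sum over the coset is already all of V, so a weight space outside the coset is disjoint
  -- from V and vanishes.
  have hdisj := (iSupIndep_weightSpace h₀ c a₁ a₂ V hV.iSup_weightSpace).disjoint_biSup
    (x := μ) (y := weightCoset h₀ μ₀) hcon
  rw [hN', disjoint_top] at hdisj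
  exact hμ hdisj

/-- For `k` in the lattice every `ξ_i ^ k_i` is 1, so a fixed vector is homogeneous of each such
degree. This provides the real root vectors and the Heisenberg elements. -/
theorem gradeRoot_of_fixed {α : Dual ℂ h₀} {x : S.fixed}
    (hx : ∀ h : h₀, ⁅(h : S.fixed), x⁆ = α h • x) {k : Deg n} (hk : k ∈ S.lattice) :
    (x : g) ∈ gradeRoot h₀ k α := by
  refine ⟨?_, fun h => congrArg (Subtype.val (p := fun z => z ∈ S.fixed)) (hx h)⟩
  have := grade_add_lattice hk (fixed_mem_grade x.2)
  rwa [add_zero] at this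

variable (h₀ c) in
/-- The coroot of the real root `α + ∑ k_i δ_i`. -/
def affCoroot (hroots : weightsOnG h₀ ⊆ enlargedRoots h₀) (i : h₀.root) (k : Deg n) : Cart h₀ :=
  ((rootSystem h₀).coroot i, ((c : ℂ) * kap h₀ hroots i) • k.toVec, 0)

/-- The `sl₂`-triples attached to the real roots `α + ∑ k_i δ_i`, where `k` is in the lattice. -/
theorem exists_affine_sl2Triple (hroots : weightsOnG h₀ ⊆ enlargedRoots h₀)
    (hV : IsIntegrable c a₁ a₂ h₀ V) (i : h₀.root) {k : Deg n} (hk : k ∈ S.lattice) :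
    ∃ e f : S.tau c a₁ a₂, IsSl2Triple (cartIncl h₀ (affCoroot h₀ c hroots i k)) e f ∧
      HasWt e (extend h₀ ((rootSystem h₀).root i) + degWt h₀ k) ∧
      HasWt f (-(extend h₀ ((rootSystem h₀).root i) + degWt h₀ k)) ∧
      (∀ v : V, ∃ N : ℕ, (toEnd ℂ (S.tau c a₁ a₂) V e ^ N) v = 0) ∧
      (∀ v : V, ∃ N : ℕ, (toEnd ℂ (S.tau c a₁ a₂) V f ^ N) v = 0) := by
  obtain ⟨x, y, ht, hx, hy⟩ := exists_rootVectors i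
  have hroot : (rootSystem h₀).root i ≠ 0 := (rootSystem h₀).ne_zero i
  have hx' := gradeRoot_of_fixed hx hk
  have hy' := gradeRoot_of_fixed hy (neg_mem hk)
  have hwe := hasWt_tauX (c := c) (a₁ := a₁) (a₂ := a₂) hx'
  have hwf := hasWt_tauX (c := c) (a₁ := a₁) (a₂ := a₂) hy'
  rw [extend_neg, degWt_neg, ← neg_add] at hwf
  have hval : ((extend h₀ ((rootSystem h₀).root i) + degWt h₀ k)
      (affCoroot h₀ c hroots i k)) = 2 := by
    have : (rootSystem h₀).root i ((rootSystem h₀).coroot i) = 2 :=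
      (rootSystem h₀).root_coroot_two i
    rw [LinearMap.add_apply, extend_apply, degWt_apply, affCoroot, zero_dotProduct, add_zero, this]
  -- With `e = x ⊗ t^k` and `f = y ⊗ t^(-k)`, the cocycle adds `c (x, y)_Killing ∑ k_i K_i` to the
  -- coroot. The four goals of the triple start with non-vanishing of `h`, which is read off the
  -- loop component.
  refine ⟨S.tauX k x hx'.1, S.tauX (-k) y hy'.1, ⟨?_, ?_, ?_, ?_⟩, hwe, hwf, ?_, ?_⟩
  · intro h0
    have h1 := congrArg (fun t : S.tau c a₁ a₂ => prX g n c a₁ a₂ (t : Full g n c a₁ a₂)) h0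
    have h2 : Finsupp.single (0 : Deg n) ((((rootSystem h₀).coroot i : h₀) : S.fixed) : g) = 0 := by
      have h3 : prX g n c a₁ a₂ (X 0 ((((rootSystem h₀).coroot i : h₀) : S.fixed) : g) +
        K 0 (affCoroot h₀ c hroots i k).2.1 + D 0 (affCoroot h₀ c hroots i k).2.2) = 0 := h1
      rwa [map_add, map_add, prX_X, prX_K, prX_D, add_zero, add_zero] at h3
    rw [Finsupp.single_eq_zero] at h2
    exact ht.h_ne_zero (Subtype.ext h2)
  · refine Subtype.ext ?_
    change ⁅(X k (x : g) : Full g n c a₁ a₂), X (-k) (y : g)⁆ =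
      X 0 ((((rootSystem h₀).coroot i : h₀) : S.fixed) : g) +
        K 0 (affCoroot h₀ c hroots i k).2.1 + D 0 (affCoroot h₀ c hroots i k).2.2
    have h3 : ⁅(x : g), (y : g)⁆ = ((((rootSystem h₀).coroot i : h₀) : S.fixed) : g) :=
      congrArg Subtype.val ht.lie_e_f
    rw [br_X_X, add_neg_cancel, h3, killingForm_rootVectors hroots i ht hy, affCoroot, map_zero,
      add_zero]
  · rw [hwe, hval]; simp [two_smul]
  · rw [hwf, LinearMap.neg_apply, hval]; simp [two_smul]
  · intro v
    exact hV.locally_nilpotent k _ hroot x hx' v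
  · intro v
    exact hV.locally_nilpotent (-k) _ (neg_ne_zero.2 hroot) y hy' v

/-- The action of the centre, when `K_0` acts as `C₀` and the other `K_i` as zero. -/
theorem apply_central {C₀ : ℝ}
    (hK₀ : ∀ v : V, ⁅(S.central 0 : S.tau c a₁ a₂), v⁆ = (C₀ : ℂ) • v)
    (hK : ∀ i : Fin (n + 1), i ≠ 0 → ∀ v : V, ⁅(S.central i : S.tau c a₁ a₂), v⁆ = 0)
    (w : Vec n) (v : V) : ⁅(S.tauK 0 w (zero_mem _) : S.tau c a₁ a₂), v⁆ = (w 0 * C₀) • v := by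
  have h1 : (S.tauK 0 w (zero_mem _) : S.tau c a₁ a₂) = ∑ i, w i • S.central i := by
    refine Subtype.ext ?_
    rw [AddSubmonoidClass.coe_finsetSum]
    change (K 0 w : Full g n c a₁ a₂) = ∑ i, w i • K 0 (Pi.single i 1)
    simp_rw [← map_smul, ← map_sum]
    congr 1
    ext j
    simp [Finset.sum_apply, Pi.single_apply]
  rw [h1, sum_lie, Fin.sum_univ_succ, smul_lie, hK₀, smul_smul]
  simp [smul_lie, hK _ (Fin.succ_ne_zero _)]

end IntegrableModules

/-! ### Reflections, multiplicities and rays at positive level -/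

section Level

variable {g : Type*} [LieRing g] [LieAlgebra ℂ g] [FiniteDimensional ℂ g]
  {n : ℕ} {S : Datum g n} [LieAlgebra.IsSimple ℂ S.fixed] (h₀ : LieSubalgebra ℂ S.fixed)
  [h₀.IsCartanSubalgebra] (c : ℝ) (a₁ a₂ : ℂ)
  (V : Type*) [AddCommGroup V] [Module ℂ V] [LieRingModule (S.tau c a₁ a₂) V]
  [LieModule ℂ (S.tau c a₁ a₂) V] (C₀ : ℝ)

/-- Integrable modules of level `(C₀, 0, …, 0)` with `C₀ > 0`. -/
structure IsPositiveLevel : Prop where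
  roots : weightsOnG h₀ ⊆ enlargedRoots h₀
  grade_le : ∀ k, S.grade k ≤ ⨆ α : enlargedRoots h₀, gradeRoot h₀ k α
  integrable : IsIntegrable c a₁ a₂ h₀ V
  c_pos : 0 < c
  level_pos : 0 < C₀
  central_zero : ∀ v : V, ⁅(S.central 0 : S.tau c a₁ a₂), v⁆ = (C₀ : ℂ) • v
  central_ne_zero : ∀ i : Fin (n + 1), i ≠ 0 → ∀ v : V, ⁅(S.central i : S.tau c a₁ a₂), v⁆ = 0

variable {h₀ c a₁ a₂ V C₀}

/-- The restriction of a functional to `h(0)`. -/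
def res (μ : Dual ℂ (Cart h₀)) : Dual ℂ h₀ := μ.comp (LinearMap.inl ℂ _ _)

theorem res_apply (μ : Dual ℂ (Cart h₀)) (t : h₀) : res μ t = μ (t, 0, 0) := rfl

theorem res_add (μ ν : Dual ℂ (Cart h₀)) : res (μ + ν) = res μ + res ν := rfl

theorem res_sub (μ ν : Dual ℂ (Cart h₀)) : res (μ - ν) = res μ - res ν := rfl

theorem res_zsmul (a : ℤ) (μ : Dual ℂ (Cart h₀)) : res (a • μ) = a • res μ := rfl

theorem res_extend (α : Dual ℂ h₀) : res (extend h₀ α) = α := by ext; rfl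

theorem res_degWt (k : Deg n) : res (degWt h₀ k) = 0 := by
  ext t; rw [res_apply, degWt_apply]; simp

variable (n) in
/-- The coefficient vector of `d_0`. -/
def e0 : Vec n := Pi.single 0 1

variable (h₀) in
/-- The element `d_0` of `H`. -/
def dElt : Cart h₀ := (0, 0, e0 n)

theorem degWt_dElt (k : Deg n) : degWt h₀ k (dElt h₀) = k 0 := by
  rw [degWt_apply, dElt]
  simp [e0, Deg.toVec]

theorem extend_dElt (α : Dual ℂ h₀) : extend h₀ α (dElt h₀) = 0 := by
  rw [extend_apply, dElt, map_zero]

variable (S) in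
/-- The generator of `Γ_0`. -/
def gen0 : Deg n := Pi.single 0 (S.m 0 : ℤ)

theorem gen0_mem : gen0 S ∈ S.lattice := fun i => by
  rcases eq_or_ne i 0 with rfl | h
  · simp [gen0]
  · simp [gen0, h]

theorem gen0_zero : gen0 S 0 = S.m 0 := by simp [gen0]

namespace IsPositiveLevel

variable (H : IsPositiveLevel h₀ c a₁ a₂ V C₀)

/-- The value of the central part of the coroot of `α + δ_0`. -/
def lev (H : IsPositiveLevel h₀ c a₁ a₂ V C₀) (i : h₀.root) : ℝ := c * kap h₀ H.roots i * C₀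

theorem lev_pos (H : IsPositiveLevel h₀ c a₁ a₂ V C₀) (i : h₀.root) : 0 < H.lev i :=
  mul_pos (mul_pos H.c_pos (kap_pos H.roots i)) H.level_pos

theorem apply_K (H : IsPositiveLevel h₀ c a₁ a₂ V C₀) {μ : Dual ℂ (Cart h₀)}
    (hμ : μ ∈ weights c a₁ a₂ h₀ V) (w : Vec n) : μ (0, w, 0) = w 0 * C₀ := by
  obtain ⟨v, hv, hv0⟩ := exists_of_mem_weights hμ
  have h1 := hv (0, w, 0)
  have h2 : (cartIncl h₀ (0, w, 0) : S.tau c a₁ a₂) = S.tauK 0 w (zero_mem _) := by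
    refine Subtype.ext ?_
    change (X 0 (0 : g) + K 0 w + D 0 0 : Full g n c a₁ a₂) = K 0 w
    rw [map_zero, map_zero, zero_add, add_zero]
  rw [h2, apply_central H.central_zero H.central_ne_zero] at h1
  exact (smul_left_injective ℂ hv0 h1).symm

/-- Since `K_1, …, K_n` act as zero, the coroot value depends on `k` only through `k_0`. The
periodicity of P(V) rests on this. -/
theorem apply_affCoroot (H : IsPositiveLevel h₀ c a₁ a₂ V C₀) {μ : Dual ℂ (Cart h₀)}
    (hμ : μ ∈ weights c a₁ a₂ h₀ V) (i : h₀.root) (k : Deg n) :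
    μ (affCoroot h₀ c H.roots i k) =
      res μ ((rootSystem h₀).coroot i) + (H.lev i : ℂ) * k 0 := by
  have h1 : affCoroot h₀ c H.roots i k = ((rootSystem h₀).coroot i, 0, 0) +
      (0, ((c : ℂ) * kap h₀ H.roots i) • k.toVec, 0) := by
    simp [affCoroot]
  rw [h1, map_add, H.apply_K hμ, res_apply, lev]
  simp only [Pi.smul_apply, Deg.toVec, smul_eq_mul]
  push_cast
  ring

theorem exists_int (H : IsPositiveLevel h₀ c a₁ a₂ V C₀) {μ : Dual ℂ (Cart h₀)}
    (hμ : μ ∈ weights c a₁ a₂ h₀ V) (i : h₀.root) {k : Deg n} (hk : k ∈ S.lattice) :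
    ∃ z : ℤ, res μ ((rootSystem h₀).coroot i) + (H.lev i : ℂ) * k 0 = z := by
  obtain ⟨v, hv, hv0⟩ := exists_of_mem_weights hμ
  obtain ⟨e, f, ht, -, -, he, hf⟩ := exists_affine_sl2Triple H.roots H.integrable i hk
  rw [← H.apply_affCoroot hμ]
  exact ht.exists_int he hf hv0 (hv _)

theorem exists_int_res (H : IsPositiveLevel h₀ c a₁ a₂ V C₀) {μ : Dual ℂ (Cart h₀)}
    (hμ : μ ∈ weights c a₁ a₂ h₀ V) (i : h₀.root) :
    ∃ z : ℤ, res μ ((rootSystem h₀).coroot i) = z := by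
  obtain ⟨z, hz⟩ := H.exists_int hμ i (zero_mem S.lattice)
  exact ⟨z, by simpa using hz⟩

/-- `P(V)` is stable under the reflections in the real roots. -/
theorem reflect_mem (H : IsPositiveLevel h₀ c a₁ a₂ V C₀) {μ : Dual ℂ (Cart h₀)}
    (hμ : μ ∈ weights c a₁ a₂ h₀ V) (i : h₀.root) {k : Deg n} (hk : k ∈ S.lattice) {z : ℤ}
    (hz : res μ ((rootSystem h₀).coroot i) + (H.lev i : ℂ) * k 0 = z) :
    μ - z • (extend h₀ ((rootSystem h₀).root i) + degWt h₀ k) ∈ weights c a₁ a₂ h₀ V := by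
  obtain ⟨v, hv, hv0⟩ := exists_of_mem_weights hμ
  obtain ⟨e, f, ht, hwe, hwf, he, hf⟩ := exists_affine_sl2Triple H.roots H.integrable i hk
  have h1 := hv (affCoroot h₀ c H.roots i k)
  rw [H.apply_affCoroot hμ, hz] at h1
  -- For `z ≤ 0` the opposite triple is used, as the reflection of a vector is available for natural
  -- weights only.
  rcases le_total 0 z with h0 | h0
  · obtain ⟨m, rfl⟩ := Int.eq_ofNat_of_zero_le h0
    obtain ⟨j, hj⟩ := ht.exists_pow_f_pow_e_ne_zero (n := m) he hf hv0 (by simpa using h1)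
    have h2 := hwf.pow_lie_mem (hwe.pow_lie_mem hv j) (m + j)
    have h3 := mem_weights_of_ne_zero h2 hj
    convert h3 using 1
    rw [natCast_zsmul, add_smul]
    module
  · obtain ⟨m, hm⟩ := Int.eq_ofNat_of_zero_le (neg_nonneg.2 h0)
    obtain rfl : z = -m := by omega
    obtain ⟨j, hj⟩ := ht.symm.exists_pow_f_pow_e_ne_zero (n := m) hf he hv0 (by
      rw [neg_lie, h1]; simp)
    have h2 := hwe.pow_lie_mem (hwf.pow_lie_mem hv j) (m + j)
    have h3 := mem_weights_of_ne_zero h2 hj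
    convert h3 using 1
    rw [neg_smul, natCast_zsmul, add_smul]
    module

theorem finrank_le_of_injective_lie {t : S.tau c a₁ a₂} {lam μ : Dual ℂ (Cart h₀)}
    (hV : IsIntegrable c a₁ a₂ h₀ V) (ht : HasWt t lam)
    (hinj : ∀ v ∈ weightSpace c a₁ a₂ h₀ V μ, ⁅t, v⁆ = 0 → v = 0) :
    finrank ℂ (weightSpace c a₁ a₂ h₀ V μ) ≤ finrank ℂ (weightSpace c a₁ a₂ h₀ V (μ + lam)) := by
  have := hV.finite_weightSpace (μ + lam)
  let T : weightSpace c a₁ a₂ h₀ V μ →ₗ[ℂ] weightSpace c a₁ a₂ h₀ V (μ + lam) :=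
    (toEnd ℂ (S.tau c a₁ a₂) V t).restrict fun v hv => ht.lie_mem hv
  refine LinearMap.finrank_le_finrank_of_injective (f := T) ?_
  refine (injective_iff_map_eq_zero T).2 fun v hv => Subtype.ext (hinj v v.2 ?_)
  exact congrArg Subtype.val hv

/-- The lowering operator of the real root is injective where the coroot value is positive.
`finrank_le_add` is the mirror image with the raising operator. -/
theorem finrank_le_sub (H : IsPositiveLevel h₀ c a₁ a₂ V C₀) {μ : Dual ℂ (Cart h₀)}
    (i : h₀.root) {k : Deg n} (hk : k ∈ S.lattice) {z : ℤ}
    (hz : res μ ((rootSystem h₀).coroot i) + (H.lev i : ℂ) * k 0 = z) (h0 : 0 < z) :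
    finrank ℂ (weightSpace c a₁ a₂ h₀ V μ) ≤ finrank ℂ (weightSpace c a₁ a₂ h₀ V
      (μ - (extend h₀ ((rootSystem h₀).root i) + degWt h₀ k))) := by
  obtain ⟨e, f, ht, hwe, hwf, he, hf⟩ := exists_affine_sl2Triple H.roots H.integrable i hk
  rw [sub_eq_add_neg]
  refine finrank_le_of_injective_lie H.integrable hwf fun v hv h1 => ?_
  by_contra hv0
  have h2 := hv (affCoroot h₀ c H.roots i k)
  rw [H.apply_affCoroot (mem_weights_of_ne_zero hv hv0), hz] at h2
  exact hv0 (ht.eq_zero_of_lie_f he h0 h2 h1)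

theorem finrank_le_add (H : IsPositiveLevel h₀ c a₁ a₂ V C₀) {μ : Dual ℂ (Cart h₀)}
    (i : h₀.root) {k : Deg n} (hk : k ∈ S.lattice) {z : ℤ}
    (hz : res μ ((rootSystem h₀).coroot i) + (H.lev i : ℂ) * k 0 = z) (h0 : z < 0) :
    finrank ℂ (weightSpace c a₁ a₂ h₀ V μ) ≤ finrank ℂ (weightSpace c a₁ a₂ h₀ V
      (μ + (extend h₀ ((rootSystem h₀).root i) + degWt h₀ k))) := by
  obtain ⟨e, f, ht, hwe, hwf, he, hf⟩ := exists_affine_sl2Triple H.roots H.integrable i hk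
  refine finrank_le_of_injective_lie H.integrable hwe fun v hv h1 => ?_
  by_contra hv0
  have h2 := hv (affCoroot h₀ c H.roots i k)
  rw [H.apply_affCoroot (mem_weights_of_ne_zero hv hv0), hz] at h2
  exact hv0 (ht.symm.eq_zero_of_lie_f hf (neg_pos.2 h0) (by rw [neg_lie, h2]; simp) h1)

/-- `m_0 · lev` is a positive integer as soon as `P(V)` is not empty. -/
theorem exists_int_lev (H : IsPositiveLevel h₀ c a₁ a₂ V C₀) {μ : Dual ℂ (Cart h₀)}
    (hμ : μ ∈ weights c a₁ a₂ h₀ V) (i : h₀.root) :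
    ∃ l : ℤ, 0 < l ∧ H.lev i * (S.m 0 : ℝ) = l := by
  -- A weight is integral on the coroots of both `α` and `α + m_0 δ_0`; `m_0` times `lev` is the
  -- difference of the two values.
  obtain ⟨x, hx⟩ := H.exists_int_res hμ i
  obtain ⟨z, hz⟩ := H.exists_int hμ i (gen0_mem (S := S))
  rw [hx, gen0_zero] at hz
  have h1 : H.lev i * (S.m 0 : ℝ) = ((z - x : ℤ) : ℝ) := by
    have : ((H.lev i * (S.m 0 : ℝ) : ℝ) : ℂ) = (((z - x : ℤ) : ℝ) : ℂ) := by
      push_cast at hz ⊢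
      linear_combination hz
    exact_mod_cast this
  refine ⟨z - x, ?_, h1⟩
  have h2 : 0 < H.lev i * (S.m 0 : ℝ) := mul_pos (H.lev_pos i) (Nat.cast_pos.2 (S.m_pos 0))
  rw [h1] at h2
  exact_mod_cast h2

/-- The multiplicities along a half-line in the direction of `δ_0` are bounded. -/
theorem exists_finrank_le (H : IsPositiveLevel h₀ c a₁ a₂ V C₀) (i : h₀.root)
    (μ : Dual ℂ (Cart h₀)) : ∃ d : ℕ, ∀ r : ℤ, 0 ≤ r →
      finrank ℂ (weightSpace c a₁ a₂ h₀ V (μ + degWt h₀ (r • gen0 S))) ≤ d := by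
  by_cases hemp : ∀ r : ℤ, weightSpace c a₁ a₂ h₀ V (μ + degWt h₀ (r • gen0 S)) = ⊥
  · exact ⟨0, fun r _ => by rw [hemp]; simp⟩
  push Not at hemp
  obtain ⟨r₀, hr₀⟩ := hemp
  have hr₀' : μ + degWt h₀ (r₀ • gen0 S) ∈ weights c a₁ a₂ h₀ V := hr₀
  obtain ⟨x, hx⟩ := H.exists_int_res hr₀' i
  obtain ⟨l, hl0, hl⟩ := H.exists_int_lev hr₀' i
  rw [res_add, res_degWt, add_zero] at hx
  have hlC : (H.lev i : ℂ) * (S.m 0 : ℂ) = l := by exact_mod_cast congrArg (Complex.ofReal) hl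
  set F : ℤ → ℕ := fun r => finrank ℂ (weightSpace c a₁ a₂ h₀ V (μ + degWt h₀ (r • gen0 S)))
  set A : ℕ := x.natAbs + 3 with hA
  -- Subtract `α + a m_0 δ_0`, then add `α - b m_0 δ_0`; the net shift is `-r m_0 δ_0`. Both
  -- operators are injective since `x + a l > 0` and `x - 2 - b l < 0`, which `a, b ≥ |x| + 3` and
  -- `l ≥ 1` ensure; the `-2` comes from the first subtraction of `α`.
  have key : ∀ r a b : ℤ, (A : ℤ) ≤ a → (A : ℤ) ≤ b → r = a + b → F r ≤ F 0 := by
    intro r a b ha hb hr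
    have h1 := H.finrank_le_sub (μ := μ + degWt h₀ (r • gen0 S)) i
      (k := a • gen0 S) (AddSubgroup.zsmul_mem _ gen0_mem a) (z := x + a * l) (by
        rw [res_add, res_degWt, add_zero, hx, Pi.smul_apply, gen0_zero]
        push_cast [smul_eq_mul]
        linear_combination (a : ℂ) * hlC) (by nlinarith [hA, abs_le.1 (le_refl |x|)])
    have h2 := H.finrank_le_add (μ := μ + degWt h₀ (r • gen0 S) -
      (extend h₀ ((rootSystem h₀).root i) + degWt h₀ (a • gen0 S))) i
      (k := (-b) • gen0 S) (AddSubgroup.zsmul_mem _ gen0_mem (-b)) (z := x - 2 - b * l) (by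
        have h3 : (rootSystem h₀).root i ((rootSystem h₀).coroot i) = 2 :=
          (rootSystem h₀).root_coroot_two i
        rw [res_sub, res_add, res_add, res_degWt, res_degWt, add_zero, add_zero, res_extend,
          LinearMap.sub_apply, hx, h3, Pi.smul_apply, gen0_zero]
        push_cast [smul_eq_mul]
        linear_combination -(b : ℂ) * hlC) (by nlinarith [hA, abs_le.1 (le_refl |x|)])
    have h3 : μ + degWt h₀ (r • gen0 S) -
        (extend h₀ ((rootSystem h₀).root i) + degWt h₀ (a • gen0 S)) +
        (extend h₀ ((rootSystem h₀).root i) + degWt h₀ ((-b) • gen0 S)) =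
        μ + degWt h₀ ((0 : ℤ) • gen0 S) := by
      simp only [degWt_smul, hr]
      module
    rw [h3] at h2
    exact h1.trans h2
  refine ⟨∑ r ∈ Finset.range (2 * A), F r + F 0, fun r hr => ?_⟩
  obtain ⟨r, rfl⟩ := Int.eq_ofNat_of_zero_le hr
  by_cases h : r < 2 * A
  · have h1 : F r ≤ ∑ r ∈ Finset.range (2 * A), F r :=
      Finset.single_le_sum (f := fun r : ℕ => F r) (fun _ _ => Nat.zero_le _)
        (Finset.mem_range.2 h)
    exact h1.trans (Nat.le_add_right _ _)
  · have h1 := key r A (r - A) le_rfl (by omega) (by ring)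
    exact h1.trans (Nat.le_add_left _ _)

/-- There are no weights far up in the direction of `δ_0`. -/
theorem exists_eventually_bot (H : IsPositiveLevel h₀ c a₁ a₂ V C₀) (i : h₀.root)
    (μ : Dual ℂ (Cart h₀)) : ∃ N : ℤ, ∀ r : ℤ, N ≤ r →
      weightSpace c a₁ a₂ h₀ V (μ + degWt h₀ (r • gen0 S)) = ⊥ := by
  obtain ⟨d, hd⟩ := H.exists_finrank_le i μ
  set t : h₀ := (rootSystem h₀).coroot i with ht
  have hmem : ∀ r : ℤ, ((t : S.fixed) : g) ∈ gradeRoot h₀ (r • gen0 S) 0 := fun r =>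
    gradeRoot_of_fixed (fun h => by
      have h1 : ⁅h, t⁆ = 0 := trivial_lie_zero _ _ h t
      have h2 : ⁅(h : S.fixed), (t : S.fixed)⁆ = 0 := congrArg Subtype.val h1
      rw [h2]; simp) (AddSubgroup.zsmul_mem _ gen0_mem r)
  let x : ℤ → S.tau c a₁ a₂ := fun r => S.tauX (r • gen0 S) ((t : S.fixed) : g) (hmem r).1
  let κ₀ : ℂ := (c : ℂ) * killingForm ℂ g ((t : S.fixed) : g) ((t : S.fixed) : g)
  have hbr : ∀ r s : ℤ, ((⁅x r, x s⁆ : S.tau c a₁ a₂) : Full g n c a₁ a₂) =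
      K (r • gen0 S + s • gen0 S) (κ₀ • (r • gen0 S).toVec) := fun r s => by
    change ⁅(X (r • gen0 S) ((t : S.fixed) : g) : Full g n c a₁ a₂),
      X (s • gen0 S) ((t : S.fixed) : g)⁆ = _
    rw [br_X_X, lie_self, map_zero, zero_add]
  have htoVec : ∀ r : ℤ, (r • gen0 S).toVec = (r : ℂ) • (gen0 S).toVec := fun r => by
    ext j; simp [Deg.toVec]
  have hcomm : ∀ r s : ℤ, r + s ≠ 0 → ⁅x r, x s⁆ = 0 := fun r s hrs => by
    refine Subtype.ext ?_
    rw [hbr]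
    have hrs' : ((r + s : ℤ) : ℂ) ≠ 0 := Int.cast_ne_zero.2 hrs
    -- The central term is a multiple of the defining relation in degree `(r + s) m_0 δ_0`, as all
    -- degrees here are proportional; dividing by `r + s` is where `r + s ≠ 0` is needed.
    refine K_eq_zero (κ₀ * r / ((r + s : ℤ) : ℂ)) ?_
    rw [← add_smul, htoVec, htoVec, smul_smul, smul_smul, div_mul_cancel₀ _ hrs']
  have hself : ∀ r : ℤ, ⁅x r, x (-r)⁆ = S.tauK 0 (κ₀ • (r • gen0 S).toVec) (zero_mem _) :=
    fun r => by
      refine Subtype.ext ?_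
      rw [hbr, ← add_smul, add_neg_cancel, zero_smul]; rfl
  let a : ℤ → End ℂ V := fun r => toEnd ℂ (S.tau c a₁ a₂) V (x r)
  -- The charge is non-zero because `(α^∨, α^∨) = 2κ > 0` and `c`, `m_0`, `C₀` are non-zero.
  have hκ : κ₀ * S.m 0 * C₀ ≠ 0 := by
    have h1 : killingForm ℂ g ((t : S.fixed) : g) ((t : S.fixed) : g) =
        (kap h₀ H.roots i : ℂ) * 2 := by
      rw [← cartanForm_apply, ht, cartanForm_coroot H.roots]
      congr 1
      exact (rootSystem h₀).root_coroot_two i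
    have h2 : (S.m 0 : ℂ) ≠ 0 := Nat.cast_ne_zero.2 (S.m_pos 0).ne'
    have h3 : (c : ℂ) ≠ 0 := Complex.ofReal_ne_zero.2 H.c_pos.ne'
    have h4 : (C₀ : ℂ) ≠ 0 := Complex.ofReal_ne_zero.2 H.level_pos.ne'
    have h5 : (kap h₀ H.roots i : ℂ) ≠ 0 := Complex.ofReal_ne_zero.2 (kap_pos H.roots i).ne'
    simp only [κ₀, h1]
    exact mul_ne_zero (mul_ne_zero (mul_ne_zero h3 (mul_ne_zero h5 two_ne_zero)) h2) h4
  refine heisenberg_eventually_bot (a := a)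
    (fun r => weightSpace c a₁ a₂ h₀ V (μ + degWt h₀ (r • gen0 S))) hκ ?_ ?_ ?_ d
    (fun r => H.integrable.finite_weightSpace _) hd
  · intro r s hrs
    refine LinearMap.ext fun v => ?_
    change ⁅x r, ⁅x s, v⁆⁆ = ⁅x s, ⁅x r, v⁆⁆
    rw [leibniz_lie, hcomm r s hrs, zero_lie, zero_add]
  · intro r
    refine LinearMap.ext fun v => ?_
    change ⁅x r, ⁅x (-r), v⁆⁆ - ⁅x (-r), ⁅x r, v⁆⁆ = _
    rw [leibniz_lie, hself, add_sub_cancel_right]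
    rw [apply_central H.central_zero H.central_ne_zero, LinearMap.smul_apply,
      Module.End.one_apply]
    congr 1
    simp only [htoVec, Pi.smul_apply, Deg.toVec, gen0_zero, smul_eq_mul]
    push_cast
    ring
  · intro r s v hv
    have h1 := (hasWt_tauX (c := c) (a₁ := a₁) (a₂ := a₂) (hmem r)).lie_mem hv
    rw [extend_zero, zero_add, add_assoc, ← degWt_add, ← add_smul] at h1
    exact h1

/-- `P(V)` is periodic in the directions of `δ_1, …, δ_n`. -/
theorem add_smul_degWt_mem (H : IsPositiveLevel h₀ c a₁ a₂ V C₀) {μ : Dual ℂ (Cart h₀)}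
    (hμ : μ ∈ weights c a₁ a₂ h₀ V) (i : h₀.root) {k q : Deg n} (hk : k ∈ S.lattice)
    (hq : q ∈ S.lattice) (hq0 : q 0 = 0) {y : ℤ}
    (hy : res μ ((rootSystem h₀).coroot i) + (H.lev i : ℂ) * k 0 = y) :
    μ + degWt h₀ (y • q) ∈ weights c a₁ a₂ h₀ V := by
  have h3 : (rootSystem h₀).root i ((rootSystem h₀).coroot i) = 2 :=
    (rootSystem h₀).root_coroot_two i
  -- Reflecting in `α + δ(k)` and then in `α + δ(k + q)`, with `δ(k)` for `degWt h₀ k`: as `q_0 =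
  -- 0`, the coroot values are `y` and then `-y`, and the product is translation by `y δ(q)`.
  have h1 := H.reflect_mem hμ i hk hy
  have h2 := H.reflect_mem h1 i (add_mem hk hq) (z := -y) (by
    rw [res_sub, res_zsmul, res_add, res_degWt, res_extend, add_zero, LinearMap.sub_apply,
      LinearMap.smul_apply, h3, Pi.add_apply, hq0, add_zero, zsmul_eq_mul]
    push_cast
    linear_combination hy)
  convert h2 using 1
  rw [degWt_smul, degWt_add]
  module

/-- The values of `k_0` are bounded on the weights in a coset of `∑ ℤ δ_i`. -/
theorem exists_forall_le (H : IsPositiveLevel h₀ c a₁ a₂ V C₀) (i : h₀.root)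
    (μ : Dual ℂ (Cart h₀)) : ∃ A : ℤ, ∀ k : Deg n,
      μ + degWt h₀ k ∈ weights c a₁ a₂ h₀ V → k 0 ≤ A := by
  by_cases hemp : ∀ k : Deg n, μ + degWt h₀ k ∉ weights c a₁ a₂ h₀ V
  · exact ⟨0, fun k hk => absurd hk (hemp k)⟩
  push Not at hemp
  obtain ⟨k₀, hk₀⟩ := hemp
  obtain ⟨x, hx⟩ := H.exists_int_res hk₀ i
  obtain ⟨l, hl0, hl⟩ := H.exists_int_lev hk₀ i
  rw [res_add, res_degWt, add_zero] at hx
  have hlC : (H.lev i : ℂ) * (S.m 0 : ℂ) = l := by exact_mod_cast congrArg (Complex.ofReal) hl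
  -- A non-zero `y` is needed for genuine periods. If `α^∨` gives `x = 0`, the root `α + m_0 δ_0`
  -- gives `l ≠ 0` instead.
  obtain ⟨r, y, hy0, hy⟩ : ∃ r y : ℤ, y ≠ 0 ∧ x + r * l = y := by
    by_cases h : x = 0
    · exact ⟨1, x + 1 * l, by omega, rfl⟩
    · exact ⟨0, x, h, by ring⟩
  choose N hN using fun k : Deg n => H.exists_eventually_bot i (μ + degWt h₀ k)
  -- The box `[0, B]` contains all residues: `k_0` modulo `m_0` and the other `k_j` modulo `y m_j`.
  -- Each of these finitely many residues `k'` starts one ray, with its own threshold `N k'`.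
  let B : Deg n := fun j => |y * S.m j| + S.m j
  have hm : ∀ j, (0 : ℤ) < S.m j := fun j => by exact_mod_cast S.m_pos j
  refine ⟨S.m 0 * ∑ k ∈ Finset.Icc 0 B, |N k| + S.m 0, fun k hk => ?_⟩
  let q : Deg n := fun j => if j = 0 then 0 else S.m j * (k j / (y * S.m j))
  let k' : Deg n := fun j => if j = 0 then k 0 % S.m 0 else k j % (y * S.m j)
  have hkk : k = k' + (k 0 / S.m 0) • gen0 S + y • q := by
    ext j
    rcases eq_or_ne j 0 with rfl | hj
    · simp only [Pi.add_apply, Pi.smul_apply, gen0_zero, k', q, if_true, smul_eq_mul]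
      have := Int.emod_add_mul_ediv (k 0) (S.m 0)
      linarith
    · simp only [Pi.add_apply, Pi.smul_apply, k', q, if_neg hj, smul_eq_mul, gen0,
        Pi.single_eq_of_ne hj]
      have := Int.emod_add_mul_ediv (k j) (y * S.m j)
      linarith
  have hk' : k' ∈ Finset.Icc 0 B := by
    rw [Finset.mem_Icc, Pi.le_def, Pi.le_def, ← forall_and]
    intro j
    have hj := hm j
    rcases eq_or_ne j 0 with rfl | h
    · simp only [k', if_true, Pi.zero_apply, B]
      have h1 := Int.emod_nonneg (k 0) hj.ne'
      have h2 := Int.emod_lt_of_pos (k 0) hj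
      have h3 := abs_nonneg (y * (S.m 0 : ℤ))
      exact ⟨h1, by linarith⟩
    · simp only [k', if_neg h, Pi.zero_apply, B]
      have h0 : y * (S.m j : ℤ) ≠ 0 := mul_ne_zero hy0 hj.ne'
      have h1 := Int.emod_nonneg (k j) h0
      have h2 := Int.emod_lt_abs (k j) h0
      exact ⟨h1, by linarith⟩
  have hq : q ∈ S.lattice := fun j => by
    by_cases h : j = 0
    · simp [q, h]
    · simp only [q, if_neg h]; exact dvd_mul_right _ _
  have h1 := H.add_smul_degWt_mem hk i (k := r • gen0 S) (q := -q) (y := y)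
    (AddSubgroup.zsmul_mem _ gen0_mem r) (neg_mem hq) (by simp [q]) (by
      rw [res_add, res_degWt, add_zero, hx, Pi.smul_apply, gen0_zero, ← hy]
      push_cast [smul_eq_mul]
      linear_combination (r : ℂ) * hlC)
  have h2 : μ + degWt h₀ k + degWt h₀ (y • -q) =
      μ + degWt h₀ k' + degWt h₀ ((k 0 / S.m 0) • gen0 S) := by
    rw [add_assoc, ← degWt_add, add_assoc, ← degWt_add]
    congr 2
    nth_rewrite 1 [hkk]
    module
  rw [h2] at h1
  have h3 : k 0 / S.m 0 < N k' := by
    by_contra h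
    exact h1 (hN k' _ (not_lt.1 h))
  have h4 : |N k'| ≤ ∑ k ∈ Finset.Icc 0 B, |N k| :=
    Finset.single_le_sum (f := fun k => |N k|) (fun _ _ => abs_nonneg _) hk'
  have h5 : k 0 / S.m 0 ≤ ∑ k ∈ Finset.Icc 0 B, |N k| := by
    have := le_abs_self (N k')
    linarith
  have h6 := Int.emod_add_mul_ediv (k 0) (S.m 0)
  have h7 := Int.emod_lt_of_pos (k 0) (hm 0)
  have h8 := mul_le_mul_of_nonneg_left h5 (hm 0).le
  linarith

end IsPositiveLevel

end Level

/-! ### The energy and the upper bound on P(V) -/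

section Bound

variable {g : Type*} [LieRing g] [LieAlgebra ℂ g] [FiniteDimensional ℂ g]
  {n : ℕ} {S : Datum g n} [LieAlgebra.IsSimple ℂ S.fixed] {h₀ : LieSubalgebra ℂ S.fixed}
  [h₀.IsCartanSubalgebra] {c : ℝ} {a₁ a₂ : ℂ}
  {V : Type*} [AddCommGroup V] [Module ℂ V] [LieRingModule (S.tau c a₁ a₂) V]
  [LieModule ℂ (S.tau c a₁ a₂) V] {C₀ : ℝ}

variable (h₀) in
-- Without roots `h(0)` would be zero; being self-normalising, it would be the whole fixed algebra,
-- which is not abelian.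
theorem nonempty_root : Nonempty h₀.root := by
  by_contra hcon
  rw [not_nonempty_iff] at hcon
  have h1 : ∀ t : h₀, t = 0 := fun t => eq_zero_of_root_apply fun i => isEmptyElim i
  have h2 : h₀ = ⊥ := by
    rw [eq_bot_iff]
    intro t ht
    have := congrArg Subtype.val (h1 ⟨t, ht⟩)
    rw [LieSubalgebra.mem_bot]
    exact this
  have h3 : h₀.normalizer = ⊤ := by
    rw [eq_top_iff]
    intro x _
    rw [LieSubalgebra.mem_normalizer_iff]
    intro y hy
    rw [h2, LieSubalgebra.mem_bot] at hy
    rw [hy, lie_zero]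
    exact zero_mem _
  rw [LieSubalgebra.IsCartanSubalgebra.self_normalizing, h2] at h3
  have : Nontrivial S.fixed := by
    by_contra h
    rw [not_nontrivial_iff_subsingleton] at h
    exact LieAlgebra.IsSimple.non_abelian (R := ℂ) (L := S.fixed) ⟨fun _ _ => Subsingleton.elim _ _⟩
  obtain ⟨x, hx⟩ := exists_ne (0 : S.fixed)
  have h4 : x ∈ (⊤ : LieSubalgebra ℂ S.fixed) := trivial
  rw [← h3, LieSubalgebra.mem_bot] at h4
  exact hx h4

/-- A functional on `h(0)` is determined by its values on coroots. -/
theorem eq_of_apply_coroot {ν ν' : Dual ℂ h₀}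
    (h : ∀ i, ν ((rootSystem h₀).coroot i) = ν' ((rootSystem h₀).coroot i)) : ν = ν' := by
  refine LinearMap.ext fun t => ?_
  have ht : t ∈ Submodule.span ℂ (Set.range (rootSystem h₀).coroot) := by
    rw [RootPairing.IsRootSystem.span_coroot_eq_top]; trivial
  induction ht using Submodule.span_induction with
  | mem x hx => obtain ⟨i, rfl⟩ := hx; exact h i
  | zero => simp
  | add x y _ _ hx hy => simp [hx, hy]
  | smul a x _ hx => simp [hx]

/-- There are finitely many integral functionals with bounded values on coroots. -/
theorem finite_integral_bounded (B : h₀.root → ℤ) :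
    {ν : Dual ℂ h₀ | ∀ i, ∃ z : ℤ, ν ((rootSystem h₀).coroot i) = z ∧ |z| ≤ B i}.Finite := by
  classical
  -- The value 0 on tuples that come from no functional is never used: only the image of the box
  -- matters.
  let F : (h₀.root → ℤ) → Dual ℂ h₀ := fun z =>
    if h : ∃ ν : Dual ℂ h₀, ∀ i, ν ((rootSystem h₀).coroot i) = z i then h.choose else 0
  refine Set.Finite.subset ((Set.finite_Icc (-B) B).image F) ?_
  intro ν hν
  choose z hz hzB using hν
  refine ⟨z, ⟨fun i => (abs_le.1 (hzB i)).1, fun i => (abs_le.1 (hzB i)).2⟩, ?_⟩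
  have h : ∃ ν : Dual ℂ h₀, ∀ i, ν ((rootSystem h₀).coroot i) = z i := ⟨ν, hz⟩
  change dite _ _ _ = ν
  rw [dif_pos h]
  exact eq_of_apply_coroot fun i => by rw [h.choose_spec i, hz i]

namespace IsPositiveLevel

/-- The invariant quadratic form on the weights of a module of level `C₀`. -/
def energy (H : IsPositiveLevel h₀ c a₁ a₂ V C₀) (μ : Dual ℂ (Cart h₀)) : ℝ :=
  normSq H.roots (res μ) + 2 * (c * C₀) * (μ (dElt h₀)).re

theorem zsmul_eq_real_smul {M : Type*} [AddCommGroup M] [Module ℂ M] (z : ℤ) (x : M) :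
    z • x = (((z : ℝ) : ℂ)) • x := by
  rw [← Int.cast_smul_eq_zsmul ℂ]; simp

/-- Translations preserve `P(V)` and the quadratic form. -/
theorem translate_mem (H : IsPositiveLevel h₀ c a₁ a₂ V C₀) {μ : Dual ℂ (Cart h₀)}
    (hμ : μ ∈ weights c a₁ a₂ h₀ V) (i : h₀.root) {x l : ℤ}
    (hx : res μ ((rootSystem h₀).coroot i) = x) (hl : H.lev i * (S.m 0 : ℝ) = l) (r : ℤ) :
    ∃ μ' ∈ weights c a₁ a₂ h₀ V, H.energy μ' = H.energy μ ∧
      μ' (dElt h₀) = μ (dElt h₀) + ((r * S.m 0 * (x - r * l) : ℤ) : ℂ) := by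
  have h3 : (rootSystem h₀).root i ((rootSystem h₀).coroot i) = 2 :=
    (rootSystem h₀).root_coroot_two i
  have hlC : (H.lev i : ℂ) * (S.m 0 : ℂ) = l := by exact_mod_cast congrArg (Complex.ofReal) hl
  -- The reflection in `α` followed by that in `α + r m_0 δ_0` subtracts `r l α` on `h(0)` and adds
  -- `r m_0 (x - r l)` to the value at `d_0`. The energy is unchanged because `l = c κ C₀ m_0`.
  have h1 := H.reflect_mem hμ i (zero_mem S.lattice) (z := x) (by simpa using hx)
  rw [degWt_zero, add_zero] at h1
  have h2 := H.reflect_mem h1 i (AddSubgroup.zsmul_mem _ gen0_mem r) (z := -x + r * l) (by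
    rw [res_sub, res_zsmul, res_extend, LinearMap.sub_apply, LinearMap.smul_apply, h3, hx,
      Pi.smul_apply, gen0_zero, zsmul_eq_mul]
    push_cast [smul_eq_mul]
    linear_combination (r : ℂ) * hlC)
  have hd : (μ - x • extend h₀ ((rootSystem h₀).root i) - (-x + r * l) •
      (extend h₀ ((rootSystem h₀).root i) + degWt h₀ (r • gen0 S))) (dElt h₀) =
      μ (dElt h₀) + ((r * S.m 0 * (x - r * l) : ℤ) : ℂ) := by
    rw [degWt_smul]
    simp only [LinearMap.sub_apply, LinearMap.smul_apply, LinearMap.add_apply, extend_dElt,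
      degWt_dElt, gen0_zero, smul_zero, sub_zero, zero_add, zsmul_eq_mul]
    push_cast
    ring
  refine ⟨_, h2, ?_, hd⟩
  have hr : res (μ - x • extend h₀ ((rootSystem h₀).root i) - (-x + r * l) •
      (extend h₀ ((rootSystem h₀).root i) + degWt h₀ (r • gen0 S))) =
      res μ - (((r * l : ℝ)) : ℂ) • (rootSystem h₀).root i := by
    rw [res_sub, res_sub, res_zsmul, res_zsmul, res_add, res_extend, res_degWt, add_zero,
      zsmul_eq_real_smul, zsmul_eq_real_smul]
    push_cast
    module
  have h5 := normSq_sub_smul_root H.roots (res μ) i hx (r * l)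
  rw [energy, energy, hd, hr, Complex.add_re, Complex.intCast_re]
  have h6 := kap_pos H.roots i
  refine mul_left_cancel₀ h6.ne' ?_
  rw [mul_add, h5, mul_add, ← hl, lev]
  have h7 : (l : ℝ) = c * kap h₀ H.roots i * C₀ * S.m 0 := by rw [← hl, lev]
  push_cast
  rw [h7]
  ring

/-- The quadratic form takes the same value at a weight whose restriction to `h(0)` is small. -/
theorem exists_reduced (H : IsPositiveLevel h₀ c a₁ a₂ V C₀) {l : h₀.root → ℤ}
    (hl : ∀ i, H.lev i * (S.m 0 : ℝ) = l i) {μ : Dual ℂ (Cart h₀)}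
    (hμ : μ ∈ weights c a₁ a₂ h₀ V) :
    ∃ μ' ∈ weights c a₁ a₂ h₀ V, H.energy μ' = H.energy μ ∧
      ∀ i, ∃ z : ℤ, res μ' ((rootSystem h₀).coroot i) = z ∧ |z| ≤ l i := by
  have hcC : 0 < c * C₀ := mul_pos H.c_pos H.level_pos
  -- At fixed energy the value at `d_0` is bounded above, since the norm is non-negative and `c C₀ >
  -- 0`; so a maximal one exists.
  let p : ℤ → Prop := fun z => ∃ μ' ∈ weights c a₁ a₂ h₀ V, H.energy μ' = H.energy μ ∧
    μ' (dElt h₀) = μ (dElt h₀) + (z : ℂ)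
  have hp0 : p 0 := ⟨μ, hμ, rfl, by simp⟩
  have hbdd : ∃ b : ℤ, ∀ z, p z → z ≤ b := by
    refine ⟨⌈H.energy μ / (2 * (c * C₀)) - (μ (dElt h₀)).re⌉, fun z hz => ?_⟩
    obtain ⟨μ', hμ', hE, hd⟩ := hz
    have h1 := normSq_nonneg H.roots (H.exists_int_res hμ')
    have h2 : H.energy μ' = normSq H.roots (res μ') + 2 * (c * C₀) * (μ' (dElt h₀)).re := rfl
    rw [hE, hd, Complex.add_re, Complex.intCast_re] at h2
    have h3 : (z : ℝ) ≤ H.energy μ / (2 * (c * C₀)) - (μ (dElt h₀)).re := by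
      rw [le_sub_iff_add_le, le_div_iff₀ (by positivity)]
      nlinarith
    exact_mod_cast h3.trans (Int.le_ceil _)
  obtain ⟨z, ⟨μ', hμ', hE, hd⟩, hmax⟩ := Int.exists_greatest_of_bdd hbdd ⟨0, hp0⟩
  refine ⟨μ', hμ', hE, fun i => ?_⟩
  obtain ⟨x, hx⟩ := H.exists_int_res hμ' i
  refine ⟨x, hx, ?_⟩
  have hm : (0 : ℤ) < S.m 0 := by exact_mod_cast S.m_pos 0
  -- By maximality no translation raises the value at `d_0`; `r = 1` gives `x ≤ l` and `r = -1`
  -- gives `-l ≤ x`.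
  have key : ∀ r : ℤ, S.m 0 * (r * (x - r * l i)) ≤ 0 := fun r => by
    obtain ⟨μ'', hμ'', hE', hd'⟩ := H.translate_mem hμ' i hx (hl i) r
    have := hmax (z + r * S.m 0 * (x - r * l i))
      ⟨μ'', hμ'', hE'.trans hE, by rw [hd', hd]; push_cast; ring⟩
    nlinarith
  have h1 := nonpos_of_mul_nonpos_right (key 1) hm
  have h2 := nonpos_of_mul_nonpos_right (key (-1)) hm
  rw [abs_le]
  constructor <;> linarith

variable [LieModule.IsIrreducible ℂ (S.tau c a₁ a₂) V]

/-- Weights with the same restriction to `h(0)` differ only by some `∑ k_i δ_i`, and `k_0` is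
bounded on such a coset. -/
theorem exists_dElt_le (H : IsPositiveLevel h₀ c a₁ a₂ V C₀) (ν : Dual ℂ h₀) :
    ∃ A : ℝ, ∀ μ ∈ weights c a₁ a₂ h₀ V, res μ = ν → (μ (dElt h₀)).re ≤ A := by
  by_cases hemp : ∀ μ ∈ weights c a₁ a₂ h₀ V, res μ ≠ ν
  · exact ⟨0, fun μ hμ h => absurd h (hemp μ hμ)⟩
  push Not at hemp
  obtain ⟨μ₀, hμ₀, h0⟩ := hemp
  obtain ⟨i⟩ := nonempty_root h₀
  obtain ⟨A, hA⟩ := H.exists_forall_le i μ₀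
  refine ⟨(μ₀ (dElt h₀)).re + A, fun μ hμ h => ?_⟩
  obtain ⟨α, -, k, rfl⟩ := mem_weightCoset_of_mem_weights H.grade_le H.integrable hμ₀ hμ
  have hα : α = 0 := by
    rw [res_add, res_add, res_extend, res_degWt, h0, add_zero] at h
    simpa using h
  subst hα
  rw [extend_zero, add_zero] at hμ ⊢
  rw [LinearMap.add_apply, degWt_dElt, Complex.add_re, Complex.intCast_re]
  have : (k 0 : ℝ) ≤ A := by exact_mod_cast hA k hμ
  linarith

/-- The quadratic form is bounded above on `P(V)`. -/
theorem exists_energy_le (H : IsPositiveLevel h₀ c a₁ a₂ V C₀) :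
    ∃ B : ℝ, ∀ μ ∈ weights c a₁ a₂ h₀ V, H.energy μ ≤ B := by
  by_cases hemp : ∀ μ, μ ∉ weights c a₁ a₂ h₀ V
  · exact ⟨0, fun μ hμ => absurd hμ (hemp μ)⟩
  push Not at hemp
  obtain ⟨μ₀, hμ₀⟩ := hemp
  choose l hl0 hl using fun i => H.exists_int_lev hμ₀ i
  choose A hA using fun ν => H.exists_dElt_le ν
  -- Reduced weights have finitely many restrictions `ν`, and for each of them `A ν` bounds the
  -- value at `d_0`.
  obtain ⟨B, hB⟩ := ((finite_integral_bounded l).image fun ν : Dual ℂ h₀ =>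
    normSq H.roots ν + 2 * (c * C₀) * A ν).bddAbove
  refine ⟨B, fun μ hμ => ?_⟩
  obtain ⟨μ', hμ', hE, hz⟩ := H.exists_reduced hl hμ
  rw [← hE]
  refine le_trans ?_ (hB ⟨res μ', hz, rfl⟩)
  have h1 := hA _ μ' hμ' rfl
  have hcC : 0 < c * C₀ := mul_pos H.c_pos H.level_pos
  exact add_le_add le_rfl (mul_le_mul_of_nonneg_left h1 (by positivity))

/-- Evaluation at `ρ + L d_0` is bounded above on `P(V)`. -/
theorem exists_apply_le (H : IsPositiveLevel h₀ c a₁ a₂ V C₀) {ρ : h₀} (hρ : IsRealElt ρ)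
    {L : ℝ} (hL : 0 < L) : ∃ B : ℝ, ∀ μ ∈ weights c a₁ a₂ h₀ V,
      (res μ ρ).re + L * (μ (dElt h₀)).re ≤ B := by
  have hcC : 0 < c * C₀ := mul_pos H.c_pos H.level_pos
  obtain ⟨B, hB⟩ := H.exists_energy_le
  obtain ⟨B', hB'⟩ := apply_re_le_normSq H.roots hρ
  -- With `s = c C₀ / L` in the Cauchy–Schwarz inequality, the terms `2 s ρ` and `2 c C₀ d_0` stand
  -- in the ratio `ρ : L d_0`; the factor `L / (2 c C₀)` normalises them.
  refine ⟨L / (2 * (c * C₀)) * (B + (c * C₀ / L) ^ 2 * B'), fun μ hμ => ?_⟩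
  have h1 := hB μ hμ
  have h2 := hB' (res μ) (H.exists_int_res hμ) (c * C₀ / L)
  rw [energy] at h1
  have h3 : 0 < L / (2 * (c * C₀)) := by positivity
  have hc := H.c_pos.ne'
  have hC := H.level_pos.ne'
  calc (res μ ρ).re + L * (μ (dElt h₀)).re = L / (2 * (c * C₀)) *
        (2 * (c * C₀ / L) * (res μ ρ).re + 2 * (c * C₀) * (μ (dElt h₀)).re) := by
        field_simp
    _ ≤ _ := mul_le_mul_of_nonneg_left (by linarith) h3.le

/-- There is a weight at which `ρ + L d_0` takes its maximal value. -/
theorem exists_maximal (H : IsPositiveLevel h₀ c a₁ a₂ V C₀) {ρ : h₀} (hρ : IsRealElt ρ)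
    (hint : ∀ α ∈ rootLattice h₀, ∃ z : ℤ, α ρ = z) {L : ℕ} (hL : 0 < L) :
    ∃ γ ∈ weights c a₁ a₂ h₀ V, ∀ μ ∈ weights c a₁ a₂ h₀ V,
      (μ (ρ, 0, (L : ℂ) • e0 n)).re ≤ (γ (ρ, 0, (L : ℂ) • e0 n)).re := by
  have hval : ∀ μ : Dual ℂ (Cart h₀), μ (ρ, 0, (L : ℂ) • e0 n) = res μ ρ + L * μ (dElt h₀) := by
    intro μ
    have : ((ρ, 0, (L : ℂ) • e0 n) : Cart h₀) = (ρ, 0, 0) + (L : ℂ) • dElt h₀ := by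
      simp [dElt]
    rw [this, map_add, map_smul, res_apply, smul_eq_mul]
  have hne : ∃ μ₀, μ₀ ∈ weights c a₁ a₂ h₀ V := by
    by_contra! hcon
    have h1 := H.integrable.iSup_weightSpace
    have h2 : ∀ μ, weightSpace c a₁ a₂ h₀ V μ = ⊥ := fun μ => not_not.1 (hcon μ)
    simp only [h2, iSup_bot] at h1
    have : Nontrivial (LieSubmodule ℂ (S.tau c a₁ a₂) V) := inferInstance
    have : Nontrivial V := (LieSubmodule.nontrivial_iff ℂ (S.tau c a₁ a₂) V).1 this
    exact bot_ne_top h1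
  obtain ⟨μ₀, hμ₀⟩ := hne
  obtain ⟨B, hB⟩ := H.exists_apply_le hρ (L := L) (by exact_mod_cast hL)
  -- The values on P(V) lie in one coset of ℤ, so a bounded supremum is attained.
  have hstep : ∀ μ ∈ weights c a₁ a₂ h₀ V, ∃ z : ℤ,
      μ (ρ, 0, (L : ℂ) • e0 n) = μ₀ (ρ, 0, (L : ℂ) • e0 n) + z := by
    intro μ hμ
    obtain ⟨α, hα, k, rfl⟩ := mem_weightCoset_of_mem_weights H.grade_le H.integrable hμ₀ hμ
    obtain ⟨z, hz⟩ := hint α hα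
    refine ⟨z + L * k 0, ?_⟩
    rw [LinearMap.add_apply, LinearMap.add_apply, hval (degWt h₀ k), extend_apply, hz, res_degWt,
      degWt_dElt]
    push_cast
    rw [LinearMap.zero_apply]
    ring
  have hLre : ∀ x : ℂ, ((L : ℂ) * x).re = L * x.re := fun x => by
    rw [← Complex.ofReal_natCast, Complex.re_ofReal_mul]
  let p : ℤ → Prop := fun z => ∃ μ ∈ weights c a₁ a₂ h₀ V,
    μ (ρ, 0, (L : ℂ) • e0 n) = μ₀ (ρ, 0, (L : ℂ) • e0 n) + z
  have hbdd : ∃ b : ℤ, ∀ z, p z → z ≤ b := by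
    refine ⟨⌈B - (μ₀ (ρ, 0, (L : ℂ) • e0 n)).re⌉, fun z hz => ?_⟩
    obtain ⟨μ, hμ, h⟩ := hz
    have h1 := hB μ hμ
    have h2 := congrArg Complex.re h
    rw [Complex.add_re, Complex.intCast_re, hval, Complex.add_re, hLre] at h2
    have h3 : (z : ℝ) ≤ B - (μ₀ (ρ, 0, (L : ℂ) • e0 n)).re := by linarith
    exact_mod_cast h3.trans (Int.le_ceil _)
  obtain ⟨z, ⟨γ, hγ, hz⟩, hmax⟩ := Int.exists_greatest_of_bdd hbdd ⟨0, μ₀, hμ₀, by simp⟩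
  refine ⟨γ, hγ, fun μ hμ => ?_⟩
  obtain ⟨z', hz'⟩ := hstep μ hμ
  have h1 : (z' : ℝ) ≤ z := by exact_mod_cast hmax z' ⟨μ, hμ, hz'⟩
  rw [hz, hz', Complex.add_re, Complex.add_re, Complex.intCast_re, Complex.intCast_re]
  linarith

end IsPositiveLevel

end Bound

/-! ### The ordering, the triangular decomposition and the highest weight -/

section Cone

variable {g : Type*} [LieRing g] [LieAlgebra ℂ g] [FiniteDimensional ℂ g]
  {n : ℕ} {S : Datum g n} [LieAlgebra.IsSimple ℂ S.fixed] {h₀ : LieSubalgebra ℂ S.fixed}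
  [h₀.IsCartanSubalgebra] {b : (rootSystem h₀).Base} {β₀ : Dual ℂ h₀}

variable (β₀) in
theorem extend_mem_posCone {α : Dual ℂ h₀}
    (hα : α ∈ AddSubmonoid.closure ((rootSystem h₀).root '' b.support)) :
    extend h₀ α ∈ posCone b β₀ := by
  induction hα using AddSubmonoid.closure_induction with
  | mem x hx =>
    obtain ⟨i, hi, rfl⟩ := hx
    exact AddSubmonoid.subset_closure (Set.mem_insert_of_mem _ ⟨i, hi, rfl⟩)
  | zero => exact zero_mem _
  | add x y _ _ hx hy => rw [extend_add]; exact add_mem hx hy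

/-- The element of `H` on which `α_1, …, α_p` take the value `1` and `δ_0` the value `L`. -/
def gradingElt (ρ : h₀) (L : ℕ) : Cart h₀ := (ρ, 0, (L : ℂ) • e0 n)

theorem delta_zero_gradingElt (ρ : h₀) (L : ℕ) : delta h₀ 0 (gradingElt ρ L) = L := by
  change ((L : ℂ) • e0 n) 0 = L
  simp [e0]

theorem deltaVec_gradingElt (ρ : h₀) (L : ℕ) (k : Fin n → ℤ) :
    deltaVec h₀ k (gradingElt ρ L) = 0 := by
  rw [deltaVec, LinearMap.sum_apply]
  refine Finset.sum_eq_zero fun i _ => ?_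
  have : delta h₀ i.succ (gradingElt ρ L) = 0 := by
    change ((L : ℂ) • e0 n) i.succ = 0
    simp [e0]
  rw [LinearMap.smul_apply, this, smul_zero]

theorem closure_apply_nat {ρ : h₀} (hρ : ∀ i ∈ b.support, (rootSystem h₀).root i ρ = 1)
    {α : Dual ℂ h₀} (hα : α ∈ AddSubmonoid.closure ((rootSystem h₀).root '' b.support)) :
    ∃ N : ℕ, α ρ = N := by
  induction hα using AddSubmonoid.closure_induction with
  | mem x hx =>
    obtain ⟨i, hi, rfl⟩ := hx
    exact ⟨1, by rw [hρ i hi, Nat.cast_one]⟩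
  | zero => exact ⟨0, by simp⟩
  | add x y _ _ hx hy =>
    obtain ⟨p, hp⟩ := hx
    obtain ⟨q, hq⟩ := hy
    exact ⟨p + q, by rw [LinearMap.add_apply, hp, hq, Nat.cast_add]⟩

/-- With `L = β₀(ρ) + 1`, all of `α_0, …, α_p` take the value 1, so the value counts the generators
in a sum and vanishes only for the empty one. -/
theorem IsPos.gradingElt_apply {ρ : h₀} (hρ : ∀ i ∈ b.support, (rootSystem h₀).root i ρ = 1)
    {N : ℕ} (hN : β₀ ρ = N) {β : Dual ℂ (Cart h₀)} (hβ : IsPos b β₀ β) :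
    ∃ m : ℕ, 0 < m ∧ β (gradingElt ρ (N + 1)) = m := by
  have key : ∃ m : ℕ, β (gradingElt ρ (N + 1)) = m ∧ (m = 0 → β = 0) := by
    obtain ⟨h, -⟩ := hβ
    induction h using AddSubmonoid.closure_induction with
    | mem x hx =>
      refine ⟨1, ?_, by simp⟩
      obtain rfl | ⟨i, hi, rfl⟩ := hx
      · rw [LinearMap.add_apply, delta_zero_gradingElt, LinearMap.neg_apply, extend_apply,
          gradingElt, hN]
        push_cast; ring
      · rw [extend_apply, gradingElt, hρ i hi, Nat.cast_one]
    | zero => exact ⟨0, by simp⟩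
    | add x y _ _ hx hy =>
      obtain ⟨p, hp, hp0⟩ := hx
      obtain ⟨q, hq, hq0⟩ := hy
      refine ⟨p + q, by rw [LinearMap.add_apply, hp, hq, Nat.cast_add], fun h => ?_⟩
      rw [hp0 (by omega), hq0 (by omega), add_zero]
  obtain ⟨m, hm, h0⟩ := key
  exact ⟨m, Nat.pos_of_ne_zero fun h => hβ.2 (h0 h), hm⟩

/-- One has `α + k δ_0 = k α_0 + (β₀ + α) + (k - 1) β₀`, and `β₀ + α` is in the cone by maximality
of `β₀` applied to `-α`. -/
theorem isPos_extend_add_smul (hβ₀ : IsMaximalRoot b β₀) {α : Dual ℂ h₀}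
    (hα : α ∈ enlargedRoots h₀) {k : ℤ} (hk : 0 < k) :
    IsPos b β₀ (extend h₀ α + k • delta h₀ 0) := by
  have hβ : extend h₀ β₀ ∈ posCone b β₀ := extend_mem_posCone β₀ (by
    simpa using hβ₀.2 0 (Or.inl rfl))
  have hβα : extend h₀ (β₀ - -α) ∈ posCone b β₀ :=
    extend_mem_posCone β₀ (hβ₀.2 _ (neg_mem_enlargedRoots hα))
  have hα₀ : -extend h₀ β₀ + delta h₀ 0 ∈ posCone b β₀ :=
    AddSubmonoid.subset_closure (Set.mem_insert _ _)
  obtain ⟨m, rfl⟩ : ∃ m : ℕ, k = m + 1 := ⟨(k - 1).toNat, by omega⟩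
  constructor
  · have e : extend h₀ α + ((m + 1 : ℤ)) • delta h₀ 0 =
        (m + 1) • (-extend h₀ β₀ + delta h₀ 0) + extend h₀ (β₀ - -α) + m • extend h₀ β₀ := by
      rw [sub_neg_eq_add, extend_add]
      module
    rw [e]
    exact add_mem (add_mem (nsmul_mem hα₀ _) hβα) (nsmul_mem hβ _)
  -- Evaluating at `d_0`, which is `gradingElt 0 1`, recovers the coefficient `k ≠ 0`.
  · intro h
    have h1 := LinearMap.congr_fun h (gradingElt (0 : h₀) 1)
    rw [LinearMap.add_apply, LinearMap.smul_apply, delta_zero_gradingElt, extend_apply, gradingElt,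
      map_zero, LinearMap.zero_apply] at h1
    simp only [zero_add, Nat.cast_one, zsmul_eq_mul, mul_one] at h1
    have : (m + 1 : ℤ) = 0 := by exact_mod_cast h1
    omega

theorem extend_eq_zero {α : Dual ℂ h₀} (h : extend h₀ α = 0) : α = 0 := by
  rw [← res_extend α, h]; rfl

/-- The sign of `k` decides when `k ≠ 0`, and the base of the finite root system decides when `k =
0`. This makes the three pieces exhaust the loop part of `τ`. -/
theorem isPos_or_isPos_neg (hβ₀ : IsMaximalRoot b β₀) {α : Dual ℂ h₀}
    (hα : α ∈ enlargedRoots h₀) (k : ℤ) :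
    IsPos b β₀ (extend h₀ α + k • delta h₀ 0) ∨ IsPos b β₀ (-(extend h₀ α + k • delta h₀ 0)) ∨
      (α = 0 ∧ k = 0) := by
  rcases lt_trichotomy k 0 with hk | rfl | hk
  · right; left
    have := isPos_extend_add_smul hβ₀ (neg_mem_enlargedRoots hα) (k := -k) (by omega)
    rwa [extend_neg, neg_smul, ← neg_add] at this
  · by_cases h0 : α = 0
    · exact Or.inr (Or.inr ⟨h0, rfl⟩)
    have hne : extend h₀ α ≠ 0 := fun h => h0 (extend_eq_zero h)
    rw [zero_smul, add_zero, ← extend_neg]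
    have key : α ∈ AddSubmonoid.closure ((rootSystem h₀).root '' b.support) ∨
        -α ∈ AddSubmonoid.closure ((rootSystem h₀).root '' b.support) := by
      rcases hα with rfl | ⟨i, rfl⟩ | ⟨-, i, -, rfl⟩
      · exact absurd rfl h0
      · exact b.root_mem_or_neg_mem i
      · rw [two_smul, neg_add]
        exact (b.root_mem_or_neg_mem i).imp (fun h => add_mem h h) fun h => add_mem h h
    rcases key with h | h
    · exact Or.inl ⟨extend_mem_posCone β₀ h, hne⟩
    · refine Or.inr (Or.inl ⟨extend_mem_posCone β₀ h, ?_⟩)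
      rwa [extend_neg, Ne, neg_eq_zero]
  · exact Or.inl (isPos_extend_add_smul hβ₀ hα hk)

theorem isPos_smul_delta (hβ₀ : IsMaximalRoot b β₀) {k : ℤ} (hk : 0 < k) :
    IsPos b β₀ (k • delta h₀ 0) := by
  simpa [extend_zero] using isPos_extend_add_smul hβ₀ (Or.inl rfl) hk

variable {c : ℝ} {a₁ a₂ : ℂ}

/-- `τ⁺` is spanned by vectors of weights `β + δ_k` with `β > 0`. -/
theorem tauPos_le (hβ₀ : IsMaximalRoot b β₀) {N : Submodule ℂ (S.tau c a₁ a₂)}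
    (hN : ∀ t β (k : Fin n → ℤ), IsPos b β₀ β → HasWt t (β + deltaVec h₀ k) → t ∈ N) :
    tauPos c a₁ a₂ b β₀ ≤ N := by
  refine Submodule.span_le.2 ?_
  rintro t (⟨k, α, x, hx, hpos, rfl⟩ | ⟨r, w, hr, hpos, rfl | rfl⟩)
  · refine hN _ _ (fun i => k i.succ) hpos ?_
    rw [add_assoc, ← degWt_eq]
    exact hasWt_tauX hx
  · refine hN _ _ (fun i => r i.succ) (isPos_smul_delta hβ₀ hpos) ?_
    rw [← degWt_eq]
    exact hasWt_tauK w hr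
  · refine hN _ _ (fun i => r i.succ) (isPos_smul_delta hβ₀ hpos) ?_
    rw [← degWt_eq]
    exact hasWt_tauD w hr

theorem tauNeg_le (hβ₀ : IsMaximalRoot b β₀) {N : Submodule ℂ (S.tau c a₁ a₂)}
    (hN : ∀ t β (k : Fin n → ℤ), IsPos b β₀ (-β) → HasWt t (β + deltaVec h₀ k) → t ∈ N) :
    tauNeg c a₁ a₂ b β₀ ≤ N := by
  have hneg : ∀ k : ℤ, k < 0 → IsPos b β₀ (-(k • delta h₀ 0)) := fun k hk => by
    rw [← neg_smul]; exact isPos_smul_delta hβ₀ (by omega)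
  refine Submodule.span_le.2 ?_
  rintro t (⟨k, α, x, hx, hpos, rfl⟩ | ⟨r, w, hr, hpos, rfl | rfl⟩)
  · refine hN _ _ (fun i => k i.succ) hpos ?_
    rw [add_assoc, ← degWt_eq]
    exact hasWt_tauX hx
  · refine hN _ _ (fun i => r i.succ) (hneg _ hpos) ?_
    rw [← degWt_eq]
    exact hasWt_tauK w hr
  · refine hN _ _ (fun i => r i.succ) (hneg _ hpos) ?_
    rw [← degWt_eq]
    exact hasWt_tauD w hr

theorem tauZero_le {N : Submodule ℂ (S.tau c a₁ a₂)}
    (hN : ∀ t (k : Fin n → ℤ), HasWt t (deltaVec h₀ k) → t ∈ N) :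
    tauZero c a₁ a₂ h₀ ≤ N := by
  have hdeg : ∀ k : Deg n, k 0 = 0 → degWt h₀ k = deltaVec h₀ fun i => k i.succ := fun k hk => by
    rw [degWt_eq, hk, zero_smul, zero_add]
  refine Submodule.span_le.2 ?_
  rintro t (⟨k, x, hx, h0, rfl⟩ | ⟨r, w, hr, h0, rfl | rfl⟩)
  · refine hN _ (fun i => k i.succ) ?_
    rw [← hdeg k h0, ← zero_add (degWt h₀ k), ← extend_zero]
    exact hasWt_tauX hx
  · refine hN _ (fun i => r i.succ) ?_
    rw [← hdeg r h0]
    exact hasWt_tauK w hr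
  · refine hN _ (fun i => r i.succ) ?_
    rw [← hdeg r h0]
    exact hasWt_tauD w hr

/-- The triangular decomposition `τ = τ⁻ ⊕ τ⁰ ⊕ τ⁺`. -/
theorem isInternal_triangular (hβ₀ : IsMaximalRoot b β₀)
    (hgrade : ∀ k, S.grade k ≤ ⨆ α : enlargedRoots h₀, gradeRoot h₀ k α) :
    DirectSum.IsInternal
      ![tauNeg c a₁ a₂ b β₀, tauZero c a₁ a₂ h₀, tauPos c a₁ a₂ b β₀] := by
  obtain ⟨ρ, -, hρ⟩ := exists_heightElt b
  obtain ⟨N, hN⟩ := closure_apply_nat hρ (α := β₀) (by simpa using hβ₀.2 0 (Or.inl rfl))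
  let T : Module.End ℂ (S.tau c a₁ a₂) :=
    toEnd ℂ (S.tau c a₁ a₂) (S.tau c a₁ a₂) (cartIncl h₀ (gradingElt ρ (N + 1)))
  -- Directness follows from the independence of these eigenspaces: the three pieces lie in the sums
  -- over `m < 0`, `m = 0` and `m > 0`.
  let E : ℤ → Submodule ℂ (S.tau c a₁ a₂) := fun m => T.eigenspace (m : ℂ)
  have hE : iSupIndep E := T.eigenspaces_iSupIndep.comp Int.cast_injective
  have hmem : ∀ (t : S.tau c a₁ a₂) (β : Dual ℂ (Cart h₀)) (k : Fin n → ℤ) (m : ℤ),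
      β (gradingElt ρ (N + 1)) = (m : ℂ) →
      HasWt t (β + deltaVec h₀ k) → t ∈ E m := fun t β k m hm ht => by
    rw [Module.End.mem_eigenspace_iff, ← hm]
    have := ht (gradingElt ρ (N + 1))
    rwa [LinearMap.add_apply, deltaVec_gradingElt, add_zero] at this
  have hneg : tauNeg c a₁ a₂ b β₀ ≤ ⨆ m ∈ Set.Iio (0 : ℤ), E m :=
    tauNeg_le hβ₀ fun t β k hβ ht => by
      obtain ⟨m, hm, h⟩ := hβ.gradingElt_apply hρ hN
      refine le_biSup E (show -(m : ℤ) ∈ Set.Iio (0 : ℤ) from ?_) (hmem t β k _ ?_ ht)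
      · rw [Set.mem_Iio]; omega
      · rw [LinearMap.neg_apply] at h
        push_cast
        rw [← h, neg_neg]
  have hpos : tauPos c a₁ a₂ b β₀ ≤ ⨆ m ∈ Set.Ioi (0 : ℤ), E m :=
    tauPos_le hβ₀ fun t β k hβ ht => by
      obtain ⟨m, hm, h⟩ := hβ.gradingElt_apply hρ hN
      refine le_biSup E (show (m : ℤ) ∈ Set.Ioi (0 : ℤ) from ?_) (hmem t β k _ ?_ ht)
      · rw [Set.mem_Ioi]; omega
      · rw [h, Int.cast_natCast]
  have hzero : tauZero c a₁ a₂ h₀ ≤ ⨆ m ∈ ({0} : Set ℤ), E m := by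
    rw [iSup_singleton]
    exact tauZero_le fun t k ht => hmem t 0 k 0 (by simp) (by rwa [zero_add])
  have hle1 : ∀ A B : Set ℤ, (⨆ m ∈ A, E m) ⊔ (⨆ m ∈ B, E m) = ⨆ m ∈ A ∪ B, E m := fun A B =>
    iSup_union.symm
  rw [DirectSum.isInternal_submodule_iff_iSupIndep_and_iSup_eq_top]
  refine ⟨iSupIndep_fin_three.2 ⟨?_, ?_, ?_⟩, ?_⟩
  · refine (hE.disjoint_biSup_biSup (s := Set.Iio 0) (t := {0} ∪ Set.Ioi 0) ?_).mono hneg ?_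
    · rw [Set.disjoint_left]; intro x hx hy
      simp only [Set.mem_Iio, Set.mem_union, Set.mem_singleton_iff, Set.mem_Ioi] at hx hy; omega
    · rw [← hle1]; exact sup_le_sup hzero hpos
  · refine (hE.disjoint_biSup_biSup (s := {0}) (t := Set.Ioi 0 ∪ Set.Iio 0) ?_).mono hzero ?_
    · rw [Set.disjoint_left]; intro x hx hy
      simp only [Set.mem_Iio, Set.mem_union, Set.mem_singleton_iff, Set.mem_Ioi] at hx hy; omega
    · rw [← hle1]; exact sup_le_sup hpos hneg
  · refine (hE.disjoint_biSup_biSup (s := Set.Ioi 0) (t := Set.Iio 0 ∪ {0}) ?_).mono hpos ?_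
    · rw [Set.disjoint_left]; intro x hx hy
      simp only [Set.mem_Iio, Set.mem_union, Set.mem_singleton_iff, Set.mem_Ioi] at hx hy; omega
    · rw [← hle1]; exact sup_le_sup hneg hzero
  · rw [iSup_fin_three]
    change tauNeg c a₁ a₂ b β₀ ⊔ tauZero c a₁ a₂ h₀ ⊔ tauPos c a₁ a₂ b β₀ = ⊤
    have sub_neg : tauNeg c a₁ a₂ b β₀ ≤
        tauNeg c a₁ a₂ b β₀ ⊔ tauZero c a₁ a₂ h₀ ⊔ tauPos c a₁ a₂ b β₀ :=
      le_sup_left.trans le_sup_left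
    have sub_zero : tauZero c a₁ a₂ h₀ ≤
        tauNeg c a₁ a₂ b β₀ ⊔ tauZero c a₁ a₂ h₀ ⊔ tauPos c a₁ a₂ b β₀ :=
      le_sup_right.trans le_sup_left
    have sub_pos : tauPos c a₁ a₂ b β₀ ≤
        tauNeg c a₁ a₂ b β₀ ⊔ tauZero c a₁ a₂ h₀ ⊔ tauPos c a₁ a₂ b β₀ := le_sup_right
    refine tau_eq_top_of_monomials hgrade _ ?_ ?_ ?_
    · intro k α hα x hx
      rcases isPos_or_isPos_neg hβ₀ hα (k 0) with h | h | ⟨rfl, h⟩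
      · exact sub_pos (Submodule.subset_span (Or.inl ⟨k, α, x, hx, h, rfl⟩))
      · exact sub_neg (Submodule.subset_span (Or.inl ⟨k, α, x, hx, h, rfl⟩))
      · exact sub_zero (Submodule.subset_span (Or.inl ⟨k, x, hx, h, rfl⟩))
    · intro r w hr
      rcases lt_trichotomy (r 0) 0 with h | h | h
      · exact sub_neg (Submodule.subset_span (Or.inr ⟨r, w, hr, h, Or.inl rfl⟩))
      · exact sub_zero (Submodule.subset_span (Or.inr ⟨r, w, hr, h, Or.inl rfl⟩))
      · exact sub_pos (Submodule.subset_span (Or.inr ⟨r, w, hr, h, Or.inl rfl⟩))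
    · intro r w hr
      rcases lt_trichotomy (r 0) 0 with h | h | h
      · exact sub_neg (Submodule.subset_span (Or.inr ⟨r, w, hr, h, Or.inr rfl⟩))
      · exact sub_zero (Submodule.subset_span (Or.inr ⟨r, w, hr, h, Or.inr rfl⟩))
      · exact sub_pos (Submodule.subset_span (Or.inr ⟨r, w, hr, h, Or.inr rfl⟩))

variable {V : Type*} [AddCommGroup V] [Module ℂ V] [LieRingModule (S.tau c a₁ a₂) V]
  [LieModule ℂ (S.tau c a₁ a₂) V] {C₀ : ℝ}

/-- At a weight maximal for the grading element, adding `β + δ_k` would raise the value by a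
positive integer, as `δ_k` contributes nothing. -/
theorem IsPositiveLevel.exists_highest_weight [LieModule.IsIrreducible ℂ (S.tau c a₁ a₂) V]
    (H : IsPositiveLevel h₀ c a₁ a₂ V C₀) (hβ₀ : IsMaximalRoot b β₀) :
    ∃ γ ∈ weights c a₁ a₂ h₀ V, ∀ β, IsPos b β₀ β → ∀ k : Fin n → ℤ,
      γ + β + deltaVec h₀ k ∉ weights c a₁ a₂ h₀ V := by
  obtain ⟨ρ, hreal, hρ⟩ := exists_heightElt b
  obtain ⟨N, hN⟩ := closure_apply_nat hρ (α := β₀) (by simpa using hβ₀.2 0 (Or.inl rfl))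
  obtain ⟨γ, hγ, hmax⟩ := H.exists_maximal hreal (fun α hα => apply_heightElt_int hρ hα)
    N.succ_pos
  refine ⟨γ, hγ, fun β hβ k hmem => ?_⟩
  obtain ⟨m, hm, h⟩ := hβ.gradingElt_apply hρ hN
  have h1 := hmax _ hmem
  change (_ + _ + deltaVec h₀ k (gradingElt ρ (N + 1))).re ≤ _ at h1
  rw [deltaVec_gradingElt, add_zero] at h1
  change (γ _ + β (gradingElt ρ (N + 1))).re ≤ _ at h1
  rw [h, Complex.add_re, Complex.natCast_re] at h1
  have : (0 : ℝ) < m := Nat.cast_pos.2 hm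
  linarith

/-- The spanning elements of `τ⁺` have weights `β + δ_k` with `β > 0`, so they send a vector of
weight `γ` into a zero weight space. -/
theorem highestWeightSpace_ne_bot (hβ₀ : IsMaximalRoot b β₀) {γ : Dual ℂ (Cart h₀)}
    (hγ : γ ∈ weights c a₁ a₂ h₀ V) (hmax : ∀ β, IsPos b β₀ β → ∀ k : Fin n → ℤ,
      γ + β + deltaVec h₀ k ∉ weights c a₁ a₂ h₀ V) :
    highestWeightSpace c a₁ a₂ b β₀ V ≠ ⊥ := by
  obtain ⟨v, hv, hv0⟩ := exists_of_mem_weights hγ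
  refine (Submodule.ne_bot_iff _).2 ⟨v, fun t ht => ?_, hv0⟩
  have hle : tauPos c a₁ a₂ b β₀ ≤
      LinearMap.ker (LinearMap.flip (toEnd ℂ (S.tau c a₁ a₂) V : S.tau c a₁ a₂ →ₗ[ℂ] End ℂ V) v) := by
    refine tauPos_le hβ₀ fun t β k hβ ht => ?_
    by_contra hne
    refine hmax β hβ k (mem_weights_of_ne_zero (v := ⁅t, v⁆) ?_ hne)
    rw [add_assoc]
    exact ht.lie_mem hv
  exact hle ht

end Cone

end Datum

end Toroidal

end

open Toroidal Toroidal.Datum in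
theorem theorem5p3 {g : Type*} [LieRing g] [LieAlgebra ℂ g] [FiniteDimensional ℂ g]
    [LieAlgebra.IsSimple ℂ g] {n : ℕ} (hn : 0 < n) (S : Datum g n)
    -- the invariant form is `c` times the Killing form, and the cocycle is `a₁ φ₁ + a₂ φ₂`
    (c : ℝ) (hc : 0 < c) (a₁ a₂ : ℂ)
    [LieAlgebra.IsSimple ℂ S.fixed]
    (h₀ : LieSubalgebra ℂ S.fixed) [h₀.IsCartanSubalgebra]
    (h : LieSubalgebra ℂ g) [h.IsCartanSubalgebra] (hh : h₀.map S.fixed.incl ≤ h)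
    (hroots : weightsOnG h₀ ⊆ enlargedRoots h₀)
    (b : (LieAlgebra.IsKilling.rootSystem h₀).Base)
    (β₀ : Module.Dual ℂ h₀) (hβ₀ : IsMaximalRoot b β₀)
    (V : Type*) [AddCommGroup V] [Module ℂ V] [LieRingModule (S.tau c a₁ a₂) V]
    [LieModule ℂ (S.tau c a₁ a₂) V] [LieModule.IsIrreducible ℂ (S.tau c a₁ a₂) V]
    (hV : IsIntegrable c a₁ a₂ h₀ V)
    (C₀ : ℝ) (hC₀ : 0 < C₀)
    (hK₀ : ∀ v : V, ⁅(S.central 0 : S.tau c a₁ a₂), v⁆ = (C₀ : ℂ) • v)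
    (hK : ∀ i : Fin (n + 1), i ≠ 0 → ∀ v : V, ⁅(S.central i : S.tau c a₁ a₂), v⁆ = 0) :
    (∃ γ ∈ weights c a₁ a₂ h₀ V, ∀ β, IsPos b β₀ β → ∀ k : Fin n → ℤ,
      γ + β + deltaVec h₀ k ∉ weights c a₁ a₂ h₀ V) ∧
    DirectSum.IsInternal ![tauNeg c a₁ a₂ b β₀, tauZero c a₁ a₂ h₀, tauPos c a₁ a₂ b β₀] ∧
    highestWeightSpace c a₁ a₂ b β₀ V ≠ ⊥ := by
  have H : IsPositiveLevel h₀ c a₁ a₂ V C₀ :=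
    ⟨hroots, grade_le_iSup_gradeRoot hroots hh, hV, hc, hC₀, hK₀, hK⟩
  obtain ⟨γ, hγ, hmax⟩ := H.exists_highest_weight hβ₀
  exact ⟨⟨γ, hγ, hmax⟩, isInternal_triangular hβ₀ H.grade_le,
    highestWeightSpace_ne_bot hβ₀ hγ hmax⟩
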